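/- **Setting.** A probabilistic transition system (PTS) $A=(S,\Sigma,\to,s_0)$ has states $S$, an initial state $s_0$, and transitions ${\to}\subseteq S\times\Sigma\times\mathcal D(S)$, where $\mathcal D(S)$ is the set of discrete probability distributions on $S$; every state has an outgoing transition. Let $A=(S,\Sigma,\to,s_0)$ and $A'=(S',\Sigma\uplus\mathcal F,\to',s_0')$ be PTSs with finitely many states and finitely many transitions ($\mathcal F$ is a set of fault labels). A coupling of $\mu\in\mathcal D(S)$, $\mu'\in\mathcal D(S')$ is a distribution on $S\times S'$ with marginals $\mu,\mu'$. **The masking game** $\mathcal G_{A,A'}$ is the following stochastic game graph. The Refuter owns the vertices $(s,s')\in S\times S'$ and a vertex $v_{\rm err}$. The Verifier owns the vertices $(s,\sigma^1,s',\mu)$ with $s\xrightarrow{\sigma}\mu$, and $(s,\sigma^2,s',\mu')$ with $s'\xrightarrow{\sigma}{}'\mu'$. The probabilistic vertices are $(s,s',\mu,\mu',w)$ with $w$ a coupling of $\mu,\mu'$. The edges are: $(s,s')\to(s,\sigma^1,s',\mu)$ and $(s,s')\to(s,\sigma^2,s',\mu')$ for all such vertices; $(s,\sigma^1,s',\mu)\to(s,s',\mu,\mu',w)$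 if $s'\xrightarrow{\sigma}{}'\mu'$; $(s,\sigma^2,s',\mu')\to(s,s',\mu,\mu',w)$ if $\sigma\notin\mathcal F$ and $s\xrightarrow{\sigma}\mu$; $(s,F^2,s',\mu')\to(s,s',\Delta_s,\mu',w)$ if $F\in\mathcal F$ ($\Delta_s$ is the Dirac distribution); $(s,s',\mu,\mu',w)\to(t,t')$, taken with probability $w(t,t')$, if $w(t,t')>0$; and an edge to $v_{\rm err}$ from $v_{\rm err}$ and from each Verifier vertex without other edges. The initial vertex is $v_0=(s_0,s_0')$. A strategy of a player maps each finite vertex sequence that ends in a vertex of that player to a distribution on the successors of that vertex; it is memoryless if it depends on the last vertex only. A Refuter strategy is *fair* if, against every Verifier strategy, the play from $v_0$ almost surely has the property that, whenever a Refuter vertex occurs infinitely often, so do all of its successors. The game is *almost-sure failing under fairness (and memoryless strategies)* if, for every memoryless Verifier strategy and every fair memoryless Refuter strategy, the play from $v_0$ reaches $v_{\rm err}$ with probability $1$. **The symbolic game graph** has the same Refuter and Verifier vertices, and the probabilistic vertices $(s,s',\mu,\mu')$ with $\mu\in\mathcal D(S)$, $\mu'\in\mathcal D(S')$. Its edges are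 as above without the couplings, with $(s,s',\mu,\mu')\to(t,t')$ for all $t\in\mathrm{Supp}(\mu)$, $t'\in\mathrm{Supp}(\mu')$. Let $V$ be its vertex set. For $v=(s,s',\mu,\mu')$ and $C\subseteq V$, let $Eq(v,C)$ be the system in the variables $x_{t,t'}$ ($t\in\mathrm{Supp}(\mu)$, $t'\in\mathrm{Supp}(\mu')$) $$\sum_{t'}x_{t,t'}=\mu(t),\qquad \sum_{t}x_{t,t'}=\mu'(t'),\qquad x_{t,t'}\ge 0,\qquad \sum_{(t,t')\in C}x_{t,t'}=0 .$$ Let $\exists\mathrm{Pre}(C)$ consist of the probabilistic vertices $(s,s',\mu,\mu')$ for which some $(t,t')\in C$ has $t\in\mathrm{Supp}(\mu)$ and $t'\in\mathrm{Supp}(\mu')$, and of the Verifier and Refuter vertices with some successor in $C$. Let $\forall\mathrm{Pre}(C)$ consist of the probabilistic vertices $v$ for which $Eq(v,C)$ has no solution, the Verifier vertices all of whose successors lie in $C$, and the Refuter vertices with some successor in $C$. Write $\mathrm{Pre}^*(C)=\bigcup_{n\ge0}\mathrm{Pre}^n(C)$. **Theorem.** 1. $\mathcal G_{A,A'}$ is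 almost-sure failing under fairness (and memoryless strategies) if and only if $$v_0\in V\setminus\exists\mathrm{Pre}^*\bigl(V\setminus\forall\mathrm{Pre}^*(\{v_{\rm err}\})\bigr).$$ 2. The problem whether $\mathcal G_{A,A'}$ is almost-sure failing under fairness (and memoryless strategies), for finite $A$ and $A'$ with rational probabilities, is decidable in polynomial time: one random access machine program decides it within a time, under the logarithmic cost criterion, that is polynomial in the number of bits of the input. The input lists the transitions; actions and faults are numbers in binary, and a distribution is given by nonnegative integers $p_t$ in binary, standing for the probabilities $p_t/\sum_u p_u$. -/

import Mathlib

open MeasureTheory ProbabilityTheory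

namespace Masking

noncomputable section

/-! ### Probabilistic transition systems and couplings -/

/-- A probabilistic transition system with states `S` and actions `Act`; every state has an outgoing
transition. Its size is not restricted here. -/
structure PTS (S : Type*) (Act : Type*) where
  init : S
  trans : Set (S × Act × PMF S)
  exists_trans : ∀ s, ∃ a μ, (s, a, μ) ∈ trans

/-- `w` is a coupling for `(μ, μ')`. -/
def IsCoupling {S S' : Type*} (w : PMF (S × S')) (μ : PMF S) (μ' : PMF S') : Prop :=
  w.map Prod.fst = μ ∧ w.map Prod.snd = μ'

/-! ### Stochastic game graphs -/

/-- To which of the three classes of the partition of the vertices a vertex belongs. -/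
inductive Owner where
  | refuter
  | verifier
  | chance

/-- A stochastic game graph for the players Refuter and Verifier. -/
structure StochGame (V : Type*) where
  owner : V → Owner
  Edge : V → V → Prop
  init : V
  δ : ∀ v, owner v = Owner.chance → PMF V
  edge_iff : ∀ v (h : owner v = Owner.chance) v', Edge v v' ↔ v' ∈ (δ v h).support
  exists_edge : ∀ v, owner v ≠ Owner.chance → ∃ v', Edge v v'

namespace StochGame

variable {V : Type*} (G : StochGame V)

def Post (v : V) : Set V := {v' | G.Edge v v'}

/-- A (randomized, history dependent) strategy of player `i`; `choice w v h` is the distribution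
chosen after the history `w · v`. -/
structure Strategy (i : Owner) where
  choice : List V → ∀ v, G.owner v = i → PMF V
  support_subset : ∀ w v h, (choice w v h).support ⊆ G.Post v

variable {G} in
def Strategy.IsMemoryless {i : Owner} (σ : G.Strategy i) : Prop :=
  ∀ w v h, σ.choice w v h = σ.choice [] v h

/-- A nonempty finite sequence of vertices `past · cur`. -/
@[ext]
structure History (V : Type*) where
  past : List V
  cur : V

instance : MeasurableSpace (History V) := ⊤

instance : DiscreteMeasurableSpace (History V) := ⟨fun _ => trivial⟩

variable {G} in
/-- The distribution of the next vertex when the two strategies are used. -/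
def nextVertex (σV : G.Strategy Owner.verifier) (σR : G.Strategy Owner.refuter)
    (x : History V) : PMF V :=
  match h : G.owner x.cur with
  | Owner.refuter => σR.choice x.past x.cur h
  | Owner.verifier => σV.choice x.past x.cur h
  | Owner.chance => G.δ x.cur h

variable {G} in
/-- One step of the Markov chain, on histories, that results from the two strategies. -/
def nextHistory (σV : G.Strategy Owner.verifier) (σR : G.Strategy Owner.refuter)
    (x : History V) : PMF (History V) :=
  (nextVertex σV σR x).map fun v' => ⟨x.past ++ [x.cur], v'⟩

variable {G} in
def stepKernel (σV : G.Strategy Owner.verifier) (σR : G.Strategy Owner.refuter) (n : ℕ) :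
    Kernel ((i : Finset.Iic n) → History V) (History V) where
  toFun h := (nextHistory σV σR (h ⟨n, Finset.mem_Iic.2 le_rfl⟩)).toMeasure
  measurable' :=
    (Measurable.of_discrete (f := fun x : History V => (nextHistory σV σR x).toMeasure)).comp
      (measurable_pi_apply _)

instance (σV : G.Strategy Owner.verifier) (σR : G.Strategy Owner.refuter) (n : ℕ) :
    IsMarkovKernel (stepKernel σV σR n) :=
  ⟨fun _ => PMF.toMeasure.isProbabilityMeasure _⟩

variable {G} in
/-- The probability measure on infinite vertex sequences that the two strategies induce from the
starting vertex `v`: the law of the current vertices of the Markov chain on histories. It is carried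
by the sequences that follow the edges of the graph. -/
def playMeasure [MeasurableSpace V] (σV : G.Strategy Owner.verifier)
    (σR : G.Strategy Owner.refuter) (v : V) : Measure (ℕ → V) :=
  (Kernel.traj (X := fun _ => History V) (stepKernel σV σR) 0 fun _ => ⟨[], v⟩).map
    fun x n => (x n).cur

/-- The event that the vertex `t` is reached. -/
def reach (t : V) : Set (ℕ → V) := {ω | ∃ k, ω k = t}

/-- The set of vertices that occur infinitely often. -/
def infOften (ω : ℕ → V) : Set V := {v | ∃ᶠ k in Filter.atTop, ω k = v}

/-- The Refuter's fair plays. -/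
def fairPlays : Set (ℕ → V) :=
  {ω | ∀ v ∈ infOften ω, G.owner v = Owner.refuter → G.Post v ⊆ infOften ω}

variable {G} in
/-- Almost-sure fairness of a Refuter's strategy: against every Verifier's strategy, with or without
memory. -/
def Strategy.IsFair [MeasurableSpace V] (σR : G.Strategy Owner.refuter) : Prop :=
  ∀ σV : G.Strategy Owner.verifier, playMeasure σV σR G.init G.fairPlays = 1

/-- Under memoryless strategies and fairness of the Refuter, `err` is reached almost surely. -/
def AlmostSureFailing [MeasurableSpace V] (err : V) : Prop :=
  ∀ (σV : G.Strategy Owner.verifier) (σR : G.Strategy Owner.refuter),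
    σV.IsMemoryless → σR.IsMemoryless → σR.IsFair →
      playMeasure σV σR G.init (reach err) = 1

end StochGame

/-! ### The stochastic masking game graph

The implementation has actions `Act ⊕ Flt`: `Sum.inl σ` is the ordinary action `σ` and `Sum.inr F` is
the fault `F`. -/

section Game

variable {S S' Act Flt : Type*}

/-- The vertices of the game. `ref s s'` is `(s,-,s',-,-,-,R)`, `verNom` is `(s,σ¹,s',μ,-,-,V)`,
`verImp` is `(s,σ²,s',-,μ',-,V)`, and `prob` is `(s,-,s',μ,μ',w,P)`. -/
inductive Vertex (A : PTS S Act) (A' : PTS S' (Act ⊕ Flt)) where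
  | err
  | ref (s : S) (s' : S')
  | verNom (s : S) (σ : Act) (s' : S') (μ : PMF S) (h : (s, σ, μ) ∈ A.trans)
  | verImp (s : S) (σ : Act ⊕ Flt) (s' : S') (μ' : PMF S') (h : (s', σ, μ') ∈ A'.trans)
  | prob (s : S) (s' : S') (μ : PMF S) (μ' : PMF S') (w : PMF (S × S')) (h : IsCoupling w μ μ')

variable {A : PTS S Act} {A' : PTS S' (Act ⊕ Flt)}

instance : MeasurableSpace (Vertex A A') := ⊤

def Vertex.owner : Vertex A A' → Owner
  | .err => .refuter
  | .ref _ _ => .refuter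
  | .verNom .. => .verifier
  | .verImp .. => .verifier
  | .prob .. => .chance

/-- The edges that do not lead to the error vertex. -/
inductive Vertex.Move : Vertex A A' → Vertex A A' → Prop
  | nominal {s σ μ} (s' : S') (h : (s, σ, μ) ∈ A.trans) :
      Move (.ref s s') (.verNom s σ s' μ h)
  | implementation {s' σ μ'} (s : S) (h : (s', σ, μ') ∈ A'.trans) :
      Move (.ref s s') (.verImp s σ s' μ' h)
  | matchNominal {s σ s' μ μ' w} (h : (s, σ, μ) ∈ A.trans)
      (h' : (s', Sum.inl σ, μ') ∈ A'.trans) (hw : IsCoupling w μ μ') :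
      Move (.verNom s σ s' μ h) (.prob s s' μ μ' w hw)
  | matchImplementation {s σ s' μ μ' w} (h : (s, σ, μ) ∈ A.trans)
      (h' : (s', Sum.inl σ, μ') ∈ A'.trans) (hw : IsCoupling w μ μ') :
      Move (.verImp s (Sum.inl σ) s' μ' h') (.prob s s' μ μ' w hw)
  | fault {s F s' μ' w} (h' : (s', Sum.inr F, μ') ∈ A'.trans)
      (hw : IsCoupling w (PMF.pure s) μ') :
      Move (.verImp s (Sum.inr F) s' μ' h') (.prob s s' (PMF.pure s) μ' w hw)
  | resolve {s s' μ μ' w t t'} (hw : IsCoupling w μ μ') (h : (t, t') ∈ w.support) :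
      Move (.prob s s' μ μ' w hw) (.ref t t')

/-- The edges of the game: the moves, and an edge to the error vertex from the error vertex and from
each Verifier's vertex without moves. -/
inductive Vertex.Edge : Vertex A A' → Vertex A A' → Prop
  | move {v v'} (h : Move v v') : Edge v v'
  | err {v} (h : v.owner = Owner.verifier ∨ v = .err) (h' : ¬ ∃ v', Move v v') : Edge v .err

def Vertex.δ : ∀ v : Vertex A A', v.owner = Owner.chance → PMF (Vertex A A')
  | .prob _ _ _ _ w _, _ => w.map fun p => .ref p.1 p.2

/-- The stochastic masking game graph of `A` and `A'`. -/
def game (A : PTS S Act) (A' : PTS S' (Act ⊕ Flt)) : StochGame (Vertex A A') where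
  owner := Vertex.owner
  Edge := Vertex.Edge
  init := .ref A.init A'.init
  δ := Vertex.δ
  edge_iff := by
    intro v h v'
    cases v with
    | prob s s' μ μ' w hw =>
      simp only [Vertex.δ, PMF.mem_support_map_iff]
      constructor
      · intro e
        cases e with
        | move m =>
          cases m with
          | resolve _ h => exact ⟨_, h, rfl⟩
        | err h _ => rcases h with h | h <;> simp [Vertex.owner] at h
      · rintro ⟨⟨t, t'⟩, ht, rfl⟩
        exact .move (.resolve hw ht)
    | _ => simp [Vertex.owner] at h
  exists_edge := by
    intro v h
    by_cases hm : ∃ v', Vertex.Move v v'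
    · exact hm.imp fun _ => .move
    · refine ⟨.err, .err ?_ hm⟩
      cases v with
      | ref s s' =>
        obtain ⟨a, μ, ha⟩ := A.exists_trans s
        exact (hm ⟨_, .nominal s' ha⟩).elim
      | prob => simp [Vertex.owner] at h
      | _ => simp [Vertex.owner]

/-- The masking game is almost-sure failing under fairness (and memoryless strategies). -/
def AlmostSureFailing (A : PTS S Act) (A' : PTS S' (Act ⊕ Flt)) : Prop :=
  (game A A').AlmostSureFailing .err

/-! ### The symbolic game graph -/

/-- The vertices of the symbolic game graph: those of the game, without couplings. -/
inductive SymVertex (A : PTS S Act) (A' : PTS S' (Act ⊕ Flt)) where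
  | err
  | ref (s : S) (s' : S')
  | verNom (s : S) (σ : Act) (s' : S') (μ : PMF S) (h : (s, σ, μ) ∈ A.trans)
  | verImp (s : S) (σ : Act ⊕ Flt) (s' : S') (μ' : PMF S') (h : (s', σ, μ') ∈ A'.trans)
  | prob (s : S) (s' : S') (μ : PMF S) (μ' : PMF S')

namespace SymVertex

def owner : SymVertex A A' → Owner
  | .err => .refuter
  | .ref _ _ => .refuter
  | .verNom .. => .verifier
  | .verImp .. => .verifier
  | .prob .. => .chance

/-- The symbolic edges that do not lead to the error vertex. -/
inductive Move : SymVertex A A' → SymVertex A A' → Prop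
  | nominal {s σ μ} (s' : S') (h : (s, σ, μ) ∈ A.trans) :
      Move (.ref s s') (.verNom s σ s' μ h)
  | implementation {s' σ μ'} (s : S) (h : (s', σ, μ') ∈ A'.trans) :
      Move (.ref s s') (.verImp s σ s' μ' h)
  | matchNominal {s σ s' μ μ'} (h : (s, σ, μ) ∈ A.trans)
      (h' : (s', Sum.inl σ, μ') ∈ A'.trans) :
      Move (.verNom s σ s' μ h) (.prob s s' μ μ')
  | matchImplementation {s σ s' μ μ'} (h : (s, σ, μ) ∈ A.trans)
      (h' : (s', Sum.inl σ, μ') ∈ A'.trans) :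
      Move (.verImp s (Sum.inl σ) s' μ' h') (.prob s s' μ μ')
  | fault {s F s' μ'} (h' : (s', Sum.inr F, μ') ∈ A'.trans) :
      Move (.verImp s (Sum.inr F) s' μ' h') (.prob s s' (PMF.pure s) μ')
  | resolve {s s' μ μ' t t'} (h : t ∈ μ.support) (h' : t' ∈ μ'.support) :
      Move (.prob s s' μ μ') (.ref t t')

inductive Edge : SymVertex A A' → SymVertex A A' → Prop
  | move {v v'} (h : Move v v') : Edge v v'
  | err {v} (h : v.owner = Owner.verifier ∨ v = .err) (h' : ¬ ∃ v', Move v v') : Edge v .err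

/-- `x` solves the system `Eq(v, C)` of the vertex `v = (s,-,s',μ,μ',P)`: it solves the transportation
system of `μ` and `μ'`, whose variables are the pairs of states in the supports, and the sum of the
variables of the pairs that lie in `C` is zero. -/
def IsSolution (μ : PMF S) (μ' : PMF S') (C : Set (SymVertex A A'))
    (x : μ.support → μ'.support → ℝ) : Prop :=
  (∀ k, ∑ᶠ j, x k j = (μ k).toReal) ∧
  (∀ j, ∑ᶠ k, x k j = (μ' j).toReal) ∧
  (∀ k j, 0 ≤ x k j) ∧
  ∑ᶠ p ∈ {p : μ.support × μ'.support | (ref p.1 p.2 : SymVertex A A') ∈ C}, x p.1 p.2 = 0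

def existsPre (C : Set (SymVertex A A')) : Set (SymVertex A A') :=
  {v | ∃ s s' μ μ', v = prob s s' μ μ' ∧ ∃ t t', ref t t' ∈ C ∧ t ∈ μ.support ∧ t' ∈ μ'.support} ∪
  {v | (v.owner = Owner.verifier ∨ v.owner = Owner.refuter) ∧ ∃ v' ∈ C, Edge v v'}

def forallPre (C : Set (SymVertex A A')) : Set (SymVertex A A') :=
  {v | ∃ s s' μ μ', v = prob s s' μ μ' ∧ ¬ ∃ x, IsSolution μ μ' C x} ∪
  {v | v.owner = Owner.verifier ∧ ∀ v', Edge v v' → v' ∈ C} ∪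
  {v | v.owner = Owner.refuter ∧ ∃ v' ∈ C, Edge v v'}

end SymVertex

/-- All vertices that some finite number of applications of the predecessor operator `Pre`, possibly
none, yields from `C`. -/
def preStar {X : Type*} (Pre : Set X → Set X) (C : Set X) : Set X :=
  ⋃ n : ℕ, Pre^[n] C

end Game

/-! ### Random access machines with logarithmic cost -/

namespace RAM

/-- Integer expressions; `get e` is the content of the memory cell with address `e`. -/
inductive Expr where
  | lit (z : ℤ)
  | get (e : Expr)
  | add (a b : Expr)
  | sub (a b : Expr)
  | mul (a b : Expr)
  | div (a b : Expr)

/-- A memory: one integer in each cell. -/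
abbrev Mem := ℤ → ℤ

/-- The number of bits of an integer, plus one for its sign. -/
def bits (z : ℤ) : ℕ := Nat.size z.natAbs + 1

def Expr.eval (m : Mem) : Expr → ℤ
  | lit z => z
  | get e => m (e.eval m)
  | add a b => a.eval m + b.eval m
  | sub a b => a.eval m - b.eval m
  | mul a b => a.eval m * b.eval m
  | div a b => a.eval m / b.eval m

/-- The logarithmic cost of an evaluation: the number of bits of all the addresses, operands and
results that occur in it. -/
def Expr.cost (m : Mem) : Expr → ℕ
  | lit z => bits z
  | get e => e.cost m + bits (m (e.eval m))
  | add a b => a.cost m + b.cost m + bits ((add a b).eval m)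
  | sub a b => a.cost m + b.cost m + bits ((sub a b).eval m)
  | mul a b => a.cost m + b.cost m + bits ((mul a b).eval m)
  | div a b => a.cost m + b.cost m + bits ((div a b).eval m)

/-- Programs; `store a b` writes the value of `b` into the cell with address `a`, and the tests of
`ite` and `loop` are whether the expression is positive. -/
inductive Program where
  | skip
  | store (a b : Expr)
  | seq (p q : Program)
  | ite (e : Expr) (p q : Program)
  | loop (e : Expr) (p : Program)

/-- `Run p m t m'`: started on the memory `m`, the program `p` halts after the time `t`, leaving the
memory `m'`. -/
inductive Run : Program → Mem → ℕ → Mem → Prop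
  | skip (m : Mem) : Run .skip m 1 m
  | store (a b : Expr) (m : Mem) :
      Run (.store a b) m (1 + a.cost m + b.cost m) (Function.update m (a.eval m) (b.eval m))
  | seq {p q m m₁ m₂ t₁ t₂} (h₁ : Run p m t₁ m₁) (h₂ : Run q m₁ t₂ m₂) :
      Run (.seq p q) m (1 + t₁ + t₂) m₂
  | ite_pos {e p q m m₁ t} (he : 0 < e.eval m) (h : Run p m t m₁) :
      Run (.ite e p q) m (1 + e.cost m + t) m₁
  | ite_neg {e p q m m₁ t} (he : ¬ 0 < e.eval m) (h : Run q m t m₁) :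
      Run (.ite e p q) m (1 + e.cost m + t) m₁
  | loop_pos {e p m m₁ m₂ t₁ t₂} (he : 0 < e.eval m) (h₁ : Run p m t₁ m₁)
      (h₂ : Run (.loop e p) m₁ t₂ m₂) :
      Run (.loop e p) m (1 + e.cost m + t₁ + t₂) m₂
  | loop_neg {e p m} (he : ¬ 0 < e.eval m) : Run (.loop e p) m (1 + e.cost m) m

/-- The initial memory on the input `l`: the length of `l` in cell `0`, its entries in the cells
`1, 2, …`, and `0` elsewhere. -/
def load (l : List ℤ) : Mem := fun a =>
  if a = 0 then l.length else if 0 < a then l.getD (a.toNat - 1) 0 else 0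

/-- The size of an input: its total number of bits. -/
def inputSize (l : List ℤ) : ℕ := (l.map bits).sum

/-- A single program decides `Q` on all inputs, in time polynomial in the number of bits of the input
(the answer is yes if cell `0` finally holds `1`, and no otherwise). -/
def DecidableInPolyTime {α : Type*} (encode : α → List ℤ) (Q : α → Prop) : Prop :=
  ∃ (p : Program) (P : Polynomial ℕ), ∀ x : α, ∃ t m,
    Run p (load (encode x)) t m ∧ t ≤ P.eval (inputSize (encode x)) ∧ (m 0 = 1 ↔ Q x)

end RAM

/-! ### Finite rational systems as inputs -/

/-- A transition with a rational distribution on `Fin n`, given by nonnegative integer numerators over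
their sum as the common denominator. -/
structure RatTrans (n : ℕ) (Act : Type) where
  src : Fin n
  act : Act
  weight : Fin n → ℕ
  sum_ne_zero : ∑ i, weight i ≠ 0

def RatTrans.dist {n : ℕ} {Act : Type} (t : RatTrans n Act) : PMF (Fin n) :=
  PMF.normalize (fun i => (t.weight i : ENNReal))
    (by
      rw [tsum_fintype]
      exact_mod_cast t.sum_ne_zero)
    (by
      rw [tsum_fintype]
      exact_mod_cast ENNReal.natCast_ne_top (∑ i, t.weight i))

/-- A finite PTS with rational probabilities, given by the list of its transitions. -/
structure RatPTS (Act : Type) where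
  n : ℕ
  init : Fin n
  trans : List (RatTrans n Act)
  exists_trans : ∀ s, ∃ t ∈ trans, t.src = s

def RatPTS.toPTS {Act : Type} (A : RatPTS Act) : PTS (Fin A.n) Act where
  init := A.init
  trans := {p | ∃ t ∈ A.trans, p = (t.src, t.act, t.dist)}
  exists_trans s := by
    obtain ⟨t, ht, rfl⟩ := A.exists_trans s
    exact ⟨_, _, t, ht, rfl⟩

def RatTrans.encode {n : ℕ} {Act : Type} (act : Act → List ℤ) (t : RatTrans n Act) : List ℤ :=
  (t.src : ℤ) :: act t.act ++ List.ofFn fun i => (t.weight i : ℤ)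

def RatPTS.encode {Act : Type} (act : Act → List ℤ) (A : RatPTS Act) : List ℤ :=
  [(A.n : ℤ), (A.init : ℤ), (A.trans.length : ℤ)] ++ A.trans.flatMap (RatTrans.encode act)

/-- The input for a nominal model and an implementation; actions and faults are numbered. -/
def encodePair (x : RatPTS ℕ × RatPTS (ℕ ⊕ ℕ)) : List ℤ :=
  x.1.encode (fun a : ℕ => [(a : ℤ)]) ++
    x.2.encode (Sum.elim (fun a : ℕ => [0, (a : ℤ)]) fun F : ℕ => [1, (F : ℤ)])

end

end Masking

open Masking

/-! Write U for `preStar forallPre {err}`. Two facts make U usable. `Eq(v, C)` is solvable exactly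
when some coupling avoids `C` (`exists_isSolution_iff_coupling`), so the symbolic operator speaks
about the real game. And each vertex of U depends on finitely many others, so U is closed under
`forallPre` after ω stages (`forallPre_preStar_subset`).

If the initial vertex is outside `∃Pre*(V \ U)`, no play can leave U. Almost surely some Refuter
vertex recurs, as there are finitely many. By fairness, and by the conditional Borel–Cantelli lemma
for the memoryless Verifier and for chance (`infOften_of_infOften`), recurrence passes on to all
successors of a recurrent Refuter vertex, to some answer of a recurrent Verifier vertex, and to all
outcomes of that answer. A recurrent Refuter vertex of least stage in U must lead to the error
vertex: otherwise one round of the game yields another of smaller stage (`exists_eq_err`).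

If the initial vertex is inside that set, let the Refuter choose uniformly among all successors,
which is fair. Let the Verifier stay outside U once there, by a coupling that avoids U, and inside U
choose uniformly among all answers with the coupling of independent choices, whose support is the
full product. Then a symbolic path out of U is followed with positive probability
(`exists_pos_isSafe`), and from outside U the error vertex is never reached
(`IsSafeStrategy.isSafe_step`).

For the complexity, a round of the game is compressed to a condition on pairs of states
(`almostSureFailing_iff_pairs`): a least "bad" relation, whose rounds ask whether a coupling avoids
the bad pairs, and then backward reachability from the pairs that are not bad. Each is reached by
repeated sweeps over tables, every unfinished sweep marking a new pair.

The coupling test is a transportation problem, characterised by the condition of Hall and Gale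
(`exists_isTransport_iff_hall`) and decided by load balancing. All supply starts in a dummy column;
amounts D are moved from columns to others whose excess is smaller by at least 2D, and D is halved
from phase to phase. A move lowers the sum of the squared excesses by 2D² (`sum_sq_move`); a stable
load of a feasible problem has excesses at most 3ND (`IsLoad.le_of_isStable`), so the next phase
starts with a small potential and needs polynomially many sweeps. The data are scaled by 2^N, so an
infeasible problem shows an excess above 3N at the end, by integrality.

The algorithm is written in a language of bounded loops over arrays without multiplication. An
assignment then adds a constant number of bits only, which bounds numbers and logarithmic cost
polynomially after compilation to the machine (`AProg.exists_simulates`). -/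

namespace Masking

noncomputable section

/-! ### The Markov chain of histories and conditional Borel–Cantelli -/

namespace StochGame

variable {V : Type*} {G : StochGame V}

/-- The law of the Markov chain of histories. -/
def historyLaw (σV : G.Strategy Owner.verifier) (σR : G.Strategy Owner.refuter) (v : V) :
    Measure (ℕ → History V) :=
  Kernel.traj (X := fun _ => History V) (stepKernel σV σR) 0 fun _ => ⟨[], v⟩

variable (σV : G.Strategy Owner.verifier) (σR : G.Strategy Owner.refuter) (v : V)

instance : IsProbabilityMeasure (historyLaw σV σR v) := by
  unfold historyLaw; infer_instance

theorem measurable_cur [MeasurableSpace V] :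
    Measurable fun (x : ℕ → History V) n => (x n).cur :=
  measurable_pi_lambda _ fun n =>
    (Measurable.of_discrete (f := fun h : History V => h.cur)).comp (measurable_pi_apply n)

theorem playMeasure_eq_map [MeasurableSpace V] :
    playMeasure σV σR v = (historyLaw σV σR v).map fun x n => (x n).cur := rfl

instance [MeasurableSpace V] : IsProbabilityMeasure (playMeasure σV σR v) := by
  rw [playMeasure_eq_map]
  exact Measure.isProbabilityMeasure_map measurable_cur.aemeasurable

/-- The joint law of the first `n` steps and the next one is a composition product; on the event
that the history is `x` the kernel is constant, so the integral over a rectangle is a product. -/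
theorem historyLaw_step (n : ℕ) (x : History V) (B : Set (History V)) :
    historyLaw σV σR v {ω | ω n = x ∧ ω (n + 1) ∈ B} =
      historyLaw σV σR v {ω | ω n = x} * (nextHistory σV σR x).toMeasure B := by
  have h := Kernel.partialTraj_compProd_eq_map_traj (X := fun _ => History V)
    (κ := stepKernel σV σR) (Nat.zero_le n) (x₀ := fun _ => ⟨[], v⟩)
  let A : Set ((i : Finset.Iic n) → History V) := {y | y ⟨n, Finset.mem_Iic.2 le_rfl⟩ = x}
  have hA : MeasurableSet A :=
    measurable_pi_apply (X := fun _ : Finset.Iic n => History V) ⟨n, Finset.mem_Iic.2 le_rfl⟩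
      (MeasurableSet.of_discrete (s := {x}))
  have hB : MeasurableSet B := .of_discrete
  have h1 := congrArg (fun μ => μ (A ×ˢ B)) h
  rw [Measure.map_apply (by fun_prop) (hA.prod hB), Measure.compProd_apply_prod hA hB] at h1
  have h2 : historyLaw σV σR v {ω | ω n = x ∧ ω (n + 1) ∈ B} = ∫⁻ a in A, stepKernel σV σR n a B
      ∂Kernel.partialTraj (X := fun _ => History V) (stepKernel σV σR) 0 n fun _ => ⟨[], v⟩ := by
    rw [h1]; rfl
  rw [h2, setLIntegral_congr_fun (g := fun _ => (nextHistory σV σR x).toMeasure B) hA,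
    setLIntegral_const, mul_comm, ← Kernel.traj_map_frestrictLe_apply,
    Measure.map_apply (by fun_prop) hA]
  · rfl
  · intro y hy
    change (nextHistory σV σR (y ⟨n, _⟩)).toMeasure B = _
    rw [show y ⟨n, _⟩ = x from hy]

theorem historyLaw_zero : ∀ᵐ ω ∂historyLaw σV σR v, ω 0 = ⟨[], v⟩ := by
  have h := Kernel.traj_map_frestrictLe_apply (X := fun _ => History V)
    (κ := stepKernel σV σR) 0 0 fun _ => ⟨[], v⟩
  rw [Kernel.partialTraj_self, Kernel.id_apply] at h
  have hA : MeasurableSet {y : (i : Finset.Iic 0) → History V |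
      y ⟨0, Finset.mem_Iic.2 le_rfl⟩ = ⟨[], v⟩} :=
    measurable_pi_apply (X := fun _ : Finset.Iic 0 => History V) ⟨0, Finset.mem_Iic.2 le_rfl⟩
      (MeasurableSet.of_discrete (s := {(⟨[], v⟩ : History V)}))
  have h2 : ∀ᵐ y ∂(Measure.dirac (fun _ : Finset.Iic 0 => (⟨[], v⟩ : History V))),
      y ⟨0, Finset.mem_Iic.2 le_rfl⟩ = ⟨[], v⟩ := by
    rw [ae_dirac_iff hA]
  rw [← h] at h2
  exact ae_of_ae_map (by fun_prop) h2

/-- The histories that occur at time `n` with positive probability. -/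
def possible : ℕ → Set (History V)
  | 0 => {⟨[], v⟩}
  | n + 1 => ⋃ x ∈ possible n, (nextHistory σV σR x).support

theorem countable_possible (n : ℕ) : (possible σV σR v n).Countable := by
  induction n with
  | zero => exact Set.countable_singleton _
  | succ n ih => exact ih.biUnion fun x _ => PMF.support_countable _

/-- Vertices carry couplings, so there may be uncountably many histories, and a null set for each of
them would not do. Distributions have countable support, hence only countably many histories are
possible at each time, and the null sets can be united. -/
theorem historyLaw_mem_support :
    ∀ᵐ ω ∂historyLaw σV σR v, ω 0 = ⟨[], v⟩ ∧
      ∀ n, ω (n + 1) ∈ (nextHistory σV σR (ω n)).support := by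
  have hstep : ∀ n (x : History V), ∀ᵐ ω ∂historyLaw σV σR v, ω n = x →
      ω (n + 1) ∈ (nextHistory σV σR x).support := by
    intro n x
    have h := historyLaw_step σV σR v n x ((nextHistory σV σR x).supportᶜ)
    rw [(PMF.toMeasure_apply_eq_zero_iff _ .of_discrete).2 disjoint_compl_right, mul_zero] at h
    rw [ae_iff]
    convert h using 3
    simp
  have hposs : ∀ n, ∀ᵐ ω ∂historyLaw σV σR v, ω n ∈ possible σV σR v n := by
    intro n
    induction n with
    | zero => exact historyLaw_zero σV σR v
    | succ n ih =>
      have h := (ae_ball_iff (countable_possible σV σR v n)).2 fun x _ => hstep n x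
      filter_upwards [ih, h] with ω h1 h2
      exact Set.mem_biUnion h1 (h2 _ h1 rfl)
  have h1 : ∀ᵐ ω ∂historyLaw σV σR v, ∀ n, ∀ x ∈ possible σV σR v n, ω n = x →
      ω (n + 1) ∈ (nextHistory σV σR x).support :=
    ae_all_iff.2 fun n => (ae_ball_iff (countable_possible σV σR v n)).2 fun x _ => hstep n x
  filter_upwards [historyLaw_zero σV σR v, h1, ae_all_iff.2 hposs] with ω a b c
  exact ⟨a, fun n => b n _ (c n) rfl⟩

/-- Extends a history of positive probability by one step; used to realise a finite path. -/
theorem historyLaw_pos_succ {n : ℕ} {x y : History V}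
    (hx : historyLaw σV σR v {ω | ω n = x} ≠ 0) (hy : y ∈ (nextHistory σV σR x).support) :
    historyLaw σV σR v {ω | ω (n + 1) = y} ≠ 0 := by
  have h := historyLaw_step σV σR v n x {y}
  rw [PMF.toMeasure_apply_singleton _ _ .of_discrete] at h
  intro h0
  have : historyLaw σV σR v {ω | ω n = x ∧ ω (n + 1) ∈ ({y} : Set (History V))} = 0 :=
    measure_mono_null (fun ω hω => hω.2) h0
  rw [this] at h
  exact (mul_ne_zero hx ((PMF.mem_support_iff _ _).1 hy)) h.symm

theorem mem_support_nextHistory {x : History V} {y : History V} :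
    y ∈ (nextHistory σV σR x).support ↔
      y.past = x.past ++ [x.cur] ∧ y.cur ∈ (nextVertex σV σR x).support := by
  rw [nextHistory, PMF.mem_support_map_iff]
  constructor
  · rintro ⟨a, ha, rfl⟩
    exact ⟨rfl, ha⟩
  · rintro ⟨h1, h2⟩
    exact ⟨_, h2, by ext1 <;> simp [h1]⟩

theorem support_nextVertex_subset (x : History V) :
    (nextVertex σV σR x).support ⊆ G.Post x.cur := by
  intro y hy
  unfold nextVertex at hy
  split at hy
  · exact σR.support_subset _ _ _ hy
  · exact σV.support_subset _ _ _ hy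
  · rename_i h
    exact (G.edge_iff _ h _).2 hy

theorem nextVertex_of_refuter {x : History V} (h : G.owner x.cur = .refuter) :
    nextVertex σV σR x = σR.choice x.past x.cur h := by
  unfold nextVertex
  split
  · rfl
  all_goals rename_i h'; rw [h] at h'; cases h'

theorem nextVertex_of_verifier {x : History V} (h : G.owner x.cur = .verifier) :
    nextVertex σV σR x = σV.choice x.past x.cur h := by
  unfold nextVertex
  split
  · rename_i h'; rw [h] at h'; cases h'
  · rfl
  · rename_i h'; rw [h] at h'; cases h'

theorem nextVertex_of_chance {x : History V} (h : G.owner x.cur = .chance) :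
    nextVertex σV σR x = G.δ x.cur h := by
  unfold nextVertex
  split
  · rename_i h'; rw [h] at h'; cases h'
  · rename_i h'; rw [h] at h'; cases h'
  · rfl

/-- The input for Lévy's form of the Borel–Cantelli lemma: given the past, the next vertex has the
distribution prescribed by the strategies. -/
theorem condExp_step (n : ℕ) (w : V) :
    condExp (Filtration.piLE (X := fun _ : ℕ => History V) n) (historyLaw σV σR v)
        ({ω : ℕ → History V | (ω (n + 1)).cur = w}.indicator (1 : (ℕ → History V) → ℝ))
      =ᵐ[historyLaw σV σR v]
      fun ω => (nextVertex σV σR (ω n) w).toReal := by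
  have hm : MeasurableSet {ω : ℕ → History V | (ω (n + 1)).cur = w} :=
    measurable_pi_apply (X := fun _ : ℕ => History V) (n + 1)
      (MeasurableSet.of_discrete (s := {h : History V | h.cur = w}))
  have h := Kernel.condExp_traj (X := fun _ => History V) (κ := stepKernel σV σR)
    (Nat.zero_le n) (x₀ := fun _ => ⟨[], v⟩)
    (f := {ω : ℕ → History V | (ω (n + 1)).cur = w}.indicator (1 : (ℕ → History V) → ℝ))
    ((integrable_const (1 : ℝ)).indicator hm)
  refine h.trans (Filter.Eventually.of_forall fun ω => ?_)
  simp only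
  rw [integral_indicator_one hm, Measure.real]
  congr 1
  have h3 := congrArg (fun κ => κ (Preorder.frestrictLe n ω) {h : History V | h.cur = w})
    (Kernel.map_traj_succ_self (X := fun _ => History V) (κ := stepKernel σV σR) (a := n))
  rw [Kernel.map_apply' _ (by fun_prop) _ .of_discrete] at h3
  refine h3.trans ?_
  change (nextHistory σV σR (ω n)).toMeasure {h : History V | h.cur = w} = _
  rw [nextHistory, PMF.toMeasure_apply_eq_toOuterMeasure, PMF.toOuterMeasure_map_apply]
  exact PMF.toOuterMeasure_apply_singleton _ _

/-- Conditional Borel–Cantelli: each visit to `a` adds the same `p > 0` to the sum of the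
conditional probabilities of `b`, so infinitely many visits make this sum diverge. -/
theorem infOften_of_infOften {a b : V} {p : ENNReal} (hp : p ≠ 0)
    (h : ∀ x : History V, x.cur = a → nextVertex σV σR x b = p) :
    ∀ᵐ ω ∂historyLaw σV σR v, (∃ᶠ k in Filter.atTop, (ω k).cur = a) →
      ∃ᶠ k in Filter.atTop, (ω k).cur = b := by
  have hL := ae_mem_limsup_atTop_iff (ℱ := Filtration.piLE (X := fun _ : ℕ => History V))
    (historyLaw σV σR v) (s := fun n => {ω : ℕ → History V | (ω n).cur = b}) (by
      intro n
      rw [Filtration.piLE_eq_comap_frestrictLe]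
      exact ⟨{y | (y ⟨n, Finset.mem_Iic.2 le_rfl⟩).cur = b},
        measurable_pi_apply (X := fun _ : Finset.Iic n => History V) _
          (MeasurableSet.of_discrete (s := {h : History V | h.cur = b})), rfl⟩)
  filter_upwards [hL, ae_all_iff.2 fun n => condExp_step σV σR v n b] with ω h1 h2 h3
  refine (Filter.mem_limsup_iff_frequently_mem
    (s := fun n => {ω : ℕ → History V | (ω n).cur = b})).1 (h1.2 ?_)
  simp only [h2]
  have hp1 : p ≠ ⊤ := by
    obtain ⟨k, hk⟩ := h3.exists
    rw [← h _ hk]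
    exact PMF.apply_ne_top _ _
  have hpos : 0 < p.toReal := ENNReal.toReal_pos hp hp1
  rw [← not_summable_iff_tendsto_nat_atTop_of_nonneg fun _ => ENNReal.toReal_nonneg]
  intro hs
  have := hs.tendsto_atTop_zero.eventually (gt_mem_nhds hpos)
  obtain ⟨k, hk, hk'⟩ := (h3.and_eventually this).exists
  rw [h _ hk] at hk'
  exact lt_irrefl _ hk'

end StochGame

/-! ### Iterated predecessors -/

theorem preStar_subset {X : Type*} {Pre : Set X → Set X} (hPre : Monotone Pre) {C D : Set X}
    (hC : C ⊆ D) (hD : Pre D ⊆ D) : preStar Pre C ⊆ D := by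
  refine Set.iUnion_subset fun n => ?_
  induction n with
  | zero => exact hC
  | succ n ih =>
    rw [Function.iterate_succ_apply']
    exact (hPre ih).trans hD

/-- The iterates increase, so finitely many elements appear at a common stage. Finite dependence
thus takes the place of continuity of the operator. -/
theorem exists_subset_iterate {X : Type*} {Pre : Set X → Set X} (hPre : Monotone Pre) {C : Set X}
    (hC : C ⊆ Pre C) {F : Set X} (hF : F.Finite) (h : F ⊆ preStar Pre C) :
    ∃ n, F ⊆ Pre^[n] C := by
  have hm : Monotone fun n => Pre^[n] C := hPre.monotone_iterate_of_le_map hC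
  have : ∀ v ∈ F, ∀ᶠ n in Filter.atTop, v ∈ Pre^[n] C := by
    intro v hv
    obtain ⟨n, hn⟩ := Set.mem_iUnion.1 (h hv)
    exact Filter.eventually_atTop.2 ⟨n, fun m hnm => hm hnm hn⟩
  exact ((Filter.eventually_all_finite hF).2 this).exists

/-! ### Couplings and solutions -/

/-- The coupling of independent choices. -/
def prodCoupling {S S' : Type*} (μ : PMF S) (μ' : PMF S') : PMF (S × S') :=
  μ.bind fun t => μ'.map (Prod.mk t)

section Coupling

variable {S S' : Type*}

theorem isCoupling_prodCoupling (μ : PMF S) (μ' : PMF S') :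
    IsCoupling (prodCoupling μ μ') μ μ' := by
  constructor
  · rw [prodCoupling, PMF.map_bind]
    simp only [PMF.map_comp, Function.comp_def]
    exact (congrArg _ (funext fun t => PMF.map_const _ _)).trans (PMF.bind_pure μ)
  · rw [prodCoupling, PMF.map_bind]
    simp only [PMF.map_comp, Function.comp_def]
    exact (congrArg _ (funext fun t => PMF.map_id _)).trans (PMF.bind_const μ μ')

theorem mem_support_prodCoupling {μ : PMF S} {μ' : PMF S'} {t : S} {t' : S'} :
    (t, t') ∈ (prodCoupling μ μ').support ↔ t ∈ μ.support ∧ t' ∈ μ'.support := by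
  simp only [prodCoupling, PMF.mem_support_bind_iff, PMF.mem_support_map_iff, Prod.mk.injEq]
  constructor
  · rintro ⟨a, ha, b, hb, rfl, rfl⟩
    exact ⟨ha, hb⟩
  · rintro ⟨ha, hb⟩
    exact ⟨t, ha, t', hb, rfl, rfl⟩

theorem IsCoupling.mem_support {w : PMF (S × S')} {μ : PMF S} {μ' : PMF S'}
    (h : IsCoupling w μ μ') {p : S × S'} (hp : p ∈ w.support) :
    p.1 ∈ μ.support ∧ p.2 ∈ μ'.support := by
  rw [← h.1, ← h.2]
  exact ⟨(PMF.mem_support_map_iff _ _ _).2 ⟨p, hp, rfl⟩,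
    (PMF.mem_support_map_iff _ _ _).2 ⟨p, hp, rfl⟩⟩

theorem finsum_subtype_eq_sum [Fintype S] {s : Set S} {F : S → ℝ} (hF : ∀ i ∉ s, F i = 0) :
    ∑ᶠ i : s, F i = ∑ i, F i := by
  rw [finsum_set_coe_eq_finsum_mem, ← finsum_eq_sum_of_fintype]
  refine (finsum_mem_inter_support_eq F s Set.univ ?_).trans (finsum_mem_univ F)
  ext i
  simp only [Set.mem_inter_iff, Function.mem_support, Set.mem_univ, true_and, and_iff_right_iff_imp]
  intro hi
  by_contra h
  exact hi (hF i h)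

theorem sum_toReal [Fintype S] (μ : PMF S) : ∑ t, (μ t).toReal = 1 := by
  rw [← ENNReal.toReal_sum fun _ _ => μ.apply_ne_top _, ← tsum_fintype (L := .unconditional S), μ.tsum_coe,
    ENNReal.toReal_one]

theorem map_fst_apply [Fintype S] [Fintype S'] (w : PMF (S × S')) (t : S) :
    w.map Prod.fst t = ∑ t', w (t, t') := by
  classical
  rw [PMF.map_apply, tsum_fintype, Fintype.sum_prod_type, Finset.sum_eq_single t]
  · simp
  · intro b _ hb
    exact Finset.sum_eq_zero fun _ _ => if_neg hb.symm
  · simp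

theorem map_snd_apply [Fintype S] [Fintype S'] (w : PMF (S × S')) (t' : S') :
    w.map Prod.snd t' = ∑ t, w (t, t') := by
  classical
  rw [PMF.map_apply, tsum_fintype, Fintype.sum_prod_type]
  refine Finset.sum_congr rfl fun t _ => ?_
  rw [Finset.sum_eq_single t']
  · simp
  · intro b _ hb
    exact if_neg hb.symm
  · simp

/-- A coupling outside `C`, as a matrix. -/
def IsTransport [Fintype S] [Fintype S'] (μ : PMF S) (μ' : PMF S') (C : Set (S × S'))
    (y : S → S' → ℝ) : Prop :=
  (∀ t, ∑ t', y t t' = (μ t).toReal) ∧ (∀ t', ∑ t, y t t' = (μ' t').toReal) ∧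
    (∀ t t', 0 ≤ y t t') ∧ ∀ t t', (t, t') ∈ C → y t t' = 0

theorem exists_coupling_iff [Fintype S] [Fintype S'] (μ : PMF S) (μ' : PMF S')
    (C : Set (S × S')) :
    (∃ w, IsCoupling w μ μ' ∧ ∀ p ∈ w.support, p ∉ C) ↔ ∃ y, IsTransport μ μ' C y := by
  constructor
  · rintro ⟨w, ⟨h1, h2⟩, h3⟩
    refine ⟨fun t t' => (w (t, t')).toReal, fun t => ?_, fun t' => ?_,
      fun _ _ => ENNReal.toReal_nonneg, fun t t' h => ?_⟩
    · rw [← h1, map_fst_apply, ENNReal.toReal_sum fun _ _ => w.apply_ne_top _]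
    · rw [← h2, map_snd_apply, ENNReal.toReal_sum fun _ _ => w.apply_ne_top _]
    · by_contra hne
      refine h3 (t, t') ?_ h
      rw [PMF.mem_support_iff]
      intro h0
      exact hne (by simp only [h0, ENNReal.toReal_zero])
  · rintro ⟨y, h1, h2, h3, h4⟩
    have hy : ∑ p : S × S', ENNReal.ofReal (y p.1 p.2) = 1 := by
      rw [← ENNReal.ofReal_sum_of_nonneg fun p _ => h3 p.1 p.2, Fintype.sum_prod_type]
      simp only [h1, sum_toReal, ENNReal.ofReal_one]
    refine ⟨PMF.ofFintype (fun p => ENNReal.ofReal (y p.1 p.2)) hy, ⟨?_, ?_⟩, ?_⟩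
    · ext t
      rw [map_fst_apply]
      simp only [PMF.ofFintype_apply]
      rw [← ENNReal.ofReal_sum_of_nonneg fun t' _ => h3 t t', h1,
        ENNReal.ofReal_toReal (μ.apply_ne_top _)]
    · ext t'
      rw [map_snd_apply]
      simp only [PMF.ofFintype_apply]
      rw [← ENNReal.ofReal_sum_of_nonneg fun t _ => h3 t t', h2,
        ENNReal.ofReal_toReal (μ'.apply_ne_top _)]
    · intro p hp hC
      rw [PMF.mem_support_iff, PMF.ofFintype_apply, h4 p.1 p.2 hC, ENNReal.ofReal_zero] at hp
      exact hp rfl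

variable {Act Flt : Type*} {A : PTS S Act} {A' : PTS S' (Act ⊕ Flt)}

theorem exists_isSolution_iff [Fintype S] [Fintype S'] (μ : PMF S) (μ' : PMF S')
    (C : Set (SymVertex A A')) :
    (∃ x, SymVertex.IsSolution μ μ' C x) ↔
      ∃ y, IsTransport μ μ' {p | (.ref p.1 p.2 : SymVertex A A') ∈ C} y := by
  classical
  constructor
  · rintro ⟨x, h1, h2, h3, h4⟩
    let y : S → S' → ℝ := fun t t' =>
      if h : t ∈ μ.support ∧ t' ∈ μ'.support then x ⟨t, h.1⟩ ⟨t', h.2⟩ else 0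
    have hy : ∀ (k : μ.support) (j : μ'.support), y k j = x k j := fun k j =>
      dif_pos ⟨k.2, j.2⟩
    refine ⟨y, fun t => ?_, fun t' => ?_, fun t t' => ?_, fun t t' h => ?_⟩
    · by_cases ht : t ∈ μ.support
      · rw [← h1 ⟨t, ht⟩, ← finsum_subtype_eq_sum (s := μ'.support)]
        · exact finsum_congr fun j => hy ⟨t, ht⟩ j
        · exact fun t' ht' => dif_neg fun h => ht' h.2
      · rw [(PMF.apply_eq_zero_iff _ _).2 ht, ENNReal.toReal_zero]
        exact Finset.sum_eq_zero fun t' _ => dif_neg fun h => ht h.1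
    · by_cases ht : t' ∈ μ'.support
      · rw [← h2 ⟨t', ht⟩, ← finsum_subtype_eq_sum (s := μ.support)]
        · exact finsum_congr fun k => hy k ⟨t', ht⟩
        · exact fun t ht' => dif_neg fun h => ht' h.1
      · rw [(PMF.apply_eq_zero_iff _ _).2 ht, ENNReal.toReal_zero]
        exact Finset.sum_eq_zero fun t' _ => dif_neg fun h => ht h.2
    · dsimp only [y]
      split
      · exact h3 _ _
      · exact le_rfl
    · dsimp only [y]
      split
      · rename_i hs
        rw [finsum_mem_eq_finite_toFinset_sum _ (Set.toFinite _),
          Finset.sum_eq_zero_iff_of_nonneg fun p _ => h3 p.1 p.2] at h4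
        exact h4 (⟨t, hs.1⟩, ⟨t', hs.2⟩) ((Set.Finite.mem_toFinset _).2 h)
      · rfl
  · rintro ⟨y, h1, h2, h3, h4⟩
    refine ⟨fun k j => y k j, fun k => ?_, fun j => ?_, fun k j => h3 _ _, ?_⟩
    · rw [finsum_subtype_eq_sum (F := fun j => y k j), h1]
      intro j hj
      have := h2 j
      rw [(PMF.apply_eq_zero_iff _ _).2 hj, ENNReal.toReal_zero,
        Finset.sum_eq_zero_iff_of_nonneg fun t _ => h3 t j] at this
      exact this _ (Finset.mem_univ _)
    · rw [finsum_subtype_eq_sum (F := fun k => y k j), h2]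
      intro k hk
      have := h1 k
      rw [(PMF.apply_eq_zero_iff _ _).2 hk, ENNReal.toReal_zero,
        Finset.sum_eq_zero_iff_of_nonneg fun t _ => h3 k t] at this
      exact this _ (Finset.mem_univ _)
    · exact finsum_mem_eq_zero_of_forall_eq_zero fun p hp => h4 _ _ hp

/-- The link between the two graphs: the linear system decides the Verifier's question whether a
coupling keeps the next pair outside `C`. -/
theorem exists_isSolution_iff_coupling [Finite S] [Finite S'] (μ : PMF S) (μ' : PMF S')
    (C : Set (SymVertex A A')) :
    (∃ x, SymVertex.IsSolution μ μ' C x) ↔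
      ∃ w, IsCoupling w μ μ' ∧ ∀ p ∈ w.support, (.ref p.1 p.2 : SymVertex A A') ∉ C := by
  cases nonempty_fintype S
  cases nonempty_fintype S'
  rw [exists_isSolution_iff, ← exists_coupling_iff]
  rfl

end Coupling

/-! ### The predecessor operators -/

namespace SymVertex

variable {S S' Act Flt : Type*} {A : PTS S Act} {A' : PTS S' (Act ⊕ Flt)}

theorem edge_err : Edge (.err : SymVertex A A') .err :=
  .err (.inr rfl) fun ⟨_, h⟩ => nomatch h

theorem existsPre_mono : Monotone (existsPre (A := A) (A' := A')) := by
  rintro C D h v (⟨s, s', μ, μ', rfl, t, t', ht, h'⟩ | ⟨ho, v', hv', he⟩)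
  · exact .inl ⟨s, s', μ, μ', rfl, t, t', h ht, h'⟩
  · exact .inr ⟨ho, v', h hv', he⟩

theorem mem_existsPre {C : Set (SymVertex A A')} {v v' : SymVertex A A'} (h : Edge v v')
    (hv' : v' ∈ C) : v ∈ existsPre C := by
  cases v with
  | prob s s' μ μ' =>
    rcases h with h | ⟨h, -⟩
    · cases h with
      | resolve h1 h2 => exact .inl ⟨s, s', μ, μ', rfl, _, _, hv', h1, h2⟩
    · rcases h with h | h <;> nomatch h
  | verNom => exact .inr ⟨.inl rfl, _, hv', h⟩
  | verImp => exact .inr ⟨.inl rfl, _, hv', h⟩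
  | _ => exact .inr ⟨.inr rfl, _, hv', h⟩

theorem mem_existsPre_iff {C : Set (SymVertex A A')} {v : SymVertex A A'} :
    v ∈ existsPre C ↔ ∃ v' ∈ C, Edge v v' := by
  refine ⟨?_, fun ⟨v', h, h'⟩ => mem_existsPre h' h⟩
  rintro (⟨s, s', μ, μ', rfl, t, t', ht, h1, h2⟩ | ⟨-, h⟩)
  · exact ⟨_, ht, .move (.resolve h1 h2)⟩
  · exact h

theorem prob_mem_forallPre_iff [Finite S] [Finite S'] {C : Set (SymVertex A A')} {s s' μ μ'} :
    (prob s s' μ μ' : SymVertex A A') ∈ forallPre C ↔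
      ∀ w, IsCoupling w μ μ' → ∃ p ∈ w.support, (ref p.1 p.2 : SymVertex A A') ∈ C := by
  have h : (prob s s' μ μ' : SymVertex A A') ∈ forallPre C ↔ ¬ ∃ x, IsSolution μ μ' C x := by
    constructor
    · rintro ((⟨s, s', μ, μ', h, hx⟩ | ⟨h, -⟩) | ⟨h, -⟩)
      · cases h
        exact hx
      · nomatch h
      · nomatch h
    · exact fun h => .inl (.inl ⟨s, s', μ, μ', rfl, h⟩)
  rw [h, exists_isSolution_iff_coupling]
  push Not
  rfl

theorem mem_forallPre_of_verifier {C : Set (SymVertex A A')} {v : SymVertex A A'}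
    (h : v.owner = .verifier) : v ∈ forallPre C ↔ ∀ v', Edge v v' → v' ∈ C := by
  constructor
  · rintro ((⟨s, s', μ, μ', rfl, hx⟩ | ⟨-, h'⟩) | ⟨h', -⟩)
    · nomatch h
    · exact h'
    · rw [h] at h'; nomatch h'
  · exact fun h' => .inl (.inr ⟨h, h'⟩)

theorem mem_forallPre_of_refuter {C : Set (SymVertex A A')} {v : SymVertex A A'}
    (h : v.owner = .refuter) : v ∈ forallPre C ↔ ∃ v' ∈ C, Edge v v' := by
  constructor
  · rintro ((⟨s, s', μ, μ', rfl, hx⟩ | ⟨h', -⟩) | ⟨-, h'⟩)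
    · nomatch h
    · rw [h] at h'; nomatch h'
    · exact h'
  · exact fun h' => .inr ⟨h, h'⟩

theorem forallPre_mono [Finite S] [Finite S'] : Monotone (forallPre (A := A) (A' := A')) := by
  rintro C D h v hv
  cases ho : v.owner with
  | refuter =>
    rw [mem_forallPre_of_refuter ho] at hv ⊢
    exact hv.imp fun v' h' => ⟨h h'.1, h'.2⟩
  | verifier =>
    rw [mem_forallPre_of_verifier ho] at hv ⊢
    exact fun v' h' => h (hv v' h')
  | chance =>
    cases v with
    | prob s s' μ μ' =>
      rw [prob_mem_forallPre_iff] at hv ⊢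
      exact fun w hw => (hv w hw).imp fun p hp => ⟨hp.1, h hp.2⟩
    | _ => nomatch ho

/-- The loop at the error vertex makes the stages of the attractor increase. -/
theorem err_subset_forallPre : ({err} : Set (SymVertex A A')) ⊆ forallPre {err} := by
  rintro _ rfl
  exact .inr ⟨rfl, _, rfl, edge_err⟩

theorem finite_post_verifier (hA : A.trans.Finite) (hA' : A'.trans.Finite) {v : SymVertex A A'}
    (hv : v.owner = .verifier) : {v' | Edge v v'}.Finite := by
  cases v with
  | verNom s σ s' μ h =>
    refine ((hA'.image fun t => (prob s s' μ t.2.2 : SymVertex A A')).insert err).subset ?_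
    rintro v' (e | _)
    · cases e with
      | matchNominal _ h' => exact .inr ⟨_, h', rfl⟩
    · exact .inl rfl
  | verImp s σ s' μ' h =>
    refine (((hA.image fun t => (prob s s' t.2.2 μ' : SymVertex A A')).insert
      (prob s s' (PMF.pure s) μ')).insert err).subset ?_
    rintro v' (e | _)
    · cases e with
      | matchImplementation h' _ => exact .inr (.inr ⟨_, h', rfl⟩)
      | fault => exact .inr (.inl rfl)
    · exact .inl rfl
  | _ => nomatch hv

/-- Membership in `forallPre` is witnessed by a finite set: one successor for the Refuter, the
finitely many answers for the Verifier, the finitely many pairs of states for chance. That set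
already lies in one stage, and its predecessor in the next. -/
theorem forallPre_preStar_subset [Finite S] [Finite S'] (hA : A.trans.Finite) (hA' : A'.trans.Finite) :
    forallPre (preStar forallPre ({err} : Set (SymVertex A A'))) ⊆
      preStar forallPre ({err} : Set (SymVertex A A')) := by
  intro v hv
  have key : ∀ F : Set (SymVertex A A'), F.Finite → F ⊆ preStar forallPre {err} →
      (∀ n, F ⊆ forallPre^[n] {err} → v ∈ forallPre^[n + 1] {err}) →
      v ∈ preStar forallPre ({err} : Set (SymVertex A A')) := by
    intro F hF hF' h
    obtain ⟨n, hn⟩ := exists_subset_iterate forallPre_mono err_subset_forallPre hF hF'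
    exact Set.mem_iUnion.2 ⟨n + 1, h n hn⟩
  cases ho : v.owner with
  | refuter =>
    obtain ⟨v', h, e⟩ := (mem_forallPre_of_refuter ho).1 hv
    refine key {v'} (Set.finite_singleton _) (by simpa using h) fun n hn => ?_
    rw [Function.iterate_succ_apply', mem_forallPre_of_refuter ho]
    exact ⟨v', hn rfl, e⟩
  | verifier =>
    rw [mem_forallPre_of_verifier ho] at hv
    refine key _ (finite_post_verifier hA hA' ho) hv fun n hn => ?_
    rw [Function.iterate_succ_apply', mem_forallPre_of_verifier ho]
    exact hn
  | chance =>
    cases v with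
    | prob s s' μ μ' =>
      rw [prob_mem_forallPre_iff] at hv
      refine key (Set.range (fun p : S × S' => ref p.1 p.2) ∩ preStar forallPre {err})
        ((Set.finite_range _).inter_of_left _) Set.inter_subset_right fun n hn => ?_
      rw [Function.iterate_succ_apply', prob_mem_forallPre_iff]
      exact fun w hw => (hv w hw).imp fun p hp => ⟨hp.1, hn ⟨⟨p, rfl⟩, hp.2⟩⟩
    | _ => nomatch ho

theorem existsPre_preStar_subset (C : Set (SymVertex A A')) :
    existsPre (preStar existsPre C) ⊆ preStar existsPre C := by
  intro v hv
  obtain ⟨v', hv', e⟩ := mem_existsPre_iff.1 hv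
  obtain ⟨n, hn⟩ := Set.mem_iUnion.1 hv'
  refine Set.mem_iUnion.2 ⟨n + 1, ?_⟩
  rw [Function.iterate_succ_apply']
  exact mem_existsPre e hn

end SymVertex

/-! ### The game and the symbolic game -/

namespace Vertex

variable {S S' Act Flt : Type*} {A : PTS S Act} {A' : PTS S' (Act ⊕ Flt)}

/-- Forgetting the coupling. -/
def toSym : Vertex A A' → SymVertex A A'
  | .err => .err
  | .ref s s' => .ref s s'
  | .verNom s σ s' μ h => .verNom s σ s' μ h
  | .verImp s σ s' μ' h => .verImp s σ s' μ' h
  | .prob s s' μ μ' _ _ => .prob s s' μ μ'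

@[simp]
theorem owner_toSym (v : Vertex A A') : v.toSym.owner = v.owner := by cases v <;> rfl

theorem toSym_eq_err {v : Vertex A A'} : v.toSym = .err ↔ v = .err := by
  cases v <;> simp [toSym]

theorem Move.toSym {v v' : Vertex A A'} (h : Move v v') : SymVertex.Move v.toSym v'.toSym := by
  cases h with
  | nominal s' h => exact .nominal s' h
  | implementation s h => exact .implementation s h
  | matchNominal h h' hw => exact .matchNominal h h'
  | matchImplementation h h' hw => exact .matchImplementation h h'
  | fault h' hw => exact .fault h'
  | resolve hw h => exact .resolve (hw.mem_support h).1 (hw.mem_support h).2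

/-- If the vertex is probabilistic, its coupling is that of independent choices. -/
def IsIndep : Vertex A A' → Prop
  | .prob _ _ μ μ' w _ => w = prodCoupling μ μ'
  | _ => True

/-- Symbolic moves lift to the game along independent couplings: their support is the product of the
two supports, so no symbolic outcome is lost. -/
theorem exists_move_of_toSym {v : Vertex A A'} (hv : v.IsIndep) {y : SymVertex A A'}
    (h : SymVertex.Move v.toSym y) : ∃ v', Move v v' ∧ v'.toSym = y ∧ v'.IsIndep := by
  cases v with
  | err => nomatch h
  | ref s s' =>
    cases h with
    | nominal _ h => exact ⟨_, .nominal s' h, rfl, trivial⟩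
    | implementation _ h => exact ⟨_, .implementation s h, rfl, trivial⟩
  | verNom s σ s' μ h0 =>
    cases h with
    | matchNominal h h' => exact ⟨_, .matchNominal h0 h' (isCoupling_prodCoupling _ _), rfl, rfl⟩
  | verImp s σ s' μ' h0 =>
    cases h with
    | matchImplementation h h' =>
      exact ⟨_, .matchImplementation h h0 (isCoupling_prodCoupling _ _), rfl, rfl⟩
    | fault h' => exact ⟨_, .fault h0 (isCoupling_prodCoupling _ _), rfl, rfl⟩
  | prob s s' μ μ' w hw =>
    cases h with
    | resolve h h' =>
      refine ⟨_, .resolve hw ?_, rfl, trivial⟩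
      rw [show w = prodCoupling μ μ' from hv]
      exact mem_support_prodCoupling.2 ⟨h, h'⟩

theorem exists_move_iff {v : Vertex A A'} (hv : v.IsIndep) :
    (∃ v', Move v v') ↔ ∃ y, SymVertex.Move v.toSym y :=
  ⟨fun ⟨_, h⟩ => ⟨_, h.toSym⟩, fun ⟨_, h⟩ =>
    (exists_move_of_toSym hv h).imp fun _ h => h.1⟩

theorem isIndep_of_owner {v : Vertex A A'} (h : v.owner ≠ .chance) : v.IsIndep := by
  cases v with
  | prob => exact (h rfl).elim
  | _ => trivial

theorem Edge.toSym {v v' : Vertex A A'} (h : Edge v v') : SymVertex.Edge v.toSym v'.toSym := by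
  cases h with
  | move h => exact .move h.toSym
  | err h h' =>
    have ho : v.owner ≠ .chance := by
      rcases h with h | rfl
      · rw [h]; nofun
      · nofun
    exact .err (by rwa [owner_toSym, toSym_eq_err])
      (by rwa [← exists_move_iff (isIndep_of_owner ho)])

theorem exists_edge_of_toSym {v : Vertex A A'} (hv : v.IsIndep) {y : SymVertex A A'}
    (h : SymVertex.Edge v.toSym y) : ∃ v', Edge v v' ∧ v'.toSym = y ∧ v'.IsIndep := by
  cases h with
  | move h => exact (exists_move_of_toSym hv h).imp fun _ h => ⟨.move h.1, h.2⟩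
  | err h h' =>
    exact ⟨.err, .err (by rwa [owner_toSym, toSym_eq_err] at h) (by rwa [exists_move_iff hv]),
      rfl, trivial⟩

theorem edge_err_iff {v' : Vertex A A'} : Edge .err v' ↔ v' = .err := by
  constructor
  · rintro (h | _)
    · nomatch h
    · rfl
  · rintro rfl
    exact .err (.inr rfl) fun ⟨_, h⟩ => nomatch h

/-- Couplings can make the set of probabilistic vertices infinite; finiteness is available for the
vertices of the players only, and the recurrence argument is therefore built on these. -/
theorem finite_refuter [Finite S] [Finite S'] :
    {v : Vertex A A' | v.owner = .refuter}.Finite := by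
  refine ((Set.finite_range fun p : S × S' => (ref p.1 p.2 : Vertex A A')).insert err).subset ?_
  rintro (_ | ⟨s, s'⟩ | _ | _ | _) h
  · exact .inl rfl
  · exact .inr ⟨(s, s'), rfl⟩
  all_goals nomatch h

theorem finite_verifier [Finite S] [Finite S'] (hA : A.trans.Finite) (hA' : A'.trans.Finite) :
    {v : Vertex A A' | v.owner = .verifier}.Finite := by
  have := hA.to_subtype
  have := hA'.to_subtype
  refine ((Set.finite_range fun p : A.trans × S' =>
    (verNom p.1.1.1 p.1.1.2.1 p.2 p.1.1.2.2 p.1.2 : Vertex A A')).union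
    (Set.finite_range fun p : A'.trans × S =>
    (verImp p.2 p.1.1.2.1 p.1.1.1 p.1.1.2.2 p.1.2 : Vertex A A'))).subset ?_
  rintro (_ | _ | ⟨s, σ, s', μ, h⟩ | ⟨s, σ, s', μ', h⟩ | _) hv
  · nomatch hv
  · nomatch hv
  · exact .inl ⟨(⟨_, h⟩, s'), rfl⟩
  · exact .inr ⟨(⟨_, h⟩, s), rfl⟩
  · nomatch hv

theorem finite_post_refuter [Finite S] [Finite S'] (hA : A.trans.Finite) (hA' : A'.trans.Finite)
    {v : Vertex A A'} (hv : v.owner = .refuter) : {v' | Edge v v'}.Finite := by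
  refine ((finite_verifier hA hA').insert err).subset ?_
  rintro v' (h | _)
  · cases h with
    | nominal => exact .inr rfl
    | implementation => exact .inr rfl
    | _ => nomatch hv
  · exact .inl rfl

end Vertex

/-! ### Memoryless strategies and recurrence -/

namespace StochGame

variable {V : Type*} {G : StochGame V}

theorem exists_memoryless (i : Owner) (c : V → Set V)
    (hc : ∀ v, G.owner v = i → (c v).Finite ∧ (c v).Nonempty ∧ c v ⊆ G.Post v) :
    ∃ σ : G.Strategy i, σ.IsMemoryless ∧ ∀ w v h, (σ.choice w v h).support = c v := by
  let p : ∀ v, G.owner v = i → PMF V := fun v h => PMF.uniformOfFinset (hc v h).1.toFinset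
    ((Set.Finite.toFinset_nonempty _).2 (hc v h).2.1)
  have hp : ∀ v h, (p v h).support = c v := by
    intro v h
    rw [PMF.support_uniformOfFinset, Set.Finite.coe_toFinset]
  refine ⟨⟨fun _ v h => p v h, fun _ v h => ?_⟩, fun _ _ _ => rfl, fun _ v h => hp v h⟩
  rw [hp v h]
  exact (hc v h).2.2

/-- For a memoryless Refuter's strategy, a vertex that is chosen with positive probability
recurs. -/
theorem IsMemoryless.infOften_refuter (σV : G.Strategy Owner.verifier)
    {σR : G.Strategy Owner.refuter} (hR : σR.IsMemoryless) (v : V) {a b : V}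
    (ha : G.owner a = .refuter) (hb : b ∈ (σR.choice [] a ha).support) :
    ∀ᵐ ω ∂historyLaw σV σR v, (∃ᶠ k in Filter.atTop, (ω k).cur = a) →
      ∃ᶠ k in Filter.atTop, (ω k).cur = b := by
  refine infOften_of_infOften σV σR v ((PMF.mem_support_iff _ _).1 hb) ?_
  rintro ⟨w, _⟩ rfl
  rw [nextVertex_of_refuter σV σR ha, hR]

theorem IsMemoryless.infOften_verifier {σV : G.Strategy Owner.verifier}
    (hV : σV.IsMemoryless) (σR : G.Strategy Owner.refuter) (v : V) {a b : V}
    (ha : G.owner a = .verifier) (hb : b ∈ (σV.choice [] a ha).support) :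
    ∀ᵐ ω ∂historyLaw σV σR v, (∃ᶠ k in Filter.atTop, (ω k).cur = a) →
      ∃ᶠ k in Filter.atTop, (ω k).cur = b := by
  refine infOften_of_infOften σV σR v ((PMF.mem_support_iff _ _).1 hb) ?_
  rintro ⟨w, _⟩ rfl
  rw [nextVertex_of_verifier σV σR ha, hV]

theorem infOften_chance (σV : G.Strategy Owner.verifier) (σR : G.Strategy Owner.refuter) (v : V)
    {a b : V} (ha : G.owner a = .chance) (hb : G.Edge a b) :
    ∀ᵐ ω ∂historyLaw σV σR v, (∃ᶠ k in Filter.atTop, (ω k).cur = a) →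
      ∃ᶠ k in Filter.atTop, (ω k).cur = b := by
  refine infOften_of_infOften σV σR v ((PMF.mem_support_iff _ _).1 ((G.edge_iff a ha b).1 hb)) ?_
  rintro ⟨w, _⟩ rfl
  rw [nextVertex_of_chance σV σR ha]

end StochGame

/-! ### Plays that stay in the attractor reach the error vertex -/

open StochGame

variable {S S' Act Flt : Type*} {A : PTS S Act} {A' : PTS S' (Act ⊕ Flt)}

/-- Needed to turn probability one into an almost sure statement. Fairness is a countable
combination of recurrence events, as it concerns finitely many Refuter vertices with finitely many
successors. -/
theorem measurableSet_fairPlays [Finite S] [Finite S'] (hA : A.trans.Finite) (hA' : A'.trans.Finite) :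
    MeasurableSet (game A A').fairPlays := by
  have hinf : ∀ a : Vertex A A', MeasurableSet {ω : ℕ → Vertex A A' | a ∈ infOften ω} := by
    intro a
    have : {ω : ℕ → Vertex A A' | a ∈ infOften ω} =
        Filter.limsup (fun n => {ω | ω n = a}) Filter.atTop := by
      ext ω
      exact (Filter.mem_limsup_iff_frequently_mem
        (s := fun n => {ω : ℕ → Vertex A A' | ω n = a})).symm
    rw [this]
    exact MeasurableSet.measurableSet_limsup fun n =>
      measurable_pi_apply (X := fun _ : ℕ => Vertex A A') n (show MeasurableSet {a} from trivial)
  have : (game A A').fairPlays = ⋂ a ∈ {v : Vertex A A' | v.owner = .refuter},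
      {ω | a ∈ infOften ω}ᶜ ∪ ⋂ b ∈ {v' | Vertex.Edge a v'}, {ω | b ∈ infOften ω} := by
    ext ω
    simp only [fairPlays, Set.mem_ofPred_eq, Set.mem_iInter, Set.mem_union, Set.mem_compl_iff]
    constructor
    · intro h a ha
      by_cases hi : a ∈ infOften ω
      · exact .inr fun b hb => h a hi ha hb
      · exact .inl hi
    · intro h a hi ha b hb
      exact (h a ha).resolve_left (fun h => h hi) b hb
  rw [this]
  refine MeasurableSet.biInter Vertex.finite_refuter.countable fun a ha => ?_
  exact (hinf a).compl.union (MeasurableSet.biInter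
    (Vertex.finite_post_refuter hA hA' ha).countable fun b _ => hinf b)

theorem measurableSet_reach (a : Vertex A A') : MeasurableSet (reach a) := by
  have : reach a = ⋃ n, {ω : ℕ → Vertex A A' | ω n = a} := by
    ext ω
    simp [reach]
  rw [this]
  exact MeasurableSet.iUnion fun n =>
    measurable_pi_apply (X := fun _ : ℕ => Vertex A A') n (show MeasurableSet {a} from trivial)

/-- Along the edges of the game a play meets Refuter's vertices again and again. -/
theorem exists_refuter_ge {ω : ℕ → Vertex A A'} (h : ∀ n, Vertex.Edge (ω n) (ω (n + 1))) (n : ℕ) :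
    ∃ m ≥ n, (ω m).owner = .refuter := by
  have hp : ∀ m, (ω m).owner = .chance → (ω (m + 1)).owner = .refuter := by
    intro m hm
    have e := h m
    revert e hm
    generalize ω m = v, ω (m + 1) = v'
    rintro hm (e | ⟨e, -⟩)
    · cases e with
      | resolve => rfl
      | _ => nomatch hm
    · rfl
  have hv : ∀ m, (ω m).owner = .verifier → (ω (m + 1)).owner ≠ .verifier := by
    intro m hm
    have e := h m
    revert e hm
    generalize ω m = v, ω (m + 1) = v'
    rintro hm (e | ⟨e, -⟩)
    · cases e with
      | nominal => nomatch hm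
      | implementation => nomatch hm
      | _ => nofun
    · nofun
  cases h0 : (ω n).owner with
  | refuter => exact ⟨n, le_rfl, h0⟩
  | chance => exact ⟨n + 1, by omega, hp n h0⟩
  | verifier =>
    cases h1 : (ω (n + 1)).owner with
    | refuter => exact ⟨n + 1, by omega, h1⟩
    | chance => exact ⟨n + 2, by omega, hp _ h1⟩
    | verifier => exact (hv n h0 h1).elim

/-- If the recurrent vertices of a play are closed under the steps of a fair play and all Refuter's
vertices of the play are in the attractor, the play reaches the error vertex. -/
theorem exists_eq_err [Finite S] [Finite S'] {ω : ℕ → Vertex A A'} (he : ∀ n, Vertex.Edge (ω n) (ω (n + 1)))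
    (hU : ∀ n, (ω n).toSym ∈ preStar SymVertex.forallPre ({.err} : Set (SymVertex A A')))
    (hfair : ∀ a ∈ infOften ω, a.owner = .refuter → ∀ b, Vertex.Edge a b → b ∈ infOften ω)
    (hver : ∀ a ∈ infOften ω, a.owner = .verifier → ∃ b, Vertex.Edge a b ∧ b ∈ infOften ω ∧
      (b.owner = .chance → ∀ r, Vertex.Edge b r → r ∈ infOften ω)) :
    ∃ n, ω n = .err := by
  classical
  have h0 : ∃ a ∈ {v : Vertex A A' | v.owner = .refuter}, a ∈ infOften ω := by
    rw [show (∃ a ∈ {v : Vertex A A' | v.owner = .refuter}, a ∈ infOften ω) ↔ _ from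
      (Filter.frequently_exists_finite (p := fun a k => ω k = a) Vertex.finite_refuter).symm]
    refine Filter.frequently_atTop.2 fun n => ?_
    obtain ⟨m, hm, ho⟩ := exists_refuter_ge he n
    exact ⟨m, hm, _, ho, rfl⟩
  have h1 : ∃ k, ∃ a ∈ infOften ω, a.owner = .refuter ∧
      a.toSym ∈ SymVertex.forallPre^[k] ({.err} : Set (SymVertex A A')) := by
    obtain ⟨a, ha, hi⟩ := h0
    obtain ⟨n, rfl⟩ := hi.exists
    obtain ⟨k, hk⟩ := Set.mem_iUnion.1 (hU n)
    exact ⟨k, _, hi, ha, hk⟩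
  -- Among the recurrent Refuter vertices take one of the least stage `k`. Following one round of
  -- the game from it gives the error vertex or a recurrent Refuter vertex of a smaller stage.
  obtain ⟨a, hi, ho, hk⟩ := Nat.find_spec h1
  have hmin := fun m (hm : m < Nat.find h1) => Nat.find_min h1 hm
  generalize Nat.find h1 = k at hk hmin
  have herr : ∀ b : Vertex A A', b.toSym = .err → b ∈ infOften ω → ∃ n, ω n = .err := by
    intro b hb hb'
    rw [Vertex.toSym_eq_err] at hb
    exact hb'.exists.imp fun n hn => hn.trans hb
  cases k with
  | zero => exact herr a hk hi
  | succ k =>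
    rw [Function.iterate_succ_apply',
      SymVertex.mem_forallPre_of_refuter (by rwa [Vertex.owner_toSym])] at hk
    obtain ⟨y, hy, e⟩ := hk
    obtain ⟨x, ex, rfl, -⟩ := Vertex.exists_edge_of_toSym
      (Vertex.isIndep_of_owner (by rw [ho]; nofun)) e
    have hx := hfair a hi ho x ex
    cases hxo : x.owner with
    | refuter => exact (hmin k (by omega) ⟨x, hx, hxo, hy⟩).elim
    | chance =>
      cases ex with
      | move m =>
        cases m with
        | resolve => nomatch ho
        | nominal => nomatch hxo
        | implementation => nomatch hxo
        | _ => nomatch ho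
      | err => nomatch hxo
    | verifier =>
      cases k with
      | zero => exact herr x hy hx
      | succ k =>
        rw [Function.iterate_succ_apply',
          SymVertex.mem_forallPre_of_verifier (by rwa [Vertex.owner_toSym])] at hy
        obtain ⟨b, hb, hbi, hr⟩ := hver x hx hxo
        have hyb := hy _ hb.toSym
        cases b with
        | prob s s' μ μ' w hw =>
          cases k with
          | zero => nomatch (show (Vertex.prob s s' μ μ' w hw).toSym = .err from hyb)
          | succ k =>
            rw [Function.iterate_succ_apply'] at hyb
            -- Every coupling meets the earlier stage, in particular the one that the Verifier
            -- chose; the outcome recurs and contradicts minimality.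
            obtain ⟨p, hp, hpk⟩ := SymVertex.prob_mem_forallPre_iff.1 hyb w hw
            exact (hmin k (by omega) ⟨.ref p.1 p.2, hr rfl _ (.move (.resolve hw hp)), rfl,
              hpk⟩).elim
        | err => exact herr _ rfl hbi
        | ref => exact (hmin k (by omega) ⟨_, hbi, rfl, hyb⟩).elim
        | _ =>
          cases hb with
          | move m => cases m; nomatch hxo

/-- The complement of `∃Pre*` is closed under symbolic edges, so the projection of the play never
leaves the attractor; almost every play also has the recurrence properties that `exists_eq_err` asks
for. -/
theorem almostSureFailing_of_notMem [Finite S] [Finite S'] (hA : A.trans.Finite) (hA' : A'.trans.Finite)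
    (h : (SymVertex.ref A.init A'.init : SymVertex A A') ∉ preStar SymVertex.existsPre
      (Set.univ \ preStar SymVertex.forallPre {SymVertex.err})) :
    AlmostSureFailing A A' := by
  intro σV σR hV hR hF
  have hfair := hF σV
  rw [← mem_ae_iff_prob_eq_one (measurableSet_fairPlays hA hA')] at hfair
  rw [← mem_ae_iff_prob_eq_one (measurableSet_reach _), playMeasure_eq_map,
    mem_ae_map_iff measurable_cur.aemeasurable (measurableSet_reach _)]
  rw [playMeasure_eq_map,
    mem_ae_map_iff measurable_cur.aemeasurable (measurableSet_fairPlays hA hA')] at hfair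
  set P := historyLaw σV σR (game A A').init
  -- All three quantifiers run over countable sets: finitely many `a` and `r`, and `b` in the
  -- support of a fixed choice because the Verifier is memoryless. This avoids quantifying over all
  -- probabilistic vertices.
  have hver : ∀ᵐ ω ∂P, ∀ a ∈ {v : Vertex A A' | v.owner = .verifier}, ∀ ha : a.owner = .verifier,
      ∀ b ∈ (σV.choice [] a ha).support, ((∃ᶠ k in Filter.atTop, (ω k).cur = a) →
        ∃ᶠ k in Filter.atTop, (ω k).cur = b) ∧ ∀ r ∈ {v : Vertex A A' | v.owner = .refuter},
        b.owner = .chance → Vertex.Edge b r → (∃ᶠ k in Filter.atTop, (ω k).cur = b) →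
        ∃ᶠ k in Filter.atTop, (ω k).cur = r := by
    refine (ae_ball_iff (Vertex.finite_verifier hA hA').countable).2 fun a _ => ?_
    refine ae_all_iff.2 fun ha => (ae_ball_iff (PMF.support_countable _)).2 fun b hb => ?_
    refine (IsMemoryless.infOften_verifier hV σR _ ha hb).and ?_
    refine (ae_ball_iff Vertex.finite_refuter.countable).2 fun r _ => ?_
    refine ae_all_iff.2 fun hb' => ae_all_iff.2 fun hr => ?_
    exact infOften_chance σV σR _ hb' hr
  filter_upwards [hfair, hver, historyLaw_mem_support σV σR (game A A').init] with ω h1 h2 h3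
  have he : ∀ n, Vertex.Edge (ω n).cur (ω (n + 1)).cur := fun n =>
    support_nextVertex_subset σV σR _ ((mem_support_nextHistory σV σR).1 (h3.2 n)).2
  have hE : ∀ n, (ω n).cur.toSym ∉ preStar SymVertex.existsPre
      (Set.univ \ preStar SymVertex.forallPre {SymVertex.err}) := by
    intro n
    induction n with
    | zero => rw [h3.1]; exact h
    | succ n ih =>
      exact fun hn => ih (SymVertex.existsPre_preStar_subset _
        (SymVertex.mem_existsPre (he n).toSym hn))
  refine exists_eq_err he (fun n => ?_) (fun a ha ho b hb => h1 a ha ho hb) fun a ha ho => ?_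
  · by_contra hn
    exact hE n (Set.mem_iUnion.2 ⟨0, trivial, hn⟩)
  · obtain ⟨b, hb⟩ := (σV.choice [] a ho).support_nonempty
    obtain ⟨hab, hr⟩ := h2 a ho ho b hb
    refine ⟨b, σV.support_subset _ _ _ hb, hab ha, fun hbo r hbr => ?_⟩
    refine hr r ?_ hbo hbr (hab ha)
    cases hbr with
    | move m =>
      cases m with
      | resolve => rfl
      | _ => nomatch hbo
    | err => rfl

/-! ### A Verifier strategy that escapes from the attractor -/

/-- The vertices from which the Verifier's safe strategy avoids the error vertex for ever. -/
def IsSafe (U : Set (SymVertex A A')) : Vertex A A' → Prop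
  | .prob _ _ _ _ w _ => ∀ p ∈ w.support, (.ref p.1 p.2 : SymVertex A A') ∉ U
  | v => v.toSym ∉ U

theorem isSafe_of_owner {U : Set (SymVertex A A')} {v : Vertex A A'} (ho : v.owner ≠ .chance)
    (h : v.toSym ∉ U) : IsSafe U v := by
  cases v with
  | prob => exact (ho rfl).elim
  | _ => exact h

theorem toSym_notMem_of_isSafe {U : Set (SymVertex A A')} {v : Vertex A A'}
    (ho : v.owner ≠ .chance) (h : IsSafe U v) : v.toSym ∉ U := by
  cases v with
  | prob => exact (ho rfl).elim
  | _ => exact h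

/-- A Verifier vertex outside a closed set has a symbolic answer outside it. That answer is not the
error vertex, so it is probabilistic, and being outside it admits a coupling all of whose outcomes
avoid `U`. -/
theorem exists_edge_isSafe [Finite S] [Finite S'] {U : Set (SymVertex A A')} (herr : .err ∈ U)
    (hU : SymVertex.forallPre U ⊆ U) {v : Vertex A A'} (ho : v.owner = .verifier)
    (hv : v.toSym ∉ U) : ∃ v', Vertex.Edge v v' ∧ IsSafe U v' := by
  have h1 : v.toSym ∉ SymVertex.forallPre U := fun h => hv (hU h)
  rw [SymVertex.mem_forallPre_of_verifier (by rwa [Vertex.owner_toSym])] at h1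
  push Not at h1
  obtain ⟨y, e, hy⟩ := h1
  have key : ∀ s s' μ μ', y = .prob s s' μ μ' → ∃ w, IsCoupling w μ μ' ∧
      ∀ p ∈ w.support, (.ref p.1 p.2 : SymVertex A A') ∉ U := by
    rintro s s' μ μ' rfl
    have h2 : ¬ _ := fun h => hy (hU h)
    rw [SymVertex.prob_mem_forallPre_iff] at h2
    push Not at h2
    exact h2
  cases e with
  | err => exact (hy herr).elim
  | move m =>
    cases v with
    | verNom s σ s' μ h0 =>
      cases m with
      | matchNominal h h' =>
        obtain ⟨w, hw, hp⟩ := key _ _ _ _ rfl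
        exact ⟨_, .move (.matchNominal h0 h' hw), hp⟩
    | verImp s σ s' μ' h0 =>
      cases m with
      | matchImplementation h h' =>
        obtain ⟨w, hw, hp⟩ := key _ _ _ _ rfl
        exact ⟨_, .move (.matchImplementation h h0 hw), hp⟩
      | fault h' =>
        obtain ⟨w, hw, hp⟩ := key _ _ _ _ rfl
        exact ⟨_, .move (.fault h0 hw), hp⟩
    | _ => nomatch ho

/-- On vertices with independent couplings `toSym` is injective, so finiteness is inherited from the
symbolic graph. A uniform choice among these answers is thus possible, although the couplings may be
infinitely many. -/
theorem finite_indep_post [Finite S] [Finite S'] (hA : A.trans.Finite) (hA' : A'.trans.Finite)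
    {v : Vertex A A'} (ho : v.owner = .verifier) :
    {v' | Vertex.Edge v v' ∧ v'.IsIndep}.Finite := by
  refine Set.Finite.of_finite_image (f := Vertex.toSym)
    ((SymVertex.finite_post_verifier hA hA' (v := v.toSym) (by rwa [Vertex.owner_toSym])).subset
      ?_) ?_
  · rintro _ ⟨v', h, rfl⟩
    exact h.1.toSym
  · rintro x ⟨-, hx⟩ y ⟨-, hy⟩ h
    cases x <;> cases y <;> simp only [Vertex.toSym, SymVertex.prob.injEq, reduceCtorEq,
      SymVertex.ref.injEq, SymVertex.verNom.injEq, SymVertex.verImp.injEq] at h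
    · rfl
    · obtain ⟨rfl, rfl⟩ := h; rfl
    · obtain ⟨rfl, rfl, rfl, rfl⟩ := h; rfl
    · obtain ⟨rfl, rfl, rfl, rfl⟩ := h; rfl
    · obtain ⟨rfl, rfl, rfl, rfl⟩ := h
      simp only [Vertex.IsIndep] at hx hy
      subst hx hy
      rfl

/-- The uniform choice among all successors gives each a fixed positive probability at every visit,
so conditional Borel–Cantelli yields fairness against any Verifier. -/
theorem exists_isFair_full [Finite S] [Finite S'] (hA : A.trans.Finite) (hA' : A'.trans.Finite) :
    ∃ σR : (game A A').Strategy .refuter, σR.IsMemoryless ∧ σR.IsFair ∧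
      ∀ w v h, (σR.choice w v h).support = {v' | Vertex.Edge v v'} := by
  obtain ⟨σR, hR, hs⟩ := exists_memoryless (G := game A A') .refuter
    (fun v => {v' | Vertex.Edge v v'}) fun v hv => ⟨Vertex.finite_post_refuter hA hA' hv,
      (game A A').exists_edge v (by rw [hv]; nofun), subset_rfl⟩
  refine ⟨σR, hR, fun σV => ?_, hs⟩
  rw [← mem_ae_iff_prob_eq_one (measurableSet_fairPlays hA hA'), playMeasure_eq_map,
    mem_ae_map_iff measurable_cur.aemeasurable (measurableSet_fairPlays hA hA')]
  have h : ∀ᵐ ω ∂historyLaw σV σR (game A A').init,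
      ∀ a ∈ {v : Vertex A A' | v.owner = .refuter}, ∀ ha : a.owner = .refuter,
      ∀ b ∈ (σR.choice [] a ha).support, (∃ᶠ k in Filter.atTop, (ω k).cur = a) →
        ∃ᶠ k in Filter.atTop, (ω k).cur = b := by
    refine (ae_ball_iff Vertex.finite_refuter.countable).2 fun a _ => ?_
    refine ae_all_iff.2 fun ha => (ae_ball_iff (PMF.support_countable _)).2 fun b hb => ?_
    exact IsMemoryless.infOften_refuter σV hR _ ha hb
  filter_upwards [h] with ω h a ha ho b hb
  exact h a ho ho b (by rw [hs]; exact hb) ha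

section Safe

variable (U : Set (SymVertex A A')) (σV : (game A A').Strategy .verifier)
  (σR : (game A A').Strategy .refuter)

/-- What the Verifier's safe strategy does: it stays in the safe region, and outside of it takes
every symbolic step with positive probability. -/
structure IsSafeStrategy : Prop where
  safe : ∀ w v h, v.toSym ∉ U → ∀ v' ∈ (σV.choice w v h).support, IsSafe U v'
  full : ∀ w v h, v.toSym ∈ U → ∀ v', Vertex.Edge v v' → v'.IsIndep →
    v' ∈ (σV.choice w v h).support

variable {U σV σR}

theorem exists_isSafeStrategy [Finite S] [Finite S'] (hA : A.trans.Finite) (hA' : A'.trans.Finite)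
    (herr : .err ∈ U) (hU : SymVertex.forallPre U ⊆ U) :
    ∃ σV : (game A A').Strategy .verifier, σV.IsMemoryless ∧ IsSafeStrategy U σV := by
  classical
  choose f hf using fun (v : Vertex A A') (h : v.owner = .verifier ∧ v.toSym ∉ U) =>
    exists_edge_isSafe herr hU h.1 h.2
  obtain ⟨σV, hV, hs⟩ := exists_memoryless (G := game A A') .verifier
    (fun v => if h : v.owner = .verifier ∧ v.toSym ∉ U then {f v h} else
      {v' | Vertex.Edge v v' ∧ v'.IsIndep}) (by
    intro v hv
    split
    · rename_i h
      exact ⟨Set.finite_singleton _, Set.singleton_nonempty _,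
        Set.singleton_subset_iff.2 (hf v h).1⟩
    · refine ⟨finite_indep_post hA hA' hv, ?_, fun _ h => h.1⟩
      obtain ⟨v', h⟩ := (game A A').exists_edge v (by rw [hv]; nofun)
      obtain ⟨x, hx⟩ := Vertex.exists_edge_of_toSym (v := v)
        (Vertex.isIndep_of_owner (by rw [show v.owner = _ from hv]; nofun)) (Vertex.Edge.toSym h)
      exact ⟨x, hx.1, hx.2.2⟩)
  refine ⟨σV, hV, ⟨fun w v h hv v' hv' => ?_, fun w v h hv v' e hi => ?_⟩⟩
  · rw [hs, dif_pos ⟨h, hv⟩] at hv'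
    rw [Set.mem_singleton_iff.1 hv']
    exact (hf v _).2
  · rw [hs, dif_neg fun h => h.2 hv]
    exact ⟨e, hi⟩

/-- Safety is an invariant: the Refuter cannot enter the closed set `U` from outside, the Verifier's
strategy does not, and the coupling at a safe probabilistic vertex has no outcome in `U`. -/
theorem IsSafeStrategy.isSafe_step (hV : IsSafeStrategy U σV) (hU : SymVertex.forallPre U ⊆ U)
    {x : History (Vertex A A')} (hx : IsSafe U x.cur) {y : Vertex A A'}
    (hy : y ∈ (nextVertex σV σR x).support) : IsSafe U y := by
  have e : Vertex.Edge x.cur y := support_nextVertex_subset σV σR x hy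
  cases ho : x.cur.owner with
  | verifier =>
    rw [nextVertex_of_verifier σV σR ho] at hy
    exact hV.safe _ _ _ (toSym_notMem_of_isSafe (by rw [ho]; nofun) hx) _ hy
  | refuter =>
    have h1 : y.toSym ∉ U := fun h => toSym_notMem_of_isSafe (by rw [ho]; nofun) hx
      (hU ((SymVertex.mem_forallPre_of_refuter (by rwa [Vertex.owner_toSym])).2 ⟨_, h, e.toSym⟩))
    refine isSafe_of_owner ?_ h1
    revert ho e
    generalize x.cur = v
    rintro (m | _) ho
    · cases m with
      | nominal => nofun
      | implementation => nofun
      | _ => nomatch ho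
    · nofun
  | chance =>
    revert ho e hx
    generalize x.cur = v
    rintro hx (m | _) ho
    · cases m with
      | resolve hw hp => exact hx _ hp
      | _ => nomatch ho
    · rename_i h _
      rcases h with h | rfl
      · rw [h] at ho; nomatch ho
      · nomatch ho

theorem mem_support_nextVertex_of_indep (hV : IsSafeStrategy U σV)
    (hR : ∀ w v h, (σR.choice w v h).support = {v' | Vertex.Edge v v'})
    {x : History (Vertex A A')} (hx : x.cur.toSym ∈ U) {y : Vertex A A'}
    (e : Vertex.Edge x.cur y) (hy : y.IsIndep) : y ∈ (nextVertex σV σR x).support := by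
  cases ho : x.cur.owner with
  | refuter =>
    rw [nextVertex_of_refuter σV σR ho]
    exact (Set.ext_iff.1 (hR x.past x.cur ho) y).2 e
  | verifier =>
    rw [nextVertex_of_verifier σV σR ho]
    exact hV.full _ _ _ hx _ e hy
  | chance =>
    rw [nextVertex_of_chance σV σR ho]
    exact ((game A A').edge_iff _ ho _).1 e

/-- Induction on the stage of `existsPre`: inside `U` every symbolic edge is taken with positive
probability, and the stage can be lowered until the play is outside `U`. -/
theorem exists_pos_isSafe [Finite S] [Finite S'] (hV : IsSafeStrategy U σV)
    (hR : ∀ w v h, (σR.choice w v h).support = {v' | Vertex.Edge v v'})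
    (hU : SymVertex.forallPre U ⊆ U) (v₀ : Vertex A A') (n : ℕ) :
    ∀ (m : ℕ) (x : History (Vertex A A')), x.cur.IsIndep →
      x.cur.toSym ∈ SymVertex.existsPre^[n] (Set.univ \ U) →
      historyLaw σV σR v₀ {ω | ω m = x} ≠ 0 →
      ∃ m x, IsSafe U x.cur ∧ historyLaw σV σR v₀ {ω | ω m = x} ≠ 0 := by
  have step : ∀ (m : ℕ) (x : History (Vertex A A')) (y : Vertex A A'),
      historyLaw σV σR v₀ {ω | ω m = x} ≠ 0 → y ∈ (nextVertex σV σR x).support →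
      historyLaw σV σR v₀ {ω | ω (m + 1) = ⟨x.past ++ [x.cur], y⟩} ≠ 0 := fun m x y hm hy =>
    historyLaw_pos_succ σV σR v₀ hm ((mem_support_nextHistory σV σR).2 ⟨rfl, hy⟩)
  have base : ∀ (m : ℕ) (x : History (Vertex A A')), x.cur.IsIndep → x.cur.toSym ∉ U →
      historyLaw σV σR v₀ {ω | ω m = x} ≠ 0 →
      ∃ m x, IsSafe U x.cur ∧ historyLaw σV σR v₀ {ω | ω m = x} ≠ 0 := by
    rintro m ⟨past, v⟩ hi hx hm
    by_cases ho : v.owner = .chance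
    · cases v with
      | prob s s' μ μ' w hw =>
        -- Outside `U`, an independent coupling may still have outcomes in `U`, so the vertex itself
        -- need not be safe. But some coupling avoids `U`, and its outcomes also have positive
        -- probability under the independent one; one more step is safe.
        have h2 : ¬ _ := fun h => hx (hU h)
        rw [Vertex.toSym, SymVertex.prob_mem_forallPre_iff] at h2
        push Not at h2
        obtain ⟨w', hw', hp⟩ := h2
        obtain ⟨p, hps⟩ := w'.support_nonempty
        refine ⟨m + 1, _, ?_, step m _ (.ref p.1 p.2) hm ?_⟩
        · exact hp p hps
        · rw [nextVertex_of_chance σV σR rfl]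
          refine ((game A A').edge_iff _ rfl _).1 (.move (.resolve hw ?_))
          rw [show w = prodCoupling μ μ' from hi]
          exact mem_support_prodCoupling.2 (hw'.mem_support hps)
      | _ => nomatch ho
    · exact ⟨m, _, isSafe_of_owner ho hx, hm⟩
  induction n with
  | zero => exact fun m x hi hx => base m x hi hx.2
  | succ n ih =>
    intro m x hi hx hm
    by_cases hxU : x.cur.toSym ∈ U
    · rw [Function.iterate_succ_apply'] at hx
      obtain ⟨y, hy, e⟩ := SymVertex.mem_existsPre_iff.1 hx
      obtain ⟨v', e', rfl, hi'⟩ := Vertex.exists_edge_of_toSym hi e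
      exact ih _ _ hi' hy (step m x v' hm (mem_support_nextVertex_of_indep hV hR hxU e' hi'))
    · exact base m x hi hxU hm

end Safe

/-- Against the uniform Refuter the escaping strategy reaches a safe history with positive
probability; after it the error vertex is impossible, against almost sure failure. -/
theorem notMem_of_almostSureFailing [Finite S] [Finite S'] (hA : A.trans.Finite)
    (hA' : A'.trans.Finite) (h : AlmostSureFailing A A') :
    (SymVertex.ref A.init A'.init : SymVertex A A') ∉ preStar SymVertex.existsPre
      (Set.univ \ preStar SymVertex.forallPre {SymVertex.err}) := by
  intro hmem
  set U : Set (SymVertex A A') := preStar SymVertex.forallPre {SymVertex.err}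
  have herr : SymVertex.err ∈ U := Set.mem_iUnion.2 ⟨0, rfl⟩
  have hU : SymVertex.forallPre U ⊆ U := SymVertex.forallPre_preStar_subset hA hA'
  obtain ⟨σR, hRm, hRf, hR⟩ := exists_isFair_full hA hA'
  obtain ⟨σV, hVm, hV⟩ := exists_isSafeStrategy hA hA' herr hU
  have h1 := h σV σR hVm hRm hRf
  rw [← mem_ae_iff_prob_eq_one (measurableSet_reach _), playMeasure_eq_map,
    mem_ae_map_iff measurable_cur.aemeasurable (measurableSet_reach _)] at h1
  obtain ⟨n, hn⟩ := Set.mem_iUnion.1 hmem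
  obtain ⟨m, x, hx, hm⟩ := exists_pos_isSafe (σR := σR) hV hR hU (game A A').init n 0
    ⟨[], (game A A').init⟩ trivial hn (by
      intro h0
      have := measure_union_null h0 (ae_iff.1 (historyLaw_zero σV σR (game A A').init))
      have huniv : {ω : ℕ → History (Vertex A A') | ω 0 = ⟨[], (game A A').init⟩} ∪
          {ω | ¬ ω 0 = ⟨[], (game A A').init⟩} = Set.univ := Set.union_compl_self _
      rw [huniv, measure_univ] at this
      exact one_ne_zero this)
  refine hm (measure_mono_null (t := {ω | ¬ (ω ∈ (fun (x : ℕ → History (Vertex A A')) n =>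
    (x n).cur) ⁻¹' reach .err ∧ (ω 0 = ⟨[], (game A A').init⟩ ∧
      ∀ n, ω (n + 1) ∈ (nextHistory σV σR (ω n)).support))}) ?_
    (ae_iff.1 (Filter.Eventually.and h1 (historyLaw_mem_support σV σR (game A A').init))))
  rintro ω hω ⟨⟨k, hk⟩, -, hstep⟩
  have hstep' := fun n => ((mem_support_nextHistory σV σR).1 (hstep n)).2
  have hsafe : ∀ j, IsSafe U (ω (m + j)).cur := by
    intro j
    induction j with
    | zero => rw [show ω (m + 0) = x from hω]; exact hx
    | succ j ih => exact hV.isSafe_step hU ih (hstep' _)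
  have hkeep : ∀ j, (ω (k + j)).cur = .err := by
    intro j
    induction j with
    | zero => exact hk
    | succ j ih =>
      have e : Vertex.Edge (ω (k + j)).cur (ω (k + j + 1)).cur :=
        support_nextVertex_subset σV σR _ (hstep' _)
      rw [ih] at e
      exact Vertex.edge_err_iff.1 e
  -- The error vertex is absorbing from time `k` on and safety holds from time `m` on; at time `m +
  -- k` both would be true.
  have h2 := hsafe k
  rw [Nat.add_comm, hkeep m] at h2
  exact h2 herr

theorem almostSureFailing_iff [Finite S] [Finite S'] (hA : A.trans.Finite)
    (hA' : A'.trans.Finite) :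
    AlmostSureFailing A A' ↔ (SymVertex.ref A.init A'.init : SymVertex A A') ∈
      Set.univ \ preStar SymVertex.existsPre
        (Set.univ \ preStar SymVertex.forallPre {SymVertex.err}) :=
  ⟨fun h => ⟨trivial, notMem_of_almostSureFailing hA hA' h⟩,
    fun h => almostSureFailing_of_notMem hA hA' h.2⟩

namespace RAM

/-! ### Sizes of integers and costs of expressions -/

theorem bits_le_iff {z : ℤ} {n : ℕ} : bits z ≤ n + 1 ↔ z.natAbs < 2 ^ n := by
  rw [bits, Nat.add_le_add_iff_right, Nat.size_le]

theorem one_le_bits (z : ℤ) : 1 ≤ bits z := Nat.le_add_left _ _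

theorem natAbs_lt_two_pow_bits (z : ℤ) : z.natAbs < 2 ^ (bits z - 1) := by
  rw [bits, Nat.add_sub_cancel]
  exact Nat.lt_size_self _

theorem bits_le_of_natAbs_le {y z : ℤ} (h : y.natAbs ≤ z.natAbs) : bits y ≤ bits z :=
  Nat.add_le_add_right (Nat.size_le_size h) 1

theorem bits_of_natAbs_le_add {x y z : ℤ} (h : z.natAbs ≤ x.natAbs + y.natAbs) :
    bits z ≤ max (bits x) (bits y) + 1 := by
  have hx := natAbs_lt_two_pow_bits x
  have hy := natAbs_lt_two_pow_bits y
  have h1 := one_le_bits x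
  have h2 : 2 ^ (bits x - 1) ≤ 2 ^ (max (bits x) (bits y) - 1) :=
    Nat.pow_le_pow_right (by norm_num) (by omega)
  have h3 : 2 ^ (bits y - 1) ≤ 2 ^ (max (bits x) (bits y) - 1) :=
    Nat.pow_le_pow_right (by norm_num) (by omega)
  rw [bits_le_iff]
  have h4 : 2 ^ max (bits x) (bits y) = 2 * 2 ^ (max (bits x) (bits y) - 1) := by
    rw [← pow_succ']
    congr 1
    omega
  omega

theorem bits_add_le_max (x y : ℤ) : bits (x + y) ≤ max (bits x) (bits y) + 1 :=
  bits_of_natAbs_le_add (Int.natAbs_add_le x y)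

theorem bits_sub_le_max (x y : ℤ) : bits (x - y) ≤ max (bits x) (bits y) + 1 :=
  bits_of_natAbs_le_add (Int.natAbs_sub_le x y)

theorem bits_div_le (x y : ℤ) : bits (x / y) ≤ bits x :=
  bits_le_of_natAbs_le (Int.natAbs_ediv_le_natAbs x y)

theorem bits_add_le (x y : ℤ) : bits (x + y) ≤ bits x + bits y := by
  have := bits_add_le_max x y
  have := one_le_bits x
  have := one_le_bits y
  omega

theorem bits_sub_le (x y : ℤ) : bits (x - y) ≤ bits x + bits y := by
  have := bits_sub_le_max x y
  have := one_le_bits x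
  have := one_le_bits y
  omega

theorem bits_mul_le (x y : ℤ) : bits (x * y) ≤ bits x + bits y := by
  have h1 := one_le_bits x
  have h2 := one_le_bits y
  have h : bits (x * y) ≤ (bits x - 1 + (bits y - 1)) + 1 := by
    rw [bits_le_iff, Int.natAbs_mul, pow_add]
    exact Nat.mul_lt_mul'' (natAbs_lt_two_pow_bits x) (natAbs_lt_two_pow_bits y)
  omega

theorem bits_natCast_le (n : ℕ) : bits n ≤ n + 1 := by
  rw [bits_le_iff, Int.natAbs_natCast]
  exact Nat.lt_two_pow_self

/-- All cells hold at most `B` bits. -/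
def Mem.Bounded (m : Mem) (B : ℕ) : Prop := ∀ z, bits (m z) ≤ B

theorem Mem.Bounded.mono {m : Mem} {B B' : ℕ} (h : m.Bounded B) (hB : B ≤ B') : m.Bounded B' :=
  fun z => (h z).trans hB

theorem Mem.Bounded.update {m : Mem} {B : ℕ} (h : m.Bounded B) (a : ℤ) {z : ℤ} (hz : bits z ≤ B) :
    Mem.Bounded (Function.update m a z) B := by
  intro y
  by_cases hy : y = a
  · subst hy; simpa
  · rw [Function.update_of_ne hy]; exact h y

/-- The value and the cost of an expression are linear in the size of the memory. -/
theorem Expr.exists_cost_le (e : Expr) :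
    ∃ c, ∀ (m : Mem) (B : ℕ), m.Bounded B → bits (e.eval m) ≤ c * (B + 1) ∧
      e.cost m ≤ c * (B + 1) := by
  have binary : ∀ (a b : Expr) (op : ℤ → ℤ → ℤ), (∀ x y, bits (op x y) ≤ bits x + bits y) →
      (∃ c, ∀ (m : Mem) (B : ℕ), m.Bounded B → bits (a.eval m) ≤ c * (B + 1) ∧
        a.cost m ≤ c * (B + 1)) →
      (∃ c, ∀ (m : Mem) (B : ℕ), m.Bounded B → bits (b.eval m) ≤ c * (B + 1) ∧
        b.cost m ≤ c * (B + 1)) →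
      ∃ c, ∀ (m : Mem) (B : ℕ), m.Bounded B → bits (op (a.eval m) (b.eval m)) ≤ c * (B + 1) ∧
        a.cost m + b.cost m + bits (op (a.eval m) (b.eval m)) ≤ c * (B + 1) := by
    rintro a b op hop ⟨c, hc⟩ ⟨d, hd⟩
    refine ⟨2 * (c + d), fun m B hm => ?_⟩
    have h1 := hc m B hm
    have h2 := hd m B hm
    have h3 := hop (a.eval m) (b.eval m)
    have h4 : 2 * (c + d) * (B + 1) = 2 * (c * (B + 1)) + 2 * (d * (B + 1)) := by ring
    rw [h4]
    omega
  induction e with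
  | lit z =>
    refine ⟨bits z, fun m B _ => ?_⟩
    simp only [Expr.eval, Expr.cost, and_self]
    exact Nat.le_mul_of_pos_right _ (Nat.succ_pos _)
  | get e ih =>
    obtain ⟨c, hc⟩ := ih
    refine ⟨c + 1, fun m B hm => ?_⟩
    have h1 := hc m B hm
    have h2 := hm (e.eval m)
    simp only [Expr.eval, Expr.cost, Nat.add_mul, Nat.one_mul]
    omega
  | add a b ha hb => exact binary a b _ bits_add_le ha hb
  | sub a b ha hb => exact binary a b _ bits_sub_le ha hb
  | mul a b ha hb => exact binary a b _ bits_mul_le ha hb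
  | div a b ha hb =>
    exact binary a b _ (fun x y => (bits_div_le x y).trans (Nat.le_add_right _ _)) ha hb

/-! ### Array programs

A language of programs that work on two-dimensional arrays, with arithmetic that lets the numbers
grow by a constant number of bits only, and loops over `0, …, N - 1` for a fixed number `N`. -/

/-- The contents of the arrays; the arrays are numbered. -/
abbrev Store := ℕ → ℕ → ℕ → ℤ

def Store.set (σ : Store) (a i j : ℕ) (z : ℤ) : Store :=
  fun b k l => if b = a ∧ k = i ∧ l = j then z else σ b k l

inductive AExpr where
  | lit (z : ℤ)
  | bound
  | input (e : AExpr)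
  | cell (a : ℕ) (i j : AExpr)
  | add (a b : AExpr)
  | sub (a b : AExpr)
  | div (a b : AExpr)

inductive AProg where
  | skip
  | store (a : ℕ) (i j e : AExpr)
  | seq (p q : AProg)
  | ite (e : AExpr) (p q : AProg)
  | loop (a : ℕ) (p : AProg)

/-- The bound of the loops and the input of an array program. -/
structure Env where
  N : ℕ
  inp : ℕ → ℤ

def AExpr.eval (E : Env) (σ : Store) : AExpr → ℤ
  | lit z => z
  | bound => E.N
  | input e => E.inp (e.eval E σ).toNat
  | cell a i j => σ a (i.eval E σ).toNat (j.eval E σ).toNat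
  | add a b => a.eval E σ + b.eval E σ
  | sub a b => a.eval E σ - b.eval E σ
  | div a b => a.eval E σ / b.eval E σ

/-- `f (n - 1) (⋯ (f 1 (f 0 σ)))`. -/
def forLoop {α : Type*} (f : ℕ → α → α) : ℕ → α → α
  | 0, σ => σ
  | n + 1, σ => f n (forLoop f n σ)

def AProg.sem (E : Env) : AProg → Store → Store
  | skip, σ => σ
  | store a i j e, σ => σ.set a (i.eval E σ).toNat (j.eval E σ).toNat (e.eval E σ)
  | seq p q, σ => q.sem E (p.sem E σ)
  | ite e p q, σ => if 0 < e.eval E σ then p.sem E σ else q.sem E σ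
  | loop a p, σ => forLoop (fun k τ => p.sem E (τ.set a 0 0 k)) E.N σ

/-! ### Compilation of array programs -/

/-- The value lies between the squares of `a + b` and `a + b + 1`, so `a + b`, and then `a`, can be
recovered. No division is needed, and surjectivity does not matter. -/
def pairing (a b : ℕ) : ℕ := (a + b) * (a + b) + a

theorem pairing_inj {a b c d : ℕ} (h : pairing a b = pairing c d) : a = c ∧ b = d := by
  unfold pairing at h
  have h1 : a + b = c + d := by
    rcases lt_trichotomy (a + b) (c + d) with hlt | heq | hlt
    · have : (a + b + 1) * (a + b + 1) ≤ (c + d) * (c + d) := Nat.mul_le_mul hlt hlt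
      nlinarith
    · exact heq
    · have : (c + d + 1) * (c + d + 1) ≤ (a + b) * (a + b) := Nat.mul_le_mul hlt hlt
      nlinarith
  rw [h1] at h
  omega

/-- The address of a cell of an array. -/
def address (a i j : ℕ) : ℤ := -(pairing (pairing i j) a : ℤ) - 1

theorem address_inj {a i j b k l : ℕ} : address a i j = address b k l ↔ a = b ∧ i = k ∧ j = l := by
  constructor
  · intro h
    have h1 : pairing (pairing i j) a = pairing (pairing k l) b := by
      unfold address at h
      omega
    obtain ⟨h2, h3⟩ := pairing_inj h1
    exact ⟨h3, pairing_inj h2⟩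
  · rintro ⟨rfl, rfl, rfl⟩
    rfl

/-- Negative addresses keep all working cells apart from the input, which occupies the nonnegative
cells. -/
theorem address_lt (a i j : ℕ) : address a i j < 0 := by
  unfold address
  omega

theorem natCast_ne_address (n a i j : ℕ) : (n : ℤ) ≠ address a i j := by
  have := address_lt a i j
  omega

namespace Expr

/-- The positive part. -/
def clamp (e : Expr) : Expr := mul e (add (lit 1) (div e (add (mul e e) (lit 1))))

/-- The floor of `z / (z² + 1)` is `0` for `z ≥ 0` and `-1` for `z < 0`, so one plus it is the
indicator of `z ≥ 0`. Array indices are natural numbers, hence the need. -/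
theorem eval_clamp (m : Mem) (e : Expr) : (clamp e).eval m = ((e.eval m).toNat : ℤ) := by
  simp only [clamp, eval]
  generalize e.eval m = z
  rcases le_or_gt 0 z with h | h
  · rw [Int.ediv_eq_zero_of_lt h (by nlinarith), Int.toNat_of_nonneg h]
    ring
  · rw [show z / (z * z + 1) = -1 by
      rw [Int.ediv_eq_iff_of_pos (by nlinarith)]
      constructor <;> nlinarith, Int.toNat_of_nonpos h.le]
    simp

def pair (a b : Expr) : Expr := add (mul (add a b) (add a b)) a

/-- The address of a cell of an array. -/
def addr (a : ℕ) (i j : Expr) : Expr :=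
  sub (sub (lit 0) (pair (pair (clamp i) (clamp j)) (lit a))) (lit 1)

theorem eval_addr (m : Mem) (a : ℕ) (i j : Expr) :
    (addr a i j).eval m = address a (i.eval m).toNat (j.eval m).toNat := by
  simp only [addr, pair, eval, eval_clamp, address, pairing]
  push_cast
  ring

end Expr

/-- The cell that holds the bound of the loops. -/
def boundCell : ℤ := address 1 0 0

/-- The cell that holds the number of the remaining iterations of a loop at depth `d`. -/
def counter (d : ℕ) : ℤ := address (2 * d + 3) 0 0

def AExpr.compile : AExpr → Expr
  | lit z => .lit z
  | bound => .get (.lit boundCell)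
  | input e => .get (e.compile.clamp)
  | cell a i j => .get (.addr (2 * a) i.compile j.compile)
  | add a b => .add a.compile b.compile
  | sub a b => .sub a.compile b.compile
  | div a b => .div a.compile b.compile

/-- A hidden counter runs down from the bound, and the visible loop variable is the bound minus the
counter. The body may overwrite the variable, but not the counter: loops inside it use counters of
greater depth. -/
def AProg.compile : ℕ → AProg → Program
  | _, skip => .skip
  | _, store a i j e => .store (.addr (2 * a) i.compile j.compile) e.compile
  | d, seq p q => .seq (p.compile d) (q.compile d)
  | d, ite e p q => .ite e.compile (p.compile d) (q.compile d)
  | d, loop a p =>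
    .seq (.store (.lit (counter d)) (.get (.lit boundCell)))
      (.loop (.get (.lit (counter d)))
        (.seq (.store (.lit (address (2 * a) 0 0))
            (.sub (.get (.lit boundCell)) (.get (.lit (counter d)))))
          (.seq (p.compile (d + 1))
            (.store (.lit (counter d)) (.sub (.get (.lit (counter d))) (.lit 1))))))

/-- The memory represents the environment and the arrays. -/
structure Represents (E : Env) (σ : Store) (m : Mem) : Prop where
  cell : ∀ a i j, m (address (2 * a) i j) = σ a i j
  input : ∀ i : ℕ, m i = E.inp i
  bound : m boundCell = E.N

theorem Represents.eval_compile {E : Env} {σ : Store} {m : Mem} (h : Represents E σ m)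
    (e : AExpr) : e.compile.eval m = e.eval E σ := by
  induction e with
  | lit z => rfl
  | bound => exact h.bound
  | input e ih =>
    simp only [AExpr.compile, Expr.eval, Expr.eval_clamp, AExpr.eval, ih]
    exact h.input _
  | cell a i j hi hj =>
    simp only [AExpr.compile, Expr.eval, Expr.eval_addr, AExpr.eval, hi, hj]
    exact h.cell _ _ _
  | _ => simp only [AExpr.compile, Expr.eval, AExpr.eval, *]

/-- This is where the absence of multiplication counts: the increase over `B` is additive and
depends on the expression alone, whereas products could double the number of bits in every round of
a loop. -/
theorem AExpr.exists_bits_le (e : AExpr) :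
    ∃ c, ∀ (E : Env) (σ : Store) (m : Mem) (B : ℕ), Represents E σ m → m.Bounded B →
      bits (e.eval E σ) ≤ B + c := by
  induction e with
  | lit z => exact ⟨bits z, fun _ _ _ _ _ _ => Nat.le_add_left _ _⟩
  | bound => exact ⟨0, fun E σ m B h hm => (congrArg bits h.bound).symm.trans_le (hm _)⟩
  | input e => exact ⟨0, fun E σ m B h hm => (congrArg bits (h.input _)).symm.trans_le (hm _)⟩
  | cell a i j =>
    exact ⟨0, fun E σ m B h hm => (congrArg bits (h.cell a _ _)).symm.trans_le (hm _)⟩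
  | add a b ha hb =>
    obtain ⟨c, hc⟩ := ha
    obtain ⟨d, hd⟩ := hb
    refine ⟨c + d + 1, fun E σ m B h hm => (bits_add_le_max _ _).trans ?_⟩
    have := hc E σ m B h hm
    have := hd E σ m B h hm
    omega
  | sub a b ha hb =>
    obtain ⟨c, hc⟩ := ha
    obtain ⟨d, hd⟩ := hb
    refine ⟨c + d + 1, fun E σ m B h hm => (bits_sub_le_max _ _).trans ?_⟩
    have := hc E σ m B h hm
    have := hd E σ m B h hm
    omega
  | div a b ha hb =>
    obtain ⟨c, hc⟩ := ha
    exact ⟨c, fun E σ m B h hm => (bits_div_le _ _).trans (hc E σ m B h hm)⟩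

theorem natCast_ne_counter (n d : ℕ) : (n : ℤ) ≠ counter d := natCast_ne_address _ _ _ _

/-- Arrays of the program have even numbers, the bound and the counters odd ones, so the cells never
clash. -/
theorem Represents.update_counter {E : Env} {σ : Store} {m : Mem} (h : Represents E σ m) (d : ℕ)
    (z : ℤ) : Represents E σ (Function.update m (counter d) z) where
  cell a i j := by
    rw [Function.update_of_ne, h.cell]
    rw [counter, Ne, address_inj]
    omega
  input i := by
    rw [Function.update_of_ne (natCast_ne_counter _ _), h.input]
  bound := by
    rw [Function.update_of_ne, h.bound]
    rw [boundCell, counter, Ne, address_inj]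
    omega

theorem Represents.update_cell {E : Env} {σ : Store} {m : Mem} (h : Represents E σ m) (a i j : ℕ)
    (z : ℤ) : Represents E (σ.set a i j z) (Function.update m (address (2 * a) i j) z) where
  cell b k l := by
    by_cases hb : b = a ∧ k = i ∧ l = j
    · obtain ⟨rfl, rfl, rfl⟩ := hb
      simp [Store.set]
    · rw [Function.update_of_ne, h.cell, Store.set, if_neg hb]
      rw [Ne, address_inj]
      omega
  input i := by
    rw [Function.update_of_ne (natCast_ne_address _ _ _ _), h.input]
  bound := by
    rw [Function.update_of_ne, h.bound]
    rw [boundCell, Ne, address_inj]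
    omega

theorem counter_ne_address (d a i j : ℕ) : counter d ≠ address (2 * a) i j := by
  rw [counter, Ne, address_inj]
  omega

theorem counter_inj {d d' : ℕ} : counter d = counter d' ↔ d = d' := by
  rw [counter, counter, address_inj]
  omega

/-- The compiled program simulates the array program; its running time and the growth of the numbers
are bounded by the number `S`. -/
def Simulates (E : Env) (σ' : Store) (d : ℕ) (p : Program) (m : Mem) (B S : ℕ) : Prop :=
  ∃ t m', Run p m t m' ∧ Represents E σ' m' ∧ (∀ d' < d, m' (counter d') = m (counter d')) ∧
    m'.Bounded (B + S) ∧ t ≤ S * (B + S + 1)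

/-- The accounting for one iteration: the body contributes `s`, and the extra `K` per iteration pays
for the test and the updates of counter and loop variable, all charged at the final word length. -/
theorem loop_time_le {K c c0 c1 c2 c3 c4 e0 e1 e2 e3 e4 s t t' r B : ℕ}
    (hK : K = 5 + c + c0 + c1 + c2 + c3 + c4) (h0 : e0 ≤ c0 * (B + 1)) (h1 : e1 ≤ c1 * (B + 1))
    (h2 : e2 ≤ c2 * (B + s + 1)) (h3 : e3 ≤ c3 * (B + s + 1)) (h4 : e4 ≤ c4 * (B + 1))
    (ht : t ≤ s * (B + s + 1)) (ht' : t' ≤ (r * (s + K) + K) * (B + s + r * (s + K) + 1)) :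
    1 + e0 + (1 + (1 + e4 + e1) + (1 + t + (1 + e3 + e2))) + t' ≤
      ((r + 1) * (s + K) + K) * (B + (r + 1) * (s + K) + 1) := by
  obtain ⟨M, hM⟩ : ∃ M, M = B + (r + 1) * (s + K) + 1 := ⟨_, rfl⟩
  have a1 : B + 1 ≤ M := by rw [hM]; omega
  have a2 : B + s + 1 ≤ M := by rw [hM, Nat.add_mul]; omega
  have a3 : B + s + r * (s + K) + 1 ≤ M := by rw [hM, Nat.add_mul]; omega
  have b0 := h0.trans (Nat.mul_le_mul_left c0 a1)
  have b1 := h1.trans (Nat.mul_le_mul_left c1 a1)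
  have b2 := h2.trans (Nat.mul_le_mul_left c2 a2)
  have b3 := h3.trans (Nat.mul_le_mul_left c3 a2)
  have b4 := h4.trans (Nat.mul_le_mul_left c4 a1)
  have bt := ht.trans (Nat.mul_le_mul_left s a2)
  have bt' := ht'.trans (Nat.mul_le_mul_left (r * (s + K) + K) a3)
  rw [← hM, show ((r + 1) * (s + K) + K) * M = (r * (s + K) + K) * M + (s * M + K * M) by ring,
    show K * M = 5 * M + c * M + c0 * M + c1 * M + c2 * M + c3 * M + c4 * M by rw [hK]; ring]
  omega

/-- One polynomial bounds both the growth in bits and the number of charged operations, the time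
being their product with the word length. A sequence adds the polynomials and a loop multiplies by
`N`, so nesting stays polynomial. -/
theorem AProg.exists_simulates (p : AProg) (d : ℕ) : ∃ S : Polynomial ℕ,
    ∀ (E : Env) (σ : Store) (m : Mem) (B : ℕ), Represents E σ m → m.Bounded B →
      Simulates E (p.sem E σ) d (p.compile d) m B (S.eval E.N) := by
  induction p generalizing d with
  | skip =>
    refine ⟨1, fun E σ m B h hm => ⟨1, m, .skip m, h, fun _ _ => rfl, ?_, ?_⟩⟩
    · exact hm.mono (Nat.le_add_right _ _)
    · simp
  | store a i j e =>
    obtain ⟨c, hc⟩ := e.exists_bits_le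
    obtain ⟨c1, hc1⟩ := (Expr.addr (2 * a) i.compile j.compile).exists_cost_le
    obtain ⟨c2, hc2⟩ := e.compile.exists_cost_le
    refine ⟨Polynomial.C (1 + c + c1 + c2), fun E σ m B h hm => ⟨_, _, .store _ _ m, ?_, ?_, ?_, ?_⟩⟩
    · rw [Expr.eval_addr, h.eval_compile, h.eval_compile, h.eval_compile]
      exact h.update_cell _ _ _ _
    · intro d' _
      rw [Expr.eval_addr, Function.update_of_ne (counter_ne_address _ _ _ _)]
    · rw [h.eval_compile, Polynomial.eval_C]
      refine (hm.mono (Nat.le_add_right _ _)).update _ ((hc E σ m B h hm).trans ?_)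
      omega
    · have h1 := (hc1 m B hm).2
      have h2 := (hc2 m B hm).2
      rw [Polynomial.eval_C]
      nlinarith
  | seq p q hp hq =>
    obtain ⟨S, hS⟩ := hp d
    obtain ⟨T, hT⟩ := hq d
    refine ⟨S + T + 1, fun E σ m B h hm => ?_⟩
    obtain ⟨t, m1, r1, h1, k1, b1, l1⟩ := hS E σ m B h hm
    obtain ⟨t', m2, r2, h2, k2, b2, l2⟩ := hT E _ m1 _ h1 b1
    refine ⟨_, m2, .seq r1 r2, h2, fun d' hd => (k2 d' hd).trans (k1 d' hd), ?_, ?_⟩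
    · refine b2.mono ?_
      simp only [Polynomial.eval_add, Polynomial.eval_one]
      omega
    · simp only [Polynomial.eval_add, Polynomial.eval_one]
      nlinarith
  | ite e p q hp hq =>
    obtain ⟨c, hc⟩ := e.compile.exists_cost_le
    obtain ⟨S, hS⟩ := hp d
    obtain ⟨T, hT⟩ := hq d
    refine ⟨S + T + Polynomial.C c + 1, fun E σ m B h hm => ?_⟩
    have h0 := (hc m B hm).2
    by_cases he : 0 < e.eval E σ
    · obtain ⟨t, m1, r1, h1, k1, b1, l1⟩ := hS E σ m B h hm
      refine ⟨_, m1, .ite_pos (by rwa [h.eval_compile]) r1, ?_, k1, ?_, ?_⟩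
      · rwa [AProg.sem, if_pos he]
      · refine b1.mono ?_
        simp only [Polynomial.eval_add, Polynomial.eval_one, Polynomial.eval_C]
        omega
      · simp only [Polynomial.eval_add, Polynomial.eval_one, Polynomial.eval_C]
        nlinarith
    · obtain ⟨t, m1, r1, h1, k1, b1, l1⟩ := hT E σ m B h hm
      refine ⟨_, m1, .ite_neg (by rwa [h.eval_compile]) r1, ?_, k1, ?_, ?_⟩
      · rwa [AProg.sem, if_neg he]
      · refine b1.mono ?_
        simp only [Polynomial.eval_add, Polynomial.eval_one, Polynomial.eval_C]
        omega
      · simp only [Polynomial.eval_add, Polynomial.eval_one, Polynomial.eval_C]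
        nlinarith
  | loop a p hp =>
    obtain ⟨S, hS⟩ := hp (d + 1)
    obtain ⟨c, hc⟩ := (Expr.get (.lit boundCell)).exists_cost_le
    obtain ⟨c0, hc0⟩ := (Expr.get (.lit (counter d))).exists_cost_le
    obtain ⟨c1, hc1⟩ := (Expr.sub (.get (.lit boundCell)) (.get (.lit (counter d)))).exists_cost_le
    obtain ⟨c2, hc2⟩ := (Expr.sub (.get (.lit (counter d))) (.lit 1)).exists_cost_le
    obtain ⟨c3, hc3⟩ := (Expr.lit (counter d)).exists_cost_le
    obtain ⟨c4, hc4⟩ := (Expr.lit (address (2 * a) 0 0)).exists_cost_le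
    obtain ⟨K, hK⟩ : ∃ K, K = 5 + c + c0 + c1 + c2 + c3 + c4 := ⟨_, rfl⟩
    refine ⟨Polynomial.X * (S + Polynomial.C K) + Polynomial.C (2 * K),
      fun E σ m B h hm => ?_⟩
    set f : ℕ → Store → Store := fun k τ => p.sem E (τ.set a 0 0 k)
    set Q := S.eval E.N + K
    -- Induction on the number `r` of remaining iterations, which is the content of the counter. The
    -- loop variable causes no growth, as it is smaller than the bound held in memory.
    have key : ∀ r ≤ E.N, ∀ (m : Mem) (B : ℕ), Represents E (forLoop f (E.N - r) σ) m →
        m.Bounded B → m (counter d) = r →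
        ∃ t m', Run (.loop (.get (.lit (counter d)))
          (.seq (.store (.lit (address (2 * a) 0 0))
            (.sub (.get (.lit boundCell)) (.get (.lit (counter d)))))
          (.seq (p.compile (d + 1))
            (.store (.lit (counter d)) (.sub (.get (.lit (counter d))) (.lit 1)))))) m t m' ∧
          Represents E (forLoop f E.N σ) m' ∧ (∀ d' < d, m' (counter d') = m (counter d')) ∧
          m'.Bounded (B + r * Q) ∧ t ≤ (r * Q + K) * (B + r * Q + 1) := by
      intro r
      induction r with
      | zero =>
        intro _ m B h hm hr
        refine ⟨_, m, .loop_neg (by simp [Expr.eval, hr]), h, fun _ _ => rfl,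
          hm.mono (Nat.le_add_right _ _), ?_⟩
        have := (hc0 m B hm).2
        simp only [Nat.zero_mul, Nat.zero_add, Nat.add_zero]
        nlinarith
      | succ r ih =>
        intro hr m B h hm hm0
        have hN : E.N - r = (E.N - (r + 1)) + 1 := by omega
        set k := E.N - (r + 1)
        set τ := forLoop f k σ
        set m1 : Mem := Function.update m (address (2 * a) 0 0) (k : ℤ)
        have h1 : Represents E (τ.set a 0 0 k) m1 := h.update_cell a 0 0 k
        have hb : bits (E.N : ℤ) ≤ B := h.bound ▸ hm _
        have hk : bits (k : ℤ) ≤ B := (bits_le_of_natAbs_le (by simp; omega)).trans hb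
        have b1 : m1.Bounded B := hm.update _ hk
        have hv : (Expr.sub (.get (.lit boundCell)) (.get (.lit (counter d)))).eval m = k := by
          simp only [Expr.eval, h.bound, hm0]
          push_cast
          omega
        have r1 := Run.store (.lit (address (2 * a) 0 0))
          (.sub (.get (.lit boundCell)) (.get (.lit (counter d)))) m
        rw [hv, show Expr.eval m (.lit (address (2 * a) 0 0)) = address (2 * a) 0 0 from rfl] at r1
        obtain ⟨t, m2, r2, h2, k2, b2, l2⟩ := hS E _ m1 B h1 b1
        have hm2 : m2 (counter d) = (r : ℤ) + 1 := by
          rw [k2 d (Nat.lt_succ_self d), show m1 = Function.update m _ _ from rfl, Function.update_of_ne (counter_ne_address _ _ _ _), hm0]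
          push_cast
          rfl
        have hv2 : (Expr.sub (.get (.lit (counter d))) (.lit 1)).eval m2 = r := by
          simp only [Expr.eval, hm2]
          ring
        have r3 := Run.store (.lit (counter d)) (.sub (.get (.lit (counter d))) (.lit 1)) m2
        rw [hv2, show Expr.eval m2 (.lit (counter d)) = counter d from rfl] at r3
        have hr' : bits (r : ℤ) ≤ B + S.eval E.N := by
          refine ((bits_le_of_natAbs_le ?_).trans hb).trans (Nat.le_add_right _ _)
          simp
          omega
        have b3 := b2.update (counter d) hr'
        have h3 := h2.update_counter d r
        obtain ⟨t', m4, r4, h4, k4, b4, l4⟩ := ih (by omega) _ _ (by rw [hN]; exact h3) b3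
          (by simp)
        refine ⟨_, m4, .loop_pos ?_ (.seq r1 (.seq r2 r3)) r4, h4, fun d' hd => ?_, ?_, ?_⟩
        · simp only [Expr.eval, hm0]
          omega
        · rw [k4 d' hd, Function.update_of_ne (by rw [Ne, counter_inj]; omega),
            k2 d' (by omega), show m1 = Function.update m _ _ from rfl, Function.update_of_ne (counter_ne_address _ _ _ _)]
        · refine b4.mono ?_
          simp only [Q, Nat.add_mul, Nat.one_mul]
          omega
        · have e0 := (hc0 m B hm).2
          have e1 := (hc1 m B hm).2
          have e2 := (hc2 m2 _ b2).2
          have e3 := (hc3 m2 _ b2).2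
          have e4 := (hc4 m B hm).2
          exact loop_time_le hK e0 e1 e2 e3 e4 l2 l4
    have hb : bits (E.N : ℤ) ≤ B := (congrArg bits h.bound).symm.trans_le (hm _)
    have r1 := Run.store (.lit (counter d)) (.get (.lit boundCell)) m
    rw [show Expr.eval m (.get (.lit boundCell)) = E.N from h.bound,
      show Expr.eval m (.lit (counter d)) = counter d from rfl] at r1
    obtain ⟨t, m2, r2, h2, k2, b2, l2⟩ := key E.N le_rfl _ B
      (by rw [Nat.sub_self]; exact h.update_counter d E.N) (hm.update (counter d) hb) (by simp)
    refine ⟨_, m2, .seq r1 r2, h2, fun d' hd => ?_, ?_, ?_⟩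
    · rw [k2 d' hd, Function.update_of_ne (by rw [Ne, counter_inj]; omega)]
    · refine b2.mono ?_
      simp only [Polynomial.eval_add, Polynomial.eval_mul, Polynomial.eval_X, Polynomial.eval_C]
      exact Nat.add_le_add_left (Nat.le_add_right _ _) _
    · have e3 := (hc3 m B hm).2
      have e5 := (hc m B hm).2
      simp only [Polynomial.eval_add, Polynomial.eval_mul, Polynomial.eval_X, Polynomial.eval_C]
      change _ ≤ (E.N * Q + 2 * K) * (B + (E.N * Q + 2 * K) + 1)
      generalize E.N * Q = R at *
      nlinarith

end RAM

namespace RAM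

/-! ### Running an array program on an input -/

theorem size_div_two {s : ℕ} (hs : 0 < s) : s.size = (s / 2).size + 1 := by
  have h : Nat.bit s.bodd (s / 2) = s := by rw [← Nat.div2_val, Nat.bit_bodd_div2]
  conv_lhs => rw [← h]
  rw [Nat.size_bit (by rw [h]; omega)]

/-- The memory of the machine while it computes the bound of the loops. -/
def boundMem (l : List ℤ) (n k s : ℕ) : Mem := fun z =>
  if z = boundCell then n else if z = counter 0 then k else if z = counter 1 then s else load l z

section Bound

variable {l : List ℤ} {n k s : ℕ}

theorem boundCell_ne_counter (d : ℕ) : boundCell ≠ counter d := by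
  rw [boundCell, counter, Ne, address_inj]
  omega

theorem natCast_ne_boundCell (i : ℕ) : (i : ℤ) ≠ boundCell := natCast_ne_address _ _ _ _

theorem boundMem_boundCell : boundMem l n k s boundCell = n := if_pos rfl

theorem boundMem_counter_zero : boundMem l n k s (counter 0) = k := by
  rw [boundMem, if_neg (boundCell_ne_counter 0).symm, if_pos rfl]

theorem boundMem_counter_one : boundMem l n k s (counter 1) = s := by
  rw [boundMem, if_neg (boundCell_ne_counter 1).symm, if_neg (by rw [counter_inj]; omega),
    if_pos rfl]

theorem boundMem_natCast (i : ℕ) : boundMem l n k s i = load l i := by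
  rw [boundMem, if_neg (natCast_ne_boundCell i), if_neg (natCast_ne_counter i _),
    if_neg (natCast_ne_counter i _)]

theorem update_boundMem_boundCell (n' : ℕ) :
    Function.update (boundMem l n k s) boundCell (n' : ℤ) = boundMem l n' k s := by
  ext z
  by_cases hz : z = boundCell
  · rw [hz, Function.update_self, boundMem_boundCell]
  · rw [Function.update_of_ne hz, boundMem, if_neg hz, boundMem, if_neg hz]

theorem update_boundMem_counter_zero (k' : ℕ) :
    Function.update (boundMem l n k s) (counter 0) (k' : ℤ) = boundMem l n k' s := by
  ext z
  by_cases hz : z = counter 0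
  · rw [hz, Function.update_self, boundMem_counter_zero]
  · rw [Function.update_of_ne hz, boundMem, boundMem, if_neg hz, if_neg hz]

theorem update_boundMem_counter_one (s' : ℕ) :
    Function.update (boundMem l n k s) (counter 1) (s' : ℤ) = boundMem l n k s' := by
  ext z
  by_cases hz : z = counter 1
  · rw [hz, Function.update_self, boundMem_counter_one]
  · rw [Function.update_of_ne hz, boundMem, boundMem, if_neg hz, if_neg hz]

theorem boundMem_bounded {B : ℕ} (hl : Mem.Bounded (load l) B) (hn : bits n ≤ B)
    (hk : bits k ≤ B) (hs : bits s ≤ B) : (boundMem l n k s).Bounded B := by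
  intro z
  unfold boundMem
  split_ifs
  exacts [hn, hk, hs, hl z]

end Bound

theorem bits_natCast_mono {a b : ℕ} (h : a ≤ b) : bits (a : ℤ) ≤ bits (b : ℤ) :=
  bits_le_of_natAbs_le (by simpa using h)

/-- Summing up the input. -/
def sumLoop : Program :=
  .loop (.get (.lit (counter 0)))
    (.seq (.store (.lit (counter 1)) (.add (.get (.lit (counter 1)))
        (.get (.get (.lit (counter 0))))))
      (.store (.lit (counter 0)) (.sub (.get (.lit (counter 0))) (.lit 1))))

/-- The entries are nonnegative, so every partial sum is bounded by the final one; the word length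
`B` therefore serves for the whole run and each iteration has cost linear in `B`. -/
theorem exists_run_sumLoop : ∃ c, ∀ (l : List ℤ), (∀ i : ℕ, 0 ≤ load l i) →
    ∀ (n B : ℕ), Mem.Bounded (load l) B → bits n ≤ B → ∀ k s : ℕ, bits k ≤ B →
    bits ((s + ∑ i ∈ Finset.range k, (load l (i + 1 : ℕ)).toNat : ℕ) : ℤ) ≤ B →
    ∃ t, Run sumLoop (boundMem l n k s) t
      (boundMem l n 0 (s + ∑ i ∈ Finset.range k, (load l (i + 1 : ℕ)).toNat)) ∧
      t ≤ (k + 1) * (c * (B + 1)) := by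
  obtain ⟨c0, hc0⟩ := (Expr.get (.lit (counter 0))).exists_cost_le
  obtain ⟨c1, hc1⟩ := (Expr.lit (counter 1)).exists_cost_le
  obtain ⟨c2, hc2⟩ := (Expr.add (.get (.lit (counter 1)))
    (.get (.get (.lit (counter 0))))).exists_cost_le
  obtain ⟨c3, hc3⟩ := (Expr.lit (counter 0)).exists_cost_le
  obtain ⟨c4, hc4⟩ := (Expr.sub (.get (.lit (counter 0))) (.lit 1)).exists_cost_le
  refine ⟨4 + c0 + c1 + c2 + c3 + c4, fun l hl n B hB hn k => ?_⟩
  induction k with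
  | zero =>
    intro s hk hs
    simp only [Finset.range_zero, Finset.sum_empty, Nat.add_zero] at hs ⊢
    refine ⟨_, .loop_neg (by simp [Expr.eval, boundMem_counter_zero]), ?_⟩
    have := (hc0 _ B (boundMem_bounded hB hn hk hs)).2
    nlinarith
  | succ k ih =>
    intro s hk hs
    rw [Finset.sum_range_succ, add_comm (∑ i ∈ Finset.range k, _) _, ← add_assoc] at hs ⊢
    set a := (load l (k + 1 : ℕ)).toNat
    have ha : load l (k + 1 : ℕ) = a := (Int.toNat_of_nonneg (hl _)).symm
    have hs1 : bits (s : ℤ) ≤ B := (bits_natCast_mono (by omega)).trans hs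
    have hs2 : bits ((s + a : ℕ) : ℤ) ≤ B := (bits_natCast_mono (by omega)).trans hs
    have hk1 : bits (k : ℤ) ≤ B := (bits_natCast_mono (by omega)).trans hk
    obtain ⟨t, r, ht⟩ := ih (s + a) hk1 hs
    have b1 := boundMem_bounded hB hn hk hs1
    have b2 := boundMem_bounded hB hn hk hs2
    have r1 := Run.store (.lit (counter 1)) (.add (.get (.lit (counter 1)))
        (.get (.get (.lit (counter 0))))) (boundMem l n (k + 1) s)
    have v1 : Expr.eval (boundMem l n (k + 1) s) (.add (.get (.lit (counter 1)))
        (.get (.get (.lit (counter 0))))) = (s + a : ℕ) := by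
      simp only [Expr.eval, boundMem_counter_one, boundMem_counter_zero]
      rw [boundMem_natCast, ha, Nat.cast_add]
    rw [v1, show Expr.eval _ (.lit (counter 1)) = counter 1 from rfl,
      update_boundMem_counter_one] at r1
    have r2 := Run.store (.lit (counter 0)) (.sub (.get (.lit (counter 0))) (.lit 1))
      (boundMem l n (k + 1) (s + a))
    have v2 : Expr.eval (boundMem l n (k + 1) (s + a))
        (.sub (.get (.lit (counter 0))) (.lit 1)) = k := by
      simp only [Expr.eval, boundMem_counter_zero]
      push_cast
      ring
    rw [v2, show Expr.eval _ (.lit (counter 0)) = counter 0 from rfl,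
      update_boundMem_counter_zero] at r2
    refine ⟨_, .loop_pos ?_ (.seq r1 r2) r, ?_⟩
    · simp only [Expr.eval, boundMem_counter_zero]
      omega
    · have e0 := (hc0 _ B b1).2
      have e1 := (hc1 _ B b1).2
      have e2 := (hc2 _ B b1).2
      have e3 := (hc3 _ B b2).2
      have e4 := (hc4 _ B b2).2
      rw [Nat.add_mul (k + 1) 1]
      simp only [Nat.add_mul _ _ (B + 1), Nat.one_mul] at ht ⊢
      omega

/-- Adding the number of bits of the sum to the bound. -/
def sizeLoop : Program :=
  .loop (.get (.lit (counter 1)))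
    (.seq (.store (.lit boundCell) (.add (.get (.lit boundCell)) (.lit 1)))
      (.store (.lit (counter 1)) (.div (.get (.lit (counter 1))) (.lit 2))))

/-- Each halving of `s` removes one bit, which is credited to the bound of the loops. -/
theorem exists_run_sizeLoop : ∃ c, ∀ (l : List ℤ) (B : ℕ), Mem.Bounded (load l) B →
    ∀ n s : ℕ, bits s ≤ B → bits ((n + s.size : ℕ) : ℤ) ≤ B →
    ∃ t, Run sizeLoop (boundMem l n 0 s) t (boundMem l (n + s.size) 0 0) ∧
      t ≤ (s.size + 1) * (c * (B + 1)) := by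
  obtain ⟨c0, hc0⟩ := (Expr.get (.lit (counter 1))).exists_cost_le
  obtain ⟨c1, hc1⟩ := (Expr.lit boundCell).exists_cost_le
  obtain ⟨c2, hc2⟩ := (Expr.add (.get (.lit boundCell)) (.lit 1)).exists_cost_le
  obtain ⟨c3, hc3⟩ := (Expr.lit (counter 1)).exists_cost_le
  obtain ⟨c4, hc4⟩ := (Expr.div (.get (.lit (counter 1))) (.lit 2)).exists_cost_le
  refine ⟨4 + c0 + c1 + c2 + c3 + c4, fun l B hB n s => ?_⟩
  induction s using Nat.strong_induction_on generalizing n with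
  | _ s ih =>
    intro hs hns
    have h0 : bits ((0 : ℕ) : ℤ) ≤ B := (bits_natCast_mono (Nat.zero_le _)).trans hs
    have hn : bits (n : ℤ) ≤ B := (bits_natCast_mono (by omega)).trans hns
    rcases Nat.eq_zero_or_pos s with rfl | hpos
    · refine ⟨_, .loop_neg (by simp [Expr.eval, boundMem_counter_one]), ?_⟩
      have := (hc0 _ B (boundMem_bounded hB hn h0 hs)).2
      rw [Nat.size_zero]
      nlinarith
    · have hsz := size_div_two hpos
      rw [hsz, show n + ((s / 2).size + 1) = n + 1 + (s / 2).size by omega] at hns ⊢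
      obtain ⟨t, r, ht⟩ := ih (s / 2) (by omega) (n + 1)
        ((bits_natCast_mono (by omega)).trans hs) hns
      have b1 := boundMem_bounded hB hn h0 hs
      have b2 := boundMem_bounded hB ((bits_natCast_mono (a := n + 1) (by omega)).trans hns) h0 hs
      have r1 := Run.store (.lit boundCell) (.add (.get (.lit boundCell)) (.lit 1))
        (boundMem l n 0 s)
      rw [show Expr.eval (boundMem l n 0 s) (.add (.get (.lit boundCell)) (.lit 1)) =
          (n + 1 : ℕ) by simp only [Expr.eval, boundMem_boundCell]; push_cast; rfl,
        show Expr.eval _ (.lit boundCell) = boundCell from rfl, update_boundMem_boundCell] at r1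
      have r2 := Run.store (.lit (counter 1)) (.div (.get (.lit (counter 1))) (.lit 2))
        (boundMem l (n + 1) 0 s)
      rw [show Expr.eval (boundMem l (n + 1) 0 s) (.div (.get (.lit (counter 1))) (.lit 2)) =
          (s / 2 : ℕ) by simp only [Expr.eval, boundMem_counter_one]; push_cast; rfl,
        show Expr.eval _ (.lit (counter 1)) = counter 1 from rfl,
        update_boundMem_counter_one] at r2
      refine ⟨_, .loop_pos ?_ (.seq r1 r2) r, ?_⟩
      · simp only [Expr.eval, boundMem_counter_one]
        omega
      · have e0 := (hc0 _ B b1).2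
        have e1 := (hc1 _ B b1).2
        have e2 := (hc2 _ B b1).2
        have e3 := (hc3 _ B b2).2
        have e4 := (hc4 _ B b2).2
        rw [Nat.add_mul ((s / 2).size + 1) 1]
        simp only [Nat.add_mul _ _ (B + 1), Nat.one_mul] at ht ⊢
        omega

theorem load_natCast_nonneg {l : List ℤ} (hl : ∀ z ∈ l, 0 ≤ z) (i : ℕ) : 0 ≤ load l i := by
  unfold load
  split_ifs
  · positivity
  · rw [List.getD_eq_getElem?_getD]
    rcases h : l[(i : ℤ).toNat - 1]? with _ | z
    · simp
    · exact hl z (List.mem_of_getElem? h)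
  · exact le_rfl

theorem load_succ (l : List ℤ) (i : ℕ) : load l (i + 1 : ℕ) = l.getD i 0 := by
  unfold load
  rw [if_neg (by omega), if_pos (by omega)]
  simp

theorem length_le_inputSize (l : List ℤ) : l.length ≤ inputSize l := by
  induction l with
  | nil => simp [inputSize]
  | cons a l ih =>
    have h1 := one_le_bits a
    simp only [inputSize, List.map_cons, List.sum_cons, List.length_cons] at ih ⊢
    omega

theorem bits_le_inputSize {l : List ℤ} {z : ℤ} (hz : z ∈ l) : bits z ≤ inputSize l :=
  List.single_le_sum (fun _ _ => Nat.zero_le _) _ (List.mem_map_of_mem hz)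

theorem load_bounded (l : List ℤ) : Mem.Bounded (load l) (inputSize l + 1) := by
  intro z
  unfold load
  split_ifs
  · exact (bits_natCast_le _).trans (Nat.add_le_add_right (length_le_inputSize l) 1)
  · rw [List.getD_eq_getElem?_getD]
    rcases h : l[z.toNat - 1]? with _ | y
    · exact Nat.le_add_left _ _
    · exact (bits_le_inputSize (List.mem_of_getElem? h)).trans (Nat.le_succ _)
  · exact Nat.le_add_left _ _

theorem bits_sum_le (l : List ℤ) : bits (l.map Int.toNat).sum ≤ inputSize l + 1 := by
  induction l with
  | nil => simp [inputSize, bits]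
  | cons a l ih =>
    have h1 := one_le_bits a
    simp only [inputSize, List.map_cons, List.sum_cons] at ih ⊢
    push_cast
    have h2 := bits_add_le (a.toNat : ℤ) ((l.map Int.toNat).sum : ℕ)
    have h3 : bits (a.toNat : ℤ) ≤ bits a := bits_le_of_natAbs_le (by omega)
    push_cast at h2 ih
    omega

theorem sum_range_load (l : List ℤ) :
    ∑ i ∈ Finset.range l.length, (load l (i + 1 : ℕ)).toNat = (l.map Int.toNat).sum := by
  simp only [load_succ]
  induction l with
  | nil => rfl
  | cons a l ih =>
    rw [List.length_cons, Finset.sum_range_succ', List.map_cons, List.sum_cons, add_comm, ← ih]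
    rfl

/-- The bound of the loops of the array program on the input `l`. -/
def loopBound (l : List ℤ) : ℕ := l.length + 100 + (1 + (l.map Int.toNat).sum).size

/-- The bound is linear in the input size, so polynomials in it are harmless. Its summand `100` is
slack for the numerical estimates of the load balancing; the `1` under the size is the initial value
of the summation cell. -/
theorem loopBound_le (l : List ℤ) : loopBound l ≤ 2 * inputSize l + 103 := by
  have h1 := length_le_inputSize l
  have h2 := bits_add_le_max 1 ((l.map Int.toNat).sum : ℕ)
  have h3 := bits_sum_le l
  have h4 : bits (1 : ℤ) = 2 := rfl
  rw [h4, show (1 : ℤ) + ((l.map Int.toNat).sum : ℕ) = ((1 + (l.map Int.toNat).sum : ℕ) : ℤ) by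
    push_cast; rfl] at h2
  have h5 : bits ((1 + (l.map Int.toNat).sum : ℕ) : ℤ) = (1 + (l.map Int.toNat).sum).size + 1 := by
    rw [bits, Int.natAbs_natCast]
  unfold loopBound
  omega

/-- Lets a loop of length `N` run through all the bits of an input number. -/
theorem lt_two_pow_loopBound {l : List ℤ} {z : ℤ} (hz : z ∈ l) : z < 2 ^ loopBound l := by
  have h1 : z.toNat ≤ (l.map Int.toNat).sum :=
    List.single_le_sum (fun _ _ => Nat.zero_le _) _ (List.mem_map_of_mem hz)
  have h2 := Nat.lt_size_self (1 + (l.map Int.toNat).sum)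
  have h3 : 2 ^ (1 + (l.map Int.toNat).sum).size ≤ 2 ^ loopBound l :=
    Nat.pow_le_pow_right (by norm_num) (Nat.le_add_left _ _)
  have h4 : z.toNat < 2 ^ loopBound l := by omega
  have h5 : (z.toNat : ℤ) < 2 ^ loopBound l := by exact_mod_cast h4
  omega

/-- The program that runs an array program on its input; the answer is taken from the cell `0, 0` of
the array `0`. -/
def AProg.run (p : AProg) : Program :=
  .seq (.store (.lit boundCell) (.add (.get (.lit 0)) (.lit 100)))
  (.seq (.store (.lit (counter 0)) (.get (.lit 0)))
  (.seq (.store (.lit (counter 1)) (.lit 1))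
  (.seq sumLoop (.seq sizeLoop (.seq (p.compile 0)
    (.store (.lit 0) (.get (.lit (address (2 * 0) 0 0)))))))))

/-- The environment of an array program on the input `l`. -/
def inputEnv (l : List ℤ) : Env := ⟨loopBound l, fun i => load l i⟩

theorem represents_boundMem (l : List ℤ) :
    Represents (inputEnv l) (fun _ _ _ => 0) (boundMem l (loopBound l) 0 0) where
  cell a i j := by
    have h := address_lt (2 * a) i j
    unfold boundMem
    split_ifs with h1
    · rw [boundCell, address_inj] at h1
      omega
    · rfl
    · rfl
    · unfold load
      rw [if_neg h.ne, if_neg h.le.not_gt]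
  input i := boundMem_natCast i
  bound := boundMem_boundCell

theorem load_eq_boundMem (l : List ℤ) : load l = boundMem l 0 0 0 := by
  have h : ∀ a i j, load l (address a i j) = 0 := by
    intro a i j
    have h := address_lt a i j
    unfold load
    rw [if_neg h.ne, if_neg h.le.not_gt]
  ext z
  unfold boundMem
  split_ifs with h1 h2 h3
  · rw [h1]; exact h _ _ _
  · rw [h2]; exact h _ _ _
  · rw [h3]; exact h _ _ _
  · rfl

theorem monotone_eval (P : Polynomial ℕ) : Monotone fun n => P.eval n := by
  intro a b hab
  simp only [Polynomial.eval_eq_sum_range]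
  exact Finset.sum_le_sum fun i _ => Nat.mul_le_mul_left _ (Nat.pow_le_pow_left hab i)

theorem run_time_le {d0 d1 d2 d3 d4 d5 d6 d7 e0 e1 e2 e3 e4 e5 e6 e7 I B T c1 c2 k s t1 t2 t3 : ℕ}
    (h0 : e0 ≤ d0 * (B + 1)) (h1 : e1 ≤ d1 * (B + 1)) (h2 : e2 ≤ d2 * (B + 1))
    (h3 : e3 ≤ d3 * (B + 1)) (h4 : e4 ≤ d4 * (B + 1)) (h5 : e5 ≤ d5 * (B + 1))
    (h6 : e6 ≤ d6 * (B + T + 1)) (h7 : e7 ≤ d7 * (B + T + 1)) (hk : k ≤ I) (hs : s + 1 ≤ 2 * I + 104)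
    (ht1 : t1 ≤ (k + 1) * (c1 * (B + 1))) (ht2 : t2 ≤ (s + 1) * (c2 * (B + 1)))
    (ht3 : t3 ≤ T * (B + T + 1)) :
    1 + (1 + e0 + e1) + (1 + (1 + e2 + e3) + (1 + (1 + e4 + e5) + (1 + t1 + (1 + t2 +
      (1 + t3 + (1 + e6 + e7)))))) ≤ (10 + d0 + d1 + d2 + d3 + d4 + d5) * (B + 1) +
        (I + 1) * (c1 * (B + 1)) + (2 * I + 104) * (c2 * (B + 1)) + T * (B + T + 1) +
        (d6 + d7) * (B + T + 1) := by
  have a1 := ht1.trans (Nat.mul_le_mul_right (c1 * (B + 1)) (Nat.add_le_add_right hk 1))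
  have a2 := ht2.trans (Nat.mul_le_mul_right (c2 * (B + 1)) hs)
  have a3 : (10 + d0 + d1 + d2 + d3 + d4 + d5) * (B + 1) = 10 * (B + 1) + d0 * (B + 1) +
    d1 * (B + 1) + d2 * (B + 1) + d3 * (B + 1) + d4 * (B + 1) + d5 * (B + 1) := by ring
  rw [a3, Nat.add_mul d6 d7]
  omega

/-- Reduces the complexity claim to the correctness of an array program: any such program is
polynomial once the bound of its loops has been computed from the input. -/
theorem decidableInPolyTime {α : Type*} {encode : α → List ℤ} {Q : α → Prop} (p : AProg)
    (hnonneg : ∀ x, ∀ z ∈ encode x, 0 ≤ z)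
    (h : ∀ x, p.sem (inputEnv (encode x)) (fun _ _ _ => 0) 0 0 0 = 1 ↔ Q x) :
    DecidableInPolyTime encode Q := by
  obtain ⟨c1, hc1⟩ := exists_run_sumLoop
  obtain ⟨c2, hc2⟩ := exists_run_sizeLoop
  obtain ⟨S, hS⟩ := p.exists_simulates 0
  obtain ⟨d0, hd0⟩ := (Expr.lit boundCell).exists_cost_le
  obtain ⟨d1, hd1⟩ := (Expr.add (.get (.lit 0)) (.lit 100)).exists_cost_le
  obtain ⟨d2, hd2⟩ := (Expr.lit (counter 0)).exists_cost_le
  obtain ⟨d3, hd3⟩ := (Expr.get (.lit 0)).exists_cost_le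
  obtain ⟨d4, hd4⟩ := (Expr.lit (counter 1)).exists_cost_le
  obtain ⟨d5, hd5⟩ := (Expr.lit 1).exists_cost_le
  obtain ⟨d6, hd6⟩ := (Expr.lit 0).exists_cost_le
  obtain ⟨d7, hd7⟩ := (Expr.get (.lit (address (2 * 0) 0 0))).exists_cost_le
  -- `T` is the simulation bound at the largest possible loop bound, and `Bd` the word length that
  -- suffices before the simulation starts.
  let T : Polynomial ℕ := S.comp (2 * .X + .C 103)
  let Bd : Polynomial ℕ := 2 * .X + .C 104
  refine ⟨p.run, .C (10 + d0 + d1 + d2 + d3 + d4 + d5) * (Bd + 1) +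
    (.X + 1) * (.C c1 * (Bd + 1)) + (2 * .X + .C 104) * (.C c2 * (Bd + 1)) + T * (Bd + T + 1) +
    .C (d6 + d7) * (Bd + T + 1), fun x => ?_⟩
  set l := encode x
  set I := inputSize l
  have hL : l.length ≤ I := length_le_inputSize l
  have hN : loopBound l ≤ 2 * I + 103 := loopBound_le l
  obtain ⟨B, hB⟩ : ∃ B, B = 2 * I + 104 := ⟨_, rfl⟩
  have hBload : Mem.Bounded (load l) B := (load_bounded l).mono (by omega)
  have hbit : ∀ n : ℕ, n ≤ 2 * I + 103 → bits (n : ℤ) ≤ B := fun n hn =>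
    (bits_natCast_le n).trans (by omega)
  set n := l.length + 100 with hn
  set s := 1 + (l.map Int.toNat).sum with hs
  have hLB : loopBound l = n + s.size := rfl
  have hsum := sum_range_load l
  have bs : bits (s : ℤ) ≤ B := by
    have h1 := bits_add_le_max 1 ((l.map Int.toNat).sum : ℕ)
    have h3 := bits_sum_le l
    have h4 : bits (1 : ℤ) = 2 := rfl
    rw [h4, show (1 : ℤ) + ((l.map Int.toNat).sum : ℕ) = (s : ℤ) by rw [hs]; push_cast; rfl] at h1
    omega
  have b0 := hbit 0 (by omega)
  have b1 := hbit 1 (by omega)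
  have bn := hbit n (by omega)
  have bL := hbit l.length (by omega)
  have m0 : Mem.Bounded (boundMem l 0 0 0) B := boundMem_bounded hBload b0 b0 b0
  have m1 : Mem.Bounded (boundMem l n 0 0) B := boundMem_bounded hBload bn b0 b0
  have m2 : Mem.Bounded (boundMem l n l.length 0) B := boundMem_bounded hBload bn bL b0
  have hget : ∀ n k s, boundMem l n k s 0 = l.length := fun n k s =>
    (boundMem_natCast 0).trans (if_pos rfl)
  have r1 := Run.store (.lit boundCell) (.add (.get (.lit 0)) (.lit 100)) (boundMem l 0 0 0)
  rw [show Expr.eval (boundMem l 0 0 0) (.add (.get (.lit 0)) (.lit 100)) = n by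
    simp only [Expr.eval, hget, hn]; push_cast; rfl,
    show Expr.eval _ (.lit boundCell) = boundCell from rfl, update_boundMem_boundCell] at r1
  have r2 := Run.store (.lit (counter 0)) (.get (.lit 0)) (boundMem l n 0 0)
  rw [show Expr.eval (boundMem l n 0 0) (.get (.lit 0)) = l.length from hget _ _ _,
    show Expr.eval _ (.lit (counter 0)) = counter 0 from rfl, update_boundMem_counter_zero] at r2
  have r3 := Run.store (.lit (counter 1)) (.lit 1) (boundMem l n l.length 0)
  rw [show Expr.eval (boundMem l n l.length 0) (.lit 1) = (1 : ℕ) from rfl,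
    show Expr.eval _ (.lit (counter 1)) = counter 1 from rfl, update_boundMem_counter_one] at r3
  obtain ⟨t1, r4, ht1⟩ := hc1 l (load_natCast_nonneg (hnonneg x)) n B hBload bn l.length 1 bL
    (by rw [hsum]; exact bs)
  rw [hsum, ← hs] at r4
  obtain ⟨t2, r5, ht2⟩ := hc2 l B hBload n s bs (by rw [← hLB]; exact hbit _ hN)
  rw [← hLB] at r5
  obtain ⟨t3, m', r6, h6, -, b6, ht3⟩ := hS (inputEnv l) _ _ B (represents_boundMem l)
    (boundMem_bounded hBload (hbit _ hN) b0 b0)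
  have hSle : S.eval (loopBound l) ≤ S.eval (2 * I + 103) := monotone_eval S hN
  change m'.Bounded (B + S.eval (loopBound l)) at b6
  change t3 ≤ S.eval (loopBound l) * (B + S.eval (loopBound l) + 1) at ht3
  set T' := S.eval (2 * I + 103) with hT'
  replace b6 : m'.Bounded (B + T') := b6.mono (by omega)
  replace ht3 : t3 ≤ T' * (B + T' + 1) := ht3.trans (Nat.mul_le_mul hSle (by omega))
  have r7 := Run.store (.lit 0) (.get (.lit (address (2 * 0) 0 0))) m'
  have hTx : T.eval I = T' := by
    simp only [T, Polynomial.eval_comp, Polynomial.eval_add, Polynomial.eval_mul,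
      Polynomial.eval_X, Polynomial.eval_C, Polynomial.eval_ofNat, hT']
  have hBx : Bd.eval I = B := by
    simp only [Bd, Polynomial.eval_add, Polynomial.eval_mul,
      Polynomial.eval_X, Polynomial.eval_C, Polynomial.eval_ofNat, hB]
  refine ⟨_, _, by rw [load_eq_boundMem]; exact .seq r1 (.seq r2 (.seq r3 (.seq r4 (.seq r5
    (.seq r6 r7))))), ?_, ?_⟩
  · simp only [Polynomial.eval_add, Polynomial.eval_mul, Polynomial.eval_C, Polynomial.eval_X,
      Polynomial.eval_one, Polynomial.eval_ofNat, hTx, hBx]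
    exact run_time_le (hd0 _ B m0).2 (hd1 _ B m0).2 (hd2 _ B m1).2 (hd3 _ B m1).2 (hd4 _ B m2).2
      (hd5 _ B m2).2 (hd6 m' _ b6).2 (hd7 m' _ b6).2 hL (by omega) ht1 ht2 ht3
  · rw [show Expr.eval m' (.lit 0) = 0 from rfl, Function.update_self, ← h]
    simp only [Expr.eval]
    rw [h6.cell 0 0 0]

end RAM

/-! ### Transportation problems and load balancing -/

/-- The condition of Hall and Gale for a transportation problem with the supplies `p` and the demands
`q`, in which the pairs in `al` are allowed. -/
def HallCond (N : ℕ) (p q : ℕ → ℕ) (al : ℕ → ℕ → Prop) : Prop :=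
  ∀ R ⊆ Finset.range N, ∃ T ⊆ Finset.range N, (∀ j ∈ T, ∃ i ∈ R, al i j) ∧
    ∑ i ∈ R, p i ≤ ∑ j ∈ T, q j

open Classical in
theorem HallCond.sum_le {N : ℕ} {p q : ℕ → ℕ} {al : ℕ → ℕ → Prop} (h : HallCond N p q al)
    {R C : Finset ℕ} (hR : R ⊆ Finset.range N)
    (hC : ∀ i ∈ R, ∀ j < N, al i j → j ∈ C) : ∑ i ∈ R, p i ≤ ∑ j ∈ C, q j := by
  obtain ⟨T, hT, hal, hle⟩ := h R hR
  refine hle.trans (Finset.sum_le_sum_of_subset fun j hj => ?_)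
  obtain ⟨i, hi, ha⟩ := hal j hj
  exact hC i hi j (Finset.mem_range.1 (hT hj)) ha

/-- Split supplies and demands into units and apply Hall's marriage theorem. Equal totals make the
matching bijective, and counting the units sent from `i` to `j` gives the matrix. -/
theorem exists_matrix_of_hall {N : ℕ} {p q : ℕ → ℕ} {al : ℕ → ℕ → Prop} (h : HallCond N p q al)
    (hpq : ∑ i ∈ Finset.range N, p i = ∑ j ∈ Finset.range N, q j) :
    ∃ g : ℕ → ℕ → ℕ, (∀ i < N, ∑ j ∈ Finset.range N, g i j = p i) ∧
      (∀ j < N, ∑ i ∈ Finset.range N, g i j = q j) ∧ ∀ i < N, ∀ j < N, ¬ al i j → g i j = 0 := by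
  classical
  let t : (Σ i : Fin N, Fin (p i)) → Finset (Σ j : Fin N, Fin (q j)) :=
    fun x => Finset.univ.filter fun y => al x.1 y.1
  have hHall : ∀ s : Finset (Σ i : Fin N, Fin (p i)), s.card ≤ (s.biUnion t).card := by
    intro s
    let R : Finset (Fin N) := s.image Sigma.fst
    obtain ⟨T, hT, hal, hle⟩ := h (R.map Fin.valEmbedding) (by
      intro i hi
      obtain ⟨a, -, rfl⟩ := Finset.mem_map.1 hi
      exact Finset.mem_range.2 a.2)
    have h1 : s.card ≤ ∑ i ∈ R, p i := by
      have : s ⊆ R.sigma fun _ => Finset.univ := by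
        intro x hx
        exact Finset.mem_sigma.2 ⟨Finset.mem_image_of_mem _ hx, Finset.mem_univ _⟩
      refine (Finset.card_le_card this).trans ?_
      simp
    let T' : Finset (Fin N) := Finset.univ.filter fun j => (j : ℕ) ∈ T
    have hT' : ∑ j ∈ T, q j = ∑ j ∈ T', q j := by
      have : T = T'.map Fin.valEmbedding := by
        ext j
        simp only [Finset.mem_map, T', Finset.mem_filter, Finset.mem_univ, true_and,
          Fin.valEmbedding_apply]
        constructor
        · exact fun hj => ⟨⟨j, Finset.mem_range.1 (hT hj)⟩, hj, rfl⟩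
        · rintro ⟨a, ha, rfl⟩
          exact ha
      rw [this, Finset.sum_map]
      rfl
    have h2 : (T'.sigma fun _ => (Finset.univ : Finset (Fin (q _)))) ⊆ s.biUnion t := by
      rintro ⟨j, k⟩ hjk
      obtain ⟨i, hi, ha⟩ := hal j (Finset.mem_filter.1 (Finset.mem_sigma.1 hjk).1).2
      obtain ⟨i', hi', rfl⟩ := Finset.mem_map.1 hi
      obtain ⟨x, hx, rfl⟩ := Finset.mem_image.1 hi'
      exact Finset.mem_biUnion.2 ⟨x, hx, Finset.mem_filter.2 ⟨Finset.mem_univ _, ha⟩⟩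
    have h3 := Finset.card_le_card h2
    rw [Finset.card_sigma] at h3
    simp only [Finset.card_univ, Fintype.card_fin] at h3
    rw [Finset.sum_map, hT'] at hle
    exact h1.trans (hle.trans h3)
  obtain ⟨f, hf, hft⟩ := (Finset.all_card_le_biUnion_card_iff_exists_injective t).1 hHall
  have hcard : Fintype.card (Σ i : Fin N, Fin (p i)) = Fintype.card (Σ j : Fin N, Fin (q j)) := by
    rw [Fintype.card_sigma, Fintype.card_sigma]
    simp only [Fintype.card_fin]
    rw [Fin.sum_univ_eq_sum_range p N, Fin.sum_univ_eq_sum_range q N, hpq]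
  have hbij : Function.Bijective f := (Fintype.bijective_iff_injective_and_card f).2 ⟨hf, hcard⟩
  let G : Fin N → Fin N → ℕ := fun i j =>
    (Finset.univ.filter fun k : Fin (p i) => (f ⟨i, k⟩).1 = j).card
  refine ⟨fun i j => if hij : i < N ∧ j < N then G ⟨i, hij.1⟩ ⟨j, hij.2⟩ else 0, ?_, ?_, ?_⟩
  · intro i hi
    rw [← Fin.sum_univ_eq_sum_range (fun j => if hij : i < N ∧ j < N then
      G ⟨i, hij.1⟩ ⟨j, hij.2⟩ else 0)]
    simp only [hi, Fin.is_lt, and_self, dite_true, Fin.eta, G]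
    refine (Finset.card_eq_sum_card_fiberwise (s := Finset.univ) (t := Finset.univ)
      (f := fun k : Fin (p i) => (f ⟨⟨i, hi⟩, k⟩).1)
      (fun _ _ => Finset.mem_coe.2 (Finset.mem_univ _))).symm.trans ?_
    simp
  · intro j hj
    rw [← Fin.sum_univ_eq_sum_range (fun i => if hij : i < N ∧ j < N then
      G ⟨i, hij.1⟩ ⟨j, hij.2⟩ else 0)]
    simp only [hj, Fin.is_lt, and_self, dite_true, Fin.eta, G]
    have h1 : (Finset.univ.filter fun x : Σ i : Fin N, Fin (p i) => (f x).1 = ⟨j, hj⟩).card =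
        (Finset.univ.filter fun y : Σ j : Fin N, Fin (q j) => y.1 = ⟨j, hj⟩).card :=
      Finset.card_bijective f hbij (by simp)
    have h2 : (Finset.univ.filter fun y : Σ j : Fin N, Fin (q j) => y.1 = ⟨j, hj⟩) =
        ({⟨j, hj⟩} : Finset (Fin N)).sigma fun _ => Finset.univ := by
      ext y; simp
    have h3 : (Finset.univ.filter fun x : Σ i : Fin N, Fin (p i) => (f x).1 = ⟨j, hj⟩) =
        (Finset.univ : Finset (Fin N)).sigma fun i =>
          Finset.univ.filter fun k : Fin (p i) => (f ⟨i, k⟩).1 = ⟨j, hj⟩ := by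
      ext y; simp
    rw [h2, h3, Finset.card_sigma, Finset.card_sigma] at h1
    rw [h1]
    simp
  · intro i hi j hj hal
    simp only [hi, hj, and_self, dite_true, G]
    rw [Finset.card_eq_zero, Finset.filter_eq_empty_iff]
    intro k _ hk
    have h1 := (Finset.mem_filter.1 (hft ⟨⟨i, hi⟩, k⟩)).2
    rw [hk] at h1
    exact hal h1

/-- The distribution is proportional to the weights. -/
def HasWeights {n : ℕ} (N : ℕ) (μ : PMF (Fin n)) (w : ℕ → ℕ) : Prop :=
  (∀ i : Fin n, (μ i).toReal * (∑ i ∈ Finset.range N, w i : ℕ) = w i) ∧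
    (∑ i ∈ Finset.range N, w i ≠ 0) ∧ ∀ i, n ≤ i → w i = 0

/-- Multiplying each side's weights by the total of the other gives an integral problem with equal
totals `P * Q`. A real transport yields the inequality for the neighbours of a set of rows;
conversely an integral matrix is divided by `P * Q`. Indices beyond the states carry weight zero. -/
theorem exists_isTransport_iff_hall {n n' N : ℕ} (hn : n ≤ N) (hn' : n' ≤ N) {μ : PMF (Fin n)}
    {μ' : PMF (Fin n')} {w w' : ℕ → ℕ} (hw : HasWeights N μ w) (hw' : HasWeights N μ' w')
    {C : Set (Fin n × Fin n')} {al : ℕ → ℕ → Prop}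
    (hal : ∀ (i : Fin n) (j : Fin n'), al i j ↔ (i, j) ∉ C) :
    (∃ y, IsTransport μ μ' C y) ↔
      HallCond N (fun i => w i * ∑ j ∈ Finset.range N, w' j)
        (fun j => w' j * ∑ i ∈ Finset.range N, w i) al := by
  classical
  obtain ⟨h1, h2, h3⟩ := hw
  obtain ⟨h1', h2', h3'⟩ := hw'
  set P := ∑ i ∈ Finset.range N, w i
  set Q := ∑ j ∈ Finset.range N, w' j
  have hP : (P : ℝ) ≠ 0 := by exact_mod_cast h2
  have hQ : (Q : ℝ) ≠ 0 := by exact_mod_cast h2'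
  constructor
  · rintro ⟨y, r, c, nn, z⟩ R hR
    let R' : Finset (Fin n) := Finset.univ.filter fun i => (i : ℕ) ∈ R
    let T' : Finset (Fin n') := Finset.univ.filter fun j => ∃ i ∈ R', al i j
    refine ⟨T'.map Fin.valEmbedding, ?_, ?_, ?_⟩
    · intro j hj
      obtain ⟨a, -, rfl⟩ := Finset.mem_map.1 hj
      exact Finset.mem_range.2 (a.2.trans_le hn')
    · intro j hj
      obtain ⟨a, ha, rfl⟩ := Finset.mem_map.1 hj
      obtain ⟨i, hi, hia⟩ := (Finset.mem_filter.1 ha).2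
      exact ⟨i, (Finset.mem_filter.1 hi).2, hia⟩
    · rw [Finset.sum_map]
      have hR' : ∑ i ∈ R, w i * Q = ∑ i ∈ R', w i * Q := by
        have hs : ∑ i ∈ R'.map Fin.valEmbedding, w i * Q = ∑ i ∈ R', w i * Q :=
          Finset.sum_map _ _ _
        rw [← hs]
        symm
        refine Finset.sum_subset ?_ fun i hi hi' => ?_
        · intro i hi
          obtain ⟨a, ha, rfl⟩ := Finset.mem_map.1 hi
          exact (Finset.mem_filter.1 ha).2
        · rw [h3 i, Nat.zero_mul]
          by_contra hlt
          exact hi' (Finset.mem_map.2 ⟨⟨i, not_le.1 hlt⟩,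
            Finset.mem_filter.2 ⟨Finset.mem_univ _, hi⟩, rfl⟩)
      rw [hR']
      have key : (∑ i ∈ R', (μ i).toReal) ≤ ∑ j ∈ T', (μ' j).toReal := by
        calc ∑ i ∈ R', (μ i).toReal = ∑ i ∈ R', ∑ j ∈ T', y i j := by
              refine Finset.sum_congr rfl fun i hi => ?_
              rw [← r i]
              symm
              refine Finset.sum_subset (Finset.subset_univ _) fun j _ hj => z i j ?_
              by_contra hC
              exact hj (Finset.mem_filter.2 ⟨Finset.mem_univ _, i, hi, (hal i j).2 hC⟩)
          _ = ∑ j ∈ T', ∑ i ∈ R', y i j := Finset.sum_comm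
          _ ≤ ∑ j ∈ T', ∑ i, y i j := Finset.sum_le_sum fun j _ =>
              Finset.sum_le_sum_of_subset_of_nonneg (Finset.subset_univ _) fun i _ _ => nn i j
          _ = _ := Finset.sum_congr rfl fun j _ => c j
      have key2 : ((∑ i ∈ R', w i * Q : ℕ) : ℝ) ≤ (∑ j ∈ T', w' j * P : ℕ) := by
        push_cast
        have e1 : ∀ i : Fin n, (w i : ℝ) * Q = (μ i).toReal * ((P : ℝ) * Q) := fun i => by
          rw [← h1 i]; ring
        have e2 : ∀ j : Fin n', (w' j : ℝ) * P = (μ' j).toReal * ((P : ℝ) * Q) := fun j => by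
          rw [← h1' j]; ring
        simp only [e1, e2, ← Finset.sum_mul]
        exact mul_le_mul_of_nonneg_right key (by positivity)
      exact_mod_cast key2
  · intro hH
    obtain ⟨g, hr, hc, hz⟩ := exists_matrix_of_hall hH (by
      rw [← Finset.sum_mul, ← Finset.sum_mul, mul_comm])
    have g0 : ∀ i, n ≤ i → i < N → ∀ j < N, g i j = 0 := by
      intro i hi hiN j hj
      have := hr i hiN
      simp only [h3 i hi, Nat.zero_mul] at this
      exact Finset.sum_eq_zero_iff.1 this j (Finset.mem_range.2 hj)
    have g0' : ∀ j, n' ≤ j → j < N → ∀ i < N, g i j = 0 := by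
      intro j hj hjN i hi
      have := hc j hjN
      simp only [h3' j hj, Nat.zero_mul] at this
      exact Finset.sum_eq_zero_iff.1 this i (Finset.mem_range.2 hi)
    refine ⟨fun i j => g i j / ((P : ℝ) * Q), fun i => ?_, fun j => ?_, fun i j => by positivity,
      fun i j hij => ?_⟩
    · have hi := i.2.trans_le hn
      rw [← Finset.sum_div, Fin.sum_univ_eq_sum_range (fun j => (g i j : ℝ)),
        Finset.sum_subset (Finset.range_mono hn') (fun j hj hj' => by
          rw [g0' j (by simpa using hj') (Finset.mem_range.1 hj) i hi, Nat.cast_zero]),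
        ← Nat.cast_sum, hr i hi, div_eq_iff (mul_ne_zero hP hQ), Nat.cast_mul, ← h1 i]
      ring
    · have hj := j.2.trans_le hn'
      rw [← Finset.sum_div, Fin.sum_univ_eq_sum_range (fun i => (g i j : ℝ)),
        Finset.sum_subset (Finset.range_mono hn) (fun i hi hi' => by
          rw [g0 i (by simpa using hi') (Finset.mem_range.1 hi) j hj, Nat.cast_zero]),
        ← Nat.cast_sum, hc j hj, div_eq_iff (mul_ne_zero hP hQ), Nat.cast_mul, ← h1' j]
      ring
    · change (g i j : ℝ) / _ = 0
      rw [hz i (i.2.trans_le hn) j (j.2.trans_le hn') (fun h => (hal i j).1 h hij), Nat.cast_zero,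
        zero_div]

/-- A matrix `f` with the row sums `p`, supported by the allowed pairs, where `x` is the excess of the
column sums over `q`. -/
structure IsLoad (N : ℕ) (p q : ℕ → ℕ) (al : ℕ → ℕ → Prop) (f : ℕ → ℕ → ℤ) (x : ℕ → ℤ) : Prop where
  nonneg : ∀ i < N, ∀ j < N, 0 ≤ f i j
  support : ∀ i < N, ∀ j < N, ¬ al i j → f i j = 0
  row : ∀ i < N, ∑ j ∈ Finset.range N, f i j = p i
  col : ∀ j < N, ∑ i ∈ Finset.range N, f i j = x j + q j

/-- No amount `D` can be moved from a column to one whose excess is smaller by `2 * D`. -/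
def IsStable (N : ℕ) (al : ℕ → ℕ → Prop) (f : ℕ → ℕ → ℤ) (x : ℕ → ℤ) (D : ℤ) : Prop :=
  ∀ i < N, ∀ j < N, ∀ j' < N, al i j' → D ≤ f i j → x j < x j' + 2 * D

section Load

variable {N : ℕ} {p q : ℕ → ℕ} {al : ℕ → ℕ → Prop} {f : ℕ → ℕ → ℤ} {x : ℕ → ℤ} {D : ℤ}

theorem IsLoad.sum_eq_zero (h : IsLoad N p q al f x)
    (hpq : ∑ i ∈ Finset.range N, p i = ∑ j ∈ Finset.range N, q j) :
    ∑ j ∈ Finset.range N, x j = 0 := by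
  have h1 : ∑ j ∈ Finset.range N, (x j + q j) = ∑ i ∈ Finset.range N, (p i : ℤ) := by
    rw [← Finset.sum_congr rfl fun j hj => h.col j (Finset.mem_range.1 hj), Finset.sum_comm]
    exact Finset.sum_congr rfl fun i hi => h.row i (Finset.mem_range.1 hi)
  rw [Finset.sum_add_distrib] at h1
  have h2 : (∑ i ∈ Finset.range N, (p i : ℤ)) = ∑ j ∈ Finset.range N, (q j : ℤ) := by
    exact_mod_cast hpq
  omega

/-- A stable load of a feasible problem has small excesses: between the large excesses and the
smaller ones there is a gap. -/
theorem IsLoad.le_of_isStable (h : IsLoad N p q al f x) (hs : IsStable N al f x D)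
    (hH : HallCond N p q al) (hD : 0 < D) : ∀ j < N, x j ≤ 3 * N * D := by
  classical
  by_contra! hcon
  obtain ⟨j₀, hj₀, hx⟩ := hcon
  -- There are `N` disjoint windows of width `2 * D` between `N * D` and `3 * N * D`. The excess of
  -- `j₀` lies above all of them, so the other `N - 1` columns leave one window empty.
  have hgap : ∃ k < N, ∀ j < N, ¬ (N * D + 2 * k * D ≤ x j ∧ x j < N * D + 2 * (k + 1) * D) := by
    by_contra! hall
    choose! g hg hg' using hall
    have hinj : Set.InjOn g (Finset.range N : Finset ℕ) := by
      intro a ha b hb hab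
      have ha' := hg' a (Finset.mem_range.1 ha)
      have hb' := hg' b (Finset.mem_range.1 hb)
      rw [hab] at ha'
      by_contra hne
      rcases lt_or_gt_of_ne hne with hlt | hlt
      · have : (a : ℤ) + 1 ≤ b := by exact_mod_cast hlt
        nlinarith
      · have : (b : ℤ) + 1 ≤ a := by exact_mod_cast hlt
        nlinarith
    have hsub : (Finset.range N).image g ⊆ (Finset.range N).erase j₀ := by
      intro j hj
      obtain ⟨k, hk, rfl⟩ := Finset.mem_image.1 hj
      have hk' := Finset.mem_range.1 hk
      refine Finset.mem_erase.2 ⟨?_, Finset.mem_range.2 (hg k hk')⟩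
      rintro rfl
      have h1 := (hg' k hk').2
      have : (k : ℤ) + 1 ≤ N := by exact_mod_cast hk'
      nlinarith
    have h1 := Finset.card_le_card hsub
    rw [Finset.card_image_of_injOn hinj, Finset.card_erase_of_mem (Finset.mem_range.2 hj₀),
      Finset.card_range] at h1
    omega
  obtain ⟨k, hk, hgap⟩ := hgap
  have hkN : (k : ℤ) + 1 ≤ N := by exact_mod_cast hk
  set C : Finset ℕ := (Finset.range N).filter fun j => N * D + 2 * (k + 1) * D ≤ x j
  -- `C` is the set of columns above the gap, and `R` the rows confined to it. A row outside `R` may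
  -- use a column below the gap, so by stability it has less than `D` in each column of `C`; rows in
  -- `R` are covered by the demand of `C` by Hall's condition. The total excess of `C` is thus at
  -- most `N * |C| * D`, too little for columns above the gap.
  set R : Finset ℕ := (Finset.range N).filter fun i => ∀ j < N, al i j → j ∈ C
  have hj₀C : j₀ ∈ C := Finset.mem_filter.2 ⟨Finset.mem_range.2 hj₀, by nlinarith⟩
  have hcol : ∑ j ∈ C, (x j + q j) = ∑ i ∈ Finset.range N, ∑ j ∈ C, f i j := by
    rw [Finset.sum_comm]
    exact Finset.sum_congr rfl fun j hj =>
      (h.col j (Finset.mem_range.1 (Finset.mem_filter.1 hj).1)).symm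
  have hsplit := Finset.sum_filter_add_sum_filter_not (Finset.range N)
    (fun i => ∀ j < N, al i j → j ∈ C) fun i => ∑ j ∈ C, f i j
  have hRle : ∑ i ∈ R, ∑ j ∈ C, f i j ≤ ∑ i ∈ R, (p i : ℤ) := by
    refine Finset.sum_le_sum fun i hi => ?_
    have hi' := Finset.mem_range.1 (Finset.mem_filter.1 hi).1
    rw [← h.row i hi']
    exact Finset.sum_le_sum_of_subset_of_nonneg (Finset.filter_subset _ _) fun j hj _ =>
      h.nonneg i hi' j (Finset.mem_range.1 hj)
  have hnR : ∑ i ∈ (Finset.range N).filter (fun i => ¬ ∀ j < N, al i j → j ∈ C),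
      ∑ j ∈ C, f i j ≤ N * (C.card * D) := by
    refine (Finset.sum_le_card_nsmul _ _ (C.card * D) fun i hi => ?_).trans ?_
    · obtain ⟨hi, hn⟩ := Finset.mem_filter.1 hi
      push Not at hn
      obtain ⟨j', hj', ha, hjC⟩ := hn
      have hx' : x j' < N * D + 2 * k * D := by
        by_contra hge
        refine hgap j' hj' ⟨not_lt.1 hge, ?_⟩
        by_contra hge'
        exact hjC (Finset.mem_filter.2 ⟨Finset.mem_range.2 hj', not_lt.1 hge'⟩)
      have := Finset.sum_le_card_nsmul C (fun j => f i j) D fun j hj => by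
        by_contra hlt
        obtain ⟨hj1, hj2⟩ := Finset.mem_filter.1 hj
        have := hs i (Finset.mem_range.1 hi) j (Finset.mem_range.1 hj1) j' hj' ha
          (not_le.1 hlt).le
        nlinarith
      simpa using this
    · rw [nsmul_eq_mul]
      refine mul_le_mul_of_nonneg_right ?_ (by positivity)
      have := Finset.card_filter_le (Finset.range N) fun i => ¬ ∀ j < N, al i j → j ∈ C
      rw [Finset.card_range] at this
      exact_mod_cast this
  have hHall : (∑ i ∈ R, (p i : ℤ)) ≤ ∑ j ∈ C, (q j : ℤ) := by
    have := hH.sum_le (R := R) (C := C) (Finset.filter_subset _ _) fun i hi j hj ha =>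
      (Finset.mem_filter.1 hi).2 j hj ha
    exact_mod_cast this
  have hxC : C.card * (N * D + 2 * (k + 1) * D) ≤ ∑ j ∈ C, x j := by
    have := Finset.card_nsmul_le_sum C x (N * D + 2 * (k + 1) * D) fun j hj =>
      (Finset.mem_filter.1 hj).2
    simpa using this
  rw [Finset.sum_add_distrib] at hcol
  have hpos : 0 < (C.card : ℤ) := by exact_mod_cast Finset.card_pos.2 ⟨j₀, hj₀C⟩
  have : 0 < (C.card : ℤ) * ((k + 1) * D) := by positivity
  nlinarith

/-- A load of an infeasible problem has a large excess. -/
theorem IsLoad.exists_lt_of_not_hall {p₀ q₀ : ℕ → ℕ} {M : ℕ}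
    (h : IsLoad N (fun i => M * p₀ i) (fun j => M * q₀ j) al f x) (hH : ¬ HallCond N p₀ q₀ al)
    {b : ℕ} (hM : N * b < M) : ∃ j < N, (b : ℤ) < x j := by
  classical
  unfold HallCond at hH
  push Not at hH
  obtain ⟨R, hR, hT⟩ := hH
  set T := (Finset.range N).filter fun j => ∃ i ∈ R, al i j
  have hlt := hT T (Finset.filter_subset _ _) fun j hj => (Finset.mem_filter.1 hj).2
  by_contra! hle
  have h1 : ∑ j ∈ T, x j ≤ N * b := by
    refine (Finset.sum_le_card_nsmul T x b fun j hj =>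
      hle j (Finset.mem_range.1 (Finset.mem_filter.1 hj).1)).trans ?_
    rw [nsmul_eq_mul]
    refine mul_le_mul_of_nonneg_right ?_ (by positivity)
    have := Finset.card_filter_le (Finset.range N) fun j => ∃ i ∈ R, al i j
    rw [Finset.card_range] at this
    exact_mod_cast this
  have h2 : ∑ j ∈ T, (x j + (M * q₀ j : ℕ)) = ∑ i ∈ Finset.range N, ∑ j ∈ T, f i j := by
    rw [Finset.sum_comm]
    exact Finset.sum_congr rfl fun j hj =>
      (h.col j (Finset.mem_range.1 (Finset.mem_filter.1 hj).1)).symm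
  have h3 : ∑ i ∈ R, ((M * p₀ i : ℕ) : ℤ) ≤ ∑ i ∈ Finset.range N, ∑ j ∈ T, f i j := by
    refine le_trans (le_of_eq ?_) (Finset.sum_le_sum_of_subset_of_nonneg hR fun i hi _ =>
      Finset.sum_nonneg fun j hj => h.nonneg i (Finset.mem_range.1 hi) j
        (Finset.mem_range.1 (Finset.mem_filter.1 hj).1))
    refine Finset.sum_congr rfl fun i hi => ?_
    have hi' := Finset.mem_range.1 (hR hi)
    rw [← h.row i hi']
    symm
    refine Finset.sum_subset (Finset.filter_subset _ _) fun j hj hj' => ?_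
    refine h.support i hi' j (Finset.mem_range.1 hj) fun ha => hj' ?_
    exact Finset.mem_filter.2 ⟨hj, i, hi, ha⟩
  -- Integrality: a violation of Hall's condition is by at least one unit, which the scaling
  -- magnifies to `M`. The columns `T` must absorb this excess, more than `N * b`.
  have h4 : M * (∑ j ∈ T, q₀ j + 1) ≤ M * ∑ i ∈ R, p₀ i := Nat.mul_le_mul_left _ hlt
  rw [Finset.sum_add_distrib] at h2
  simp only [Nat.cast_mul, ← Finset.mul_sum] at h2 h3
  have h5 : (M : ℤ) * (∑ j ∈ T, (q₀ j : ℤ) + 1) ≤ M * ∑ i ∈ R, (p₀ i : ℤ) := by exact_mod_cast h4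
  have h6 : (N : ℤ) * b < M := by exact_mod_cast hM
  nlinarith

/-- The excesses sum to zero, so the upper bound left by the phase with amount `2 * D` also gives
the lower bound `-6 * N² * D`. The sum of squares is at most `36 * N⁵ * D²`, and `36 < 2 * N`. -/
theorem sum_sq_lt (h : IsLoad N p q al f x)
    (hpq : ∑ i ∈ Finset.range N, p i = ∑ j ∈ Finset.range N, q j) (hD : 0 < D) (hN : 100 ≤ N)
    (hx : ∀ j < N, x j ≤ 3 * N * (2 * D)) :
    ∑ j ∈ Finset.range N, x j ^ 2 < N ^ 6 * (2 * D ^ 2) := by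
  have h0 := h.sum_eq_zero hpq
  have hN' : (100 : ℤ) ≤ N := by exact_mod_cast hN
  have hlow : ∀ j < N, -(6 * N ^ 2 * D) ≤ x j := by
    intro j hj
    have h1 := Finset.sum_erase_add (Finset.range N) x (Finset.mem_range.2 hj)
    have h2 : ∑ i ∈ (Finset.range N).erase j, x i ≤ N * (3 * N * (2 * D)) := by
      refine (Finset.sum_le_card_nsmul _ _ (3 * N * (2 * D)) fun i hi =>
        hx i (Finset.mem_range.1 (Finset.mem_erase.1 hi).2)).trans ?_
      rw [nsmul_eq_mul]
      refine mul_le_mul_of_nonneg_right ?_ (by positivity)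
      have := Finset.card_erase_le (s := Finset.range N) (a := j)
      rw [Finset.card_range] at this
      exact_mod_cast this
    nlinarith
  have hsq : ∀ j ∈ Finset.range N, x j ^ 2 ≤ (6 * N ^ 2 * D) ^ 2 := by
    intro j hj
    have h1 := hlow j (Finset.mem_range.1 hj)
    have h2 := hx j (Finset.mem_range.1 hj)
    refine sq_le_sq' h1 (h2.trans ?_)
    nlinarith [mul_pos (show (0:ℤ) < N by omega) hD]
  have h3 := Finset.sum_le_card_nsmul _ _ _ hsq
  rw [Finset.card_range, nsmul_eq_mul] at h3
  refine h3.trans_lt ?_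
  have h4 : (0 : ℤ) < N ^ 5 * D ^ 2 := by positivity
  have h5 : (N : ℤ) * (6 * N ^ 2 * D) ^ 2 = 36 * (N ^ 5 * D ^ 2) := by ring
  have h6 : (N : ℤ) ^ 6 * (2 * D ^ 2) = N * (2 * (N ^ 5 * D ^ 2)) := by ring
  rw [h5, h6]
  nlinarith

/-- Moving the amount `D` from the column `j` to the column `j'` of the row `i`. -/
theorem IsLoad.move (h : IsLoad N p q al f x) {i j j' : ℕ} (hi : i < N) (hj : j < N) (hj' : j' < N)
    (hne : j ≠ j') (ha : al i j') (hD : 0 < D) (hf : D ≤ f i j)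
    {f' : ℕ → ℕ → ℤ} {x' : ℕ → ℤ}
    (hf' : ∀ k < N, ∀ l < N, f' k l = f k l + (if k = i ∧ l = j' then D else 0) -
      if k = i ∧ l = j then D else 0)
    (hx' : ∀ l < N, x' l = x l + (if l = j' then D else 0) - if l = j then D else 0) :
    IsLoad N p q al f' x' := by
  refine ⟨fun k hk l hl => ?_, fun k hk l hl hal => ?_, fun k hk => ?_, fun l hl => ?_⟩
  · have h1 := h.nonneg k hk l hl
    rw [hf' k hk l hl]
    split_ifs with h2 h3 h3
    · omega
    · omega
    · obtain ⟨rfl, rfl⟩ := h3; omega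
    · omega
  · have h1 := h.support k hk l hl hal
    rw [hf' k hk l hl, if_neg (by rintro ⟨rfl, rfl⟩; exact hal ha), if_neg, h1]
    · rfl
    · rintro ⟨rfl, rfl⟩
      omega
  · rw [Finset.sum_congr rfl fun l hl => hf' k hk l (Finset.mem_range.1 hl),
      Finset.sum_sub_distrib, Finset.sum_add_distrib, h.row k hk]
    by_cases hki : k = i
    · simp [hki, hj, hj']
    · simp [hki]
  · rw [Finset.sum_congr rfl fun k hk => hf' k (Finset.mem_range.1 hk) l hl,
      Finset.sum_sub_distrib, Finset.sum_add_distrib, h.col l hl, hx' l hl]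
    have e : ∀ c : ℕ, ∑ k ∈ Finset.range N, (if k = i ∧ l = c then D else 0) =
        if l = c then D else 0 := by
      intro c
      by_cases h1 : l = c <;> simp [h1, hi]
    rw [e, e]
    ring

/-- The change of the two squares is `2 * D² - 2 * D * (x j - x j')`, which is at most `-2 * D²`. -/
theorem sum_sq_move {j j' : ℕ} (hj : j < N) (hj' : j' < N) (hne : j ≠ j')
    (hD : 0 < D) (hxx : x j' + 2 * D ≤ x j) {x' : ℕ → ℤ}
    (hx' : ∀ l < N, x' l = x l + (if l = j' then D else 0) - if l = j then D else 0) :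
    ∑ l ∈ Finset.range N, x' l ^ 2 + 2 * D ^ 2 ≤ ∑ l ∈ Finset.range N, x l ^ 2 := by
  have h1 : ∀ y : ℕ → ℤ, ∑ l ∈ Finset.range N, y l ^ 2 =
      ∑ l ∈ ((Finset.range N).erase j).erase j', y l ^ 2 + y j' ^ 2 + y j ^ 2 := by
    intro y
    rw [Finset.sum_erase_add _ (fun l => y l ^ 2) (Finset.mem_erase.2 ⟨hne.symm,
      Finset.mem_range.2 hj'⟩), Finset.sum_erase_add _ (fun l => y l ^ 2) (Finset.mem_range.2 hj)]
  rw [h1 x', h1 x, hx' j' hj', hx' j hj, Finset.sum_congr rfl (g := fun l => x l ^ 2)]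
  · rw [if_pos rfl, if_neg hne.symm, if_neg hne, if_pos rfl]
    nlinarith
  · intro l hl
    obtain ⟨h2, h3⟩ := Finset.mem_erase.1 hl
    obtain ⟨h3, h4⟩ := Finset.mem_erase.1 h3
    rw [hx' l (Finset.mem_range.1 h4), if_neg h2, if_neg h3]
    ring

end Load

namespace RAM

/-! ### Reasoning about array programs -/

namespace Store

variable (σ : Store) {a b i j : ℕ} {z : ℤ}

@[simp]
theorem set_of_ne (h : b ≠ a) : σ.set a i j z b = σ b := by
  ext k l
  exact if_neg fun h' => h h'.1

@[simp]
theorem set_same (k l : ℕ) : σ.set a i j z a k l = if k = i ∧ l = j then z else σ a k l := by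
  simp [set]

end Store

instance : Add AExpr := ⟨AExpr.add⟩

instance : Sub AExpr := ⟨AExpr.sub⟩

namespace AExpr

/-- A variable. -/
def reg (a : ℕ) : AExpr := cell a (lit 0) (lit 0)

variable (E : Env) (σ : Store)

@[simp] theorem eval_lit (z : ℤ) : (lit z).eval E σ = z := rfl

@[simp] theorem eval_bound : bound.eval E σ = E.N := rfl

@[simp] theorem eval_input (e : AExpr) : (input e).eval E σ = E.inp (e.eval E σ).toNat := rfl

@[simp] theorem eval_cell (a : ℕ) (i j : AExpr) :
    (cell a i j).eval E σ = σ a (i.eval E σ).toNat (j.eval E σ).toNat := rfl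

@[simp] theorem eval_reg (a : ℕ) : (reg a).eval E σ = σ a 0 0 := rfl

@[simp] theorem eval_add (a b : AExpr) : (a + b).eval E σ = a.eval E σ + b.eval E σ := rfl

@[simp] theorem eval_sub (a b : AExpr) : (a - b).eval E σ = a.eval E σ - b.eval E σ := rfl

@[simp] theorem eval_div (a b : AExpr) : (a.div b).eval E σ = a.eval E σ / b.eval E σ := rfl

end AExpr

namespace AProg

/-- Assigning to a variable. -/
def assign (a : ℕ) (e : AExpr) : AProg := store a (.lit 0) (.lit 0) e

def whenPos (e : AExpr) (p : AProg) : AProg := ite e p skip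

def whenEq (e e' : AExpr) (p : AProg) : AProg := ite (e - e') skip (ite (e' - e) skip p)

/-- The arrays to which the program may write. -/
def writes : AProg → List ℕ
  | skip => []
  | store a _ _ _ => [a]
  | seq p q => p.writes ++ q.writes
  | ite _ p q => p.writes ++ q.writes
  | loop a p => a :: p.writes

variable {E : Env}

@[simp] theorem sem_store (a : ℕ) (i j e : AExpr) (σ : Store) : (store a i j e).sem E σ =
    σ.set a (i.eval E σ).toNat (j.eval E σ).toNat (e.eval E σ) := rfl

@[simp] theorem sem_assign (a : ℕ) (e : AExpr) (σ : Store) :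
    (assign a e).sem E σ = σ.set a 0 0 (e.eval E σ) := rfl

@[simp] theorem sem_seq (p q : AProg) (σ : Store) :
    (seq p q).sem E σ = q.sem E (p.sem E σ) := rfl

theorem sem_whenPos (e : AExpr) (p : AProg) (σ : Store) :
    (whenPos e p).sem E σ = if 0 < e.eval E σ then p.sem E σ else σ := rfl

theorem sem_whenEq (e e' : AExpr) (p : AProg) (σ : Store) :
    (whenEq e e' p).sem E σ = if e.eval E σ = e'.eval E σ then p.sem E σ else σ := by
  change (if 0 < e.eval E σ - e'.eval E σ then σ else if 0 < e'.eval E σ - e.eval E σ then σ else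
    p.sem E σ) = _
  rcases lt_trichotomy (e.eval E σ) (e'.eval E σ) with h | h | h
  · rw [if_neg (by omega), if_pos (by omega), if_neg h.ne]
  · rw [if_neg (by omega), if_neg (by omega), if_pos h]
  · rw [if_pos (by omega), if_neg h.ne']

theorem sem_frame {p : AProg} {b : ℕ} (h : b ∉ p.writes) (σ : Store) : p.sem E σ b = σ b := by
  induction p generalizing σ with
  | skip => rfl
  | store a i j e => exact Store.set_of_ne _ fun hb => h (by simp [writes, hb])
  | seq p q hp hq =>
    simp only [writes, List.mem_append, not_or] at h
    rw [sem_seq, hq h.2, hp h.1]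
  | ite e p q hp hq =>
    simp only [writes, List.mem_append, not_or] at h
    rw [sem]
    split_ifs
    · exact hp h.1 σ
    · exact hq h.2 σ
  | loop a p hp =>
    simp only [writes, List.mem_cons, not_or] at h
    rw [sem]
    generalize E.N = n
    induction n with
    | zero => rfl
    | succ n ih => rw [forLoop, hp h.2, Store.set_of_ne _ h.1, ih]

/-- The rule of loop invariants combined with the frame rule: the step may use that arrays not
written by the loop still have their contents from before it. -/
theorem sem_loop_inv {a : ℕ} {p : AProg} {σ : Store} (I : ℕ → Store → Prop) (h0 : I 0 σ)
    (hs : ∀ k < E.N, ∀ τ : Store, (∀ b ∉ (loop a p).writes, τ b = σ b) → I k τ →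
      I (k + 1) (p.sem E (τ.set a 0 0 k))) : I E.N ((loop a p).sem E σ) := by
  rw [sem]
  have key : ∀ n ≤ E.N, (∀ b ∉ (loop a p).writes,
      forLoop (fun k τ => p.sem E (τ.set a 0 0 k)) n σ b = σ b) ∧
      I n (forLoop (fun k τ => p.sem E (τ.set a 0 0 k)) n σ) := by
    intro n
    induction n with
    | zero => exact fun _ => ⟨fun _ _ => rfl, h0⟩
    | succ n ih =>
      intro hn
      obtain ⟨h1, h2⟩ := ih (by omega)
      refine ⟨fun b hb => ?_, hs n (by omega) _ h1 h2⟩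
      have hb' := hb
      simp only [writes, List.mem_cons, not_or] at hb'
      rw [forLoop, sem_frame hb'.2, Store.set_of_ne _ hb'.1, h1 b hb]
  exact (key E.N le_rfl).2

/-! ### Sweeps that decrease a potential -/

section Sweep

variable {β : Type*} (E) (view : Store → β) (Inv : β → Prop) (Φ : β → ℤ) (δ : ℤ)

/-- The program keeps the view and `P` holds for it, or it decreases the potential by `δ`. -/
def IsSweep (Pre : Store → Prop) (p : AProg) (P : β → Prop) : Prop :=
  ∀ τ, Pre τ → Inv (view τ) → Inv (view (p.sem E τ)) ∧
    ((P (view τ) ∧ view (p.sem E τ) = view τ) ∨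
      (¬ P (view τ) ∧ Φ (view (p.sem E τ)) + δ ≤ Φ (view τ)))

/-- The program attains `P` or decreases the potential by `M * δ`. -/
def Converges (Pre : Store → Prop) (p : AProg) (P : β → Prop) (M : ℕ) : Prop :=
  ∀ τ, Pre τ → Inv (view τ) → Inv (view (p.sem E τ)) ∧
    (P (view τ) → view (p.sem E τ) = view τ) ∧ Φ (view (p.sem E τ)) ≤ Φ (view τ) ∧
    (P (view (p.sem E τ)) ∨ Φ (view (p.sem E τ)) + M * δ ≤ Φ (view τ))

/-- The predicate does not depend on the arrays to which the program writes. -/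
def Preserves (p : AProg) (Pre : Store → Prop) : Prop :=
  ∀ τ τ' : Store, (∀ b ∉ p.writes, τ' b = τ b) → Pre τ → Pre τ'

variable {E view Inv Φ δ} {Pre : Store → Prop}

/-- The dichotomy composes because both conditions refer to the initial view: if the first program
changed nothing, the second one tests that same view; if it lowered the potential, the second cannot
raise it again. -/
theorem IsSweep.seq {p q : AProg} {P Q : β → Prop} (hδ : 0 ≤ δ) (hPre : Preserves p Pre)
    (hp : IsSweep E view Inv Φ δ Pre p P) (hq : IsSweep E view Inv Φ δ Pre q Q) :
    IsSweep E view Inv Φ δ Pre (seq p q) fun v => P v ∧ Q v := by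
  intro τ h hI
  obtain ⟨h1, h2⟩ := hp τ h hI
  obtain ⟨h3, h4⟩ := hq (p.sem E τ) (hPre τ _ (fun b hb => sem_frame hb τ) h) h1
  refine ⟨h3, ?_⟩
  rw [sem_seq]
  rcases h2 with ⟨hP, hv⟩ | ⟨hP, hv⟩
  · rw [hv] at h4
    rcases h4 with ⟨hQ, hv'⟩ | ⟨hQ, hv'⟩
    · exact .inl ⟨⟨hP, hQ⟩, hv'⟩
    · exact .inr ⟨fun h => hQ h.2, hv'⟩
  · refine .inr ⟨fun h => hP h.1, ?_⟩
    rcases h4 with ⟨hQ, hv'⟩ | ⟨hQ, hv'⟩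
    · rwa [hv']
    · omega

theorem IsSweep.whenPos {e : AExpr} {p : AProg} {P : β → Prop} {c : β → Prop}
    (he : ∀ τ, Pre τ → (0 < e.eval E τ ↔ c (view τ)))
    (hp : IsSweep E view Inv Φ δ (fun τ => Pre τ ∧ Inv (view τ) ∧ c (view τ)) p P) :
    IsSweep E view Inv Φ δ Pre (whenPos e p) fun v => c v → P v := by
  intro τ h hI
  rw [sem_whenPos]
  by_cases hc : c (view τ)
  · rw [if_pos ((he τ h).2 hc)]
    simpa [hc] using hp τ ⟨h, hI, hc⟩ hI
  · rw [if_neg fun h' => hc ((he τ h).1 h')]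
    exact ⟨hI, .inl ⟨fun h' => (hc h').elim, rfl⟩⟩

theorem IsSweep.of_imp {Pre' : Store → Prop} {p : AProg} {P : β → Prop}
    (h : IsSweep E view Inv Φ δ Pre p P) (hPre : ∀ τ, Pre' τ → Pre τ) :
    IsSweep E view Inv Φ δ Pre' p P :=
  fun τ hτ => h τ (hPre τ hτ)

theorem IsSweep.comp {Pre' : Store → Prop} {p q : AProg} {P : β → Prop}
    (hp : ∀ τ, Pre τ → view (p.sem E τ) = view τ ∧ Pre' (p.sem E τ))
    (hq : IsSweep E view Inv Φ δ Pre' q P) : IsSweep E view Inv Φ δ Pre (AProg.seq p q) P := by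
  intro τ h hI
  obtain ⟨h1, h2⟩ := hp τ h
  have := hq (p.sem E τ) h2 (by rwa [h1])
  rwa [h1] at this

theorem IsSweep.loop {a : ℕ} {p : AProg} {P : ℕ → β → Prop} (hδ : 0 ≤ δ)
    (hview : ∀ (τ : Store) (k : ℕ), view (τ.set a 0 0 k) = view τ)
    (hPre : Preserves (loop a p) Pre)
    (h : ∀ k < E.N, IsSweep E view Inv Φ δ (fun τ => Pre τ ∧ τ a 0 0 = k) p (P k)) :
    IsSweep E view Inv Φ δ Pre (loop a p) fun v => ∀ k < E.N, P k v := by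
  intro σ hσ hI
  refine sem_loop_inv (fun k τ => Inv (view τ) ∧
    (((∀ i < k, P i (view σ)) ∧ view τ = view σ) ∨
      (¬ (∀ i < k, P i (view σ)) ∧ Φ (view τ) + δ ≤ Φ (view σ)))) ?_ ?_
  · exact ⟨hI, .inl ⟨fun i hi => (Nat.not_lt_zero i hi).elim, rfl⟩⟩
  · rintro k hk τ hfr ⟨h1, h2⟩
    have hpre : Pre (τ.set a 0 0 k) := by
      refine hPre σ _ (fun b hb => ?_) hσ
      rw [← hfr b hb, Store.set_of_ne]
      rintro rfl
      exact hb List.mem_cons_self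
    obtain ⟨h3, h4⟩ := h k hk (τ.set a 0 0 k) ⟨hpre, by simp⟩ (by rwa [hview])
    refine ⟨h3, ?_⟩
    rw [hview] at h4
    rcases h2 with ⟨hP, hv⟩ | ⟨hP, hv⟩
    · rw [hv] at h4
      rcases h4 with ⟨hQ, hv'⟩ | ⟨hQ, hv'⟩
      · refine .inl ⟨fun i hi => ?_, hv'⟩
        rcases Nat.lt_succ_iff_lt_or_eq.1 hi with hi | rfl
        · exact hP i hi
        · exact hQ
      · exact .inr ⟨fun h' => hQ (h' k (Nat.lt_succ_self k)), hv'⟩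
    · refine .inr ⟨fun h' => hP fun i hi => h' i (by omega), ?_⟩
      rcases h4 with ⟨hQ, hv'⟩ | ⟨hQ, hv'⟩
      · rwa [hv']
      · omega

theorem IsSweep.converges {p : AProg} {P : β → Prop} (hδ : 0 ≤ δ)
    (hp : IsSweep E view Inv Φ δ Pre p P) : Converges E view Inv Φ δ Pre p P 1 := by
  intro τ h hI
  obtain ⟨h1, h2⟩ := hp τ h hI
  refine ⟨h1, ?_⟩
  rcases h2 with ⟨hP, hv⟩ | ⟨hP, hv⟩
  · exact ⟨fun _ => hv, by rw [hv], .inl (by rwa [hv])⟩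
  · exact ⟨fun h => (hP h).elim, by omega, .inr (by simpa using hv)⟩

/-- Once `P` holds the view is frozen; until then every round gains `M * δ`, and the gains add up.
-/
theorem Converges.loop {a M : ℕ} {p : AProg} {P : β → Prop}
    (hview : ∀ (τ : Store) (k : ℕ), view (τ.set a 0 0 k) = view τ)
    (hPre : Preserves (loop a p) Pre)
    (h : Converges E view Inv Φ δ Pre p P M) :
    Converges E view Inv Φ δ Pre (loop a p) P (E.N * M) := by
  intro σ hσ hI
  have := sem_loop_inv (E := E) (a := a) (p := p) (σ := σ) (fun k τ => Inv (view τ) ∧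
    (P (view σ) → view τ = view σ) ∧ Φ (view τ) ≤ Φ (view σ) ∧
    (P (view τ) ∨ Φ (view τ) + k * M * δ ≤ Φ (view σ))) ?_ ?_
  · simpa using this
  · exact ⟨hI, fun _ => rfl, le_rfl, .inr (by simp)⟩
  · rintro k hk τ hfr ⟨h1, h2, h3, h4⟩
    have hpre : Pre (τ.set a 0 0 k) := by
      refine hPre σ _ (fun b hb => ?_) hσ
      rw [← hfr b hb, Store.set_of_ne]
      rintro rfl
      exact hb List.mem_cons_self
    obtain ⟨g1, g2, g3, g4⟩ := h (τ.set a 0 0 k) hpre (by rwa [hview])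
    rw [hview] at g2 g3 g4
    refine ⟨g1, fun hP => ?_, g3.trans h3, ?_⟩
    · have := h2 hP
      rw [← this] at hP
      rw [g2 hP, this]
    · by_cases hP : P (view τ)
      · left
        rwa [g2 hP]
      · have h5 := h4.resolve_left hP
        refine g4.imp id fun h6 => ?_
        push_cast
        have : ((k : ℤ) + 1) * M * δ = k * M * δ + M * δ := by ring
        omega

/-- Repeating a program `N ^ d` times. -/
def repeatPow (a : ℕ) (p : AProg) : ℕ → AProg
  | 0 => p
  | d + 1 => AProg.loop a (repeatPow a p d)

theorem notMem_writes_repeatPow {a b d : ℕ} {p : AProg} (hb : b ∉ a :: p.writes) :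
    b ∉ (repeatPow a p d).writes := by
  induction d with
  | zero => exact fun h => hb (List.mem_cons_of_mem _ h)
  | succ d ih =>
    simp only [repeatPow, writes, List.mem_cons, not_or]
    exact ⟨fun h => hb (h ▸ List.mem_cons_self), ih⟩

theorem Converges.repeatPow {a M : ℕ} {p : AProg} {P : β → Prop}
    (hview : ∀ (τ : Store) (k : ℕ), view (τ.set a 0 0 k) = view τ)
    (hPre : Preserves (AProg.loop a p) Pre)
    (h : Converges E view Inv Φ δ Pre p P M) (d : ℕ) :
    Converges E view Inv Φ δ Pre (repeatPow a p d) P (E.N ^ d * M) := by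
  induction d with
  | zero => simpa [AProg.repeatPow] using h
  | succ d ih =>
    rw [pow_succ', mul_assoc]
    refine ih.loop hview fun τ τ' hτ => hPre τ τ' fun b hb => hτ b ?_
    exact notMem_writes_repeatPow (d := d + 1) hb

theorem sem_repeatPow_inv {a : ℕ} {p : AProg} {σ : Store} (I : ℕ → Store → Prop)
    (hset : ∀ k (τ : Store) (z : ℕ), I k τ → I k (τ.set a 0 0 z))
    (hs : ∀ k (τ : Store), (∀ b ∉ a :: p.writes, τ b = σ b) → I k τ → I (k + 1) (p.sem E τ))
    (h0 : I 0 σ) (d : ℕ) : I (E.N ^ d) ((repeatPow a p d).sem E σ) := by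
  have key : ∀ d k (τ : Store), (∀ b ∉ a :: p.writes, τ b = σ b) → I k τ →
      I (k + E.N ^ d) ((repeatPow a p d).sem E τ) := by
    intro d
    induction d with
    | zero => exact fun k τ => hs k τ
    | succ d ih =>
      intro k τ hτ hk
      have := sem_loop_inv (E := E) (a := a) (p := repeatPow a p d) (σ := τ)
        (fun m τ => I (k + m * E.N ^ d) τ) (by simpa using hk) fun m _ ρ hρ hm => by
          rw [Nat.succ_mul, ← Nat.add_assoc]
          refine ih _ _ (fun b hb => ?_) (hset _ _ _ hm)
          rw [Store.set_of_ne _ (fun h => hb (by simp [h])),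
            hρ b (notMem_writes_repeatPow (d := d + 1) hb), hτ b hb]
      rwa [← pow_succ'] at this
  simpa using key d 0 σ (fun _ _ => rfl) h0

end Sweep

end AProg

end RAM

namespace RAM

/-! ### The names of the arrays -/

notation "vRes" => (0 : ℕ)
notation "vNumS" => (1 : ℕ)
notation "vNumS'" => (2 : ℕ)
notation "vNumT" => (3 : ℕ)
notation "vNumT'" => (4 : ℕ)
notation "vInit" => (5 : ℕ)
notation "vInit'" => (6 : ℕ)
notation "vPos" => (7 : ℕ)
notation "vRecs" => (8 : ℕ)
notation "vRecs'" => (9 : ℕ)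
notation "vMatch" => (10 : ℕ)
notation "vBad" => (11 : ℕ)
notation "vFeas" => (12 : ℕ)
notation "vReach" => (13 : ℕ)
notation "kA" => (14 : ℕ)
notation "kB" => (15 : ℕ)
notation "kI" => (16 : ℕ)
notation "kJ" => (17 : ℕ)
notation "kL" => (18 : ℕ)
notation "kR" => (19 : ℕ)
notation "vSum" => (22 : ℕ)
notation "vSum'" => (23 : ℕ)
notation "vMulX" => (24 : ℕ)
notation "vMulY" => (25 : ℕ)
notation "vProd" => (26 : ℕ)
notation "vOk" => (27 : ℕ)
notation "vFlow" => (29 : ℕ)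
notation "vExc" => (30 : ℕ)
notation "vAmt" => (31 : ℕ)

open AExpr AProg

variable {E : Env}

/-! ### Arithmetic -/

/-- Summing the values of an expression. -/
def sumProg (d a : ℕ) (e : AExpr) : AProg :=
  seq (assign d (lit 0)) (loop a (assign d (reg d + e)))

theorem sem_sumProg {d a : ℕ} (hda : d ≠ a) {e : AExpr} {σ : Store} (g : ℕ → ℤ)
    (he : ∀ k < E.N, ∀ τ : Store, (∀ b, b ≠ d → b ≠ a → τ b = σ b) → τ a 0 0 = k →
      e.eval E τ = g k) :
    (sumProg d a e).sem E σ d 0 0 = ∑ k ∈ Finset.range E.N, g k := by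
  refine sem_loop_inv (fun k τ => τ d 0 0 = ∑ i ∈ Finset.range k, g i) (by simp) ?_
  intro k hk τ hτ h
  rw [Finset.sum_range_succ, ← h, sem_assign, Store.set_same, if_pos ⟨rfl, rfl⟩, eval_add, eval_reg,
    Store.set_of_ne _ hda, he k hk _ ?_ (by simp)]
  intro b hb hb'
  rw [Store.set_of_ne _ hb', hτ b (by simp [assign, writes, hb, hb']), sem_assign,
    Store.set_of_ne _ hb]

/-- Multiplication by `2 ^ N`. -/
def shiftProg (d a : ℕ) : AProg := loop a (assign d (reg d + reg d))

theorem sem_shiftProg {d a : ℕ} (hda : d ≠ a) (σ : Store) :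
    (shiftProg d a).sem E σ d 0 0 = 2 ^ E.N * σ d 0 0 := by
  refine sem_loop_inv (fun k τ => τ d 0 0 = 2 ^ k * σ d 0 0) (by simp) ?_
  intro k _ τ _ h
  simp only [sem_assign, eval_add, eval_reg, Store.set_of_ne _ hda, Store.set_same, and_self,
    if_true, h]
  ring

/-- Multiplication of the numbers in `vMulX` and `vMulY`. -/
def mulProg : AProg :=
  seq (assign vProd (lit 0)) <| loop kR <|
    seq (whenPos (reg vMulY - (reg vMulY).div (lit 2) - (reg vMulY).div (lit 2))
      (assign vProd (reg vProd + reg vMulX))) <|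
    seq (assign vMulX (reg vMulX + reg vMulX)) (assign vMulY ((reg vMulY).div (lit 2)))

/-- Binary multiplication: doubling one factor and halving the other keeps product plus accumulator
constant, where an odd `vMulY` is detected by a remainder after subtracting its half twice. After
`N` rounds `vMulY` is zero. -/
theorem sem_mulProg {σ : Store} (h0 : 0 ≤ σ vMulY 0 0) (h : σ vMulY 0 0 < 2 ^ E.N) :
    mulProg.sem E σ vProd 0 0 = σ vMulX 0 0 * σ vMulY 0 0 := by
  have := sem_loop_inv (E := E) (a := kR) (p :=
    seq (whenPos (reg vMulY - (reg vMulY).div (lit 2) - (reg vMulY).div (lit 2))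
      (assign vProd (reg vProd + reg vMulX))) <|
    seq (assign vMulX (reg vMulX + reg vMulX)) (assign vMulY ((reg vMulY).div (lit 2))))
    (σ := (assign vProd (lit 0)).sem E σ)
    (fun k τ => 0 ≤ τ vMulY 0 0 ∧ τ vMulY 0 0 * 2 ^ k < 2 ^ E.N ∧
      τ vProd 0 0 + τ vMulX 0 0 * τ vMulY 0 0 = σ vMulX 0 0 * σ vMulY 0 0)
    (by simpa using ⟨h0, h⟩) ?_
  · obtain ⟨h1, h2, h3⟩ := this
    have h4 : mulProg.sem E σ vMulY 0 0 < 1 := by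
      by_contra hge
      exact absurd h2 (not_lt.2 (le_mul_of_one_le_left (by positivity) (not_lt.1 hge)))
    have h5 : mulProg.sem E σ vMulY 0 0 = 0 := le_antisymm (Int.lt_add_one_iff.1 h4) h1
    rw [← h3]
    change _ = mulProg.sem E σ vProd 0 0 + mulProg.sem E σ vMulX 0 0 * mulProg.sem E σ vMulY 0 0
    rw [h5, mul_zero, add_zero]
  · rintro k - τ - ⟨h1, h2, h3⟩
    have h6 : τ vMulY 0 0 / 2 * 2 ^ (k + 1) ≤ τ vMulY 0 0 * 2 ^ k := by
      rw [pow_succ', ← mul_assoc]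
      exact mul_le_mul_of_nonneg_right (by omega) (by positivity)
    simp only [sem_seq, sem_whenPos]
    by_cases hp : 0 < τ vMulY 0 0 - τ vMulY 0 0 / 2 - τ vMulY 0 0 / 2
    · have h7 : τ vMulY 0 0 = 2 * (τ vMulY 0 0 / 2) + 1 := by omega
      rw [if_pos (by simpa using hp)]
      simp
      refine ⟨by omega, h6.trans_lt h2, ?_⟩
      rw [← h3]
      nth_rw 2 [h7]
      ring
    · have h7 : τ vMulY 0 0 = 2 * (τ vMulY 0 0 / 2) := by omega
      rw [if_neg (by simpa using hp)]
      simp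
      refine ⟨by omega, h6.trans_lt h2, ?_⟩
      rw [← h3]
      nth_rw 2 [h7]
      ring

/-! ### Deciding the feasibility of a transportation problem by load balancing -/

/-- The start of the load balancing: everything is in the last column. -/
def loadInit : AProg :=
  seq (sumProg vSum kI (cell vRecs (reg kA) (reg kI + lit 2))) <|
  seq (sumProg vSum' kJ (cell vRecs' (reg kB) (reg kJ + lit 3))) <|
  seq (shiftProg vSum kR) <|
  seq (shiftProg vSum' kR) <|
  seq (loop kJ <|
    seq (assign vMulX (reg vSum)) <|
    seq (assign vMulY (cell vRecs' (reg kB) (reg kJ + lit 3))) <|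
    seq mulProg (store vExc (reg kJ) (lit 0) (lit 0 - reg vProd))) <|
  loop kI <|
    seq (assign vMulX (reg vSum')) <|
    seq (assign vMulY (cell vRecs (reg kA) (reg kI + lit 2))) <|
    seq mulProg <|
    seq (loop kJ (store vFlow (reg kI) (reg kJ) (lit 0))) <|
    seq (store vFlow (reg kI) (bound - lit 1) (reg vProd)) <|
    store vExc (bound - lit 1) (lit 0) (cell vExc (bound - lit 1) (lit 0) + reg vProd)

/-- Moving the amount in `vAmt` once between two columns if this is allowed. -/
def loadMove : AProg :=
  whenPos (lit 1 - cell vBad (reg kI) (reg kL)) <|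
  -- Tests are for positivity, so the added one expresses a weak inequality between integers;
  -- likewise in the next test.
  whenPos (cell vFlow (reg kI) (reg kJ) - reg vAmt + lit 1) <|
  whenPos (cell vExc (reg kJ) (lit 0) - cell vExc (reg kL) (lit 0) - reg vAmt - reg vAmt + lit 1) <|
  seq (store vFlow (reg kI) (reg kJ) (cell vFlow (reg kI) (reg kJ) - reg vAmt)) <|
  seq (store vFlow (reg kI) (reg kL) (cell vFlow (reg kI) (reg kL) + reg vAmt)) <|
  seq (store vExc (reg kJ) (lit 0) (cell vExc (reg kJ) (lit 0) - reg vAmt)) <|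
  store vExc (reg kL) (lit 0) (cell vExc (reg kL) (lit 0) + reg vAmt)

def loadSweep : AProg := loop kI (loop kJ (loop kL loadMove))

/-- A phase starts with a potential below `N⁶ * (2 * D²)` when the problem is feasible, and each
sweep that finds a move lowers it by `2 * D²`; hence `N⁶` sweeps. -/
def loadPhase : AProg :=
  seq (assign vAmt ((reg vAmt).div (lit 2))) (repeatPow kR loadSweep 6)

/-- Load balancing with amounts that are halved successively. -/
def feasProg : AProg :=
  seq loadInit <|
  seq (assign vAmt (lit 1)) <|
  -- Doubling `N²` times gives the amount `2 ^ N²`; the `N²` phases, each of which halves first, end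
  -- with amount one.
  seq (repeatPow kR (assign vAmt (reg vAmt + reg vAmt)) 2) <|
  seq (repeatPow kR loadPhase 2) <|
  seq (store vFeas (reg kA) (reg kB) (lit 1)) <|
  loop kJ <| whenPos (cell vExc (reg kJ) (lit 0) - bound - bound - bound)
    (store vFeas (reg kA) (reg kB) (lit 0))

/-- The matrix and the excesses of the load balancing. -/
def loadView (τ : Store) : (ℕ → ℕ → ℤ) × (ℕ → ℤ) := (τ vFlow, fun j => τ vExc j 0)

theorem isSweep_loadMove {p q : ℕ → ℕ} {al : ℕ → ℕ → Prop} {D : ℤ} (hD : 0 < D) {i j l : ℕ}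
    (hi : i < E.N) (hj : j < E.N) (hl : l < E.N) :
    IsSweep E loadView (fun v => IsLoad E.N p q al v.1 v.2)
      (fun v => ∑ j ∈ Finset.range E.N, v.2 j ^ 2) (2 * D ^ 2)
      (fun τ => (((τ vAmt 0 0 = D ∧ ∀ i j, τ vBad i j ≤ 0 ↔ al i j) ∧ τ kI 0 0 = i) ∧
        τ kJ 0 0 = j) ∧ τ kL 0 0 = l)
      loadMove fun v => al i l → D ≤ v.1 i j → v.2 j < v.2 l + 2 * D := by
  rintro τ ⟨⟨⟨⟨h1, h2⟩, h3⟩, h4⟩, h5⟩ hI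
  have e1 := h2 i l
  by_cases hc : al i l ∧ D ≤ τ vFlow i j ∧ τ vExc l 0 + 2 * D ≤ τ vExc j 0
  · obtain ⟨ha, hf, hx⟩ := hc
    have hb := e1.2 ha
    have hne : j ≠ l := by
      rintro rfl
      omega
    have hf' : ∀ k m, (loadMove.sem E τ) vFlow k m = τ vFlow k m +
        (if k = i ∧ m = l then D else 0) - if k = i ∧ m = j then D else 0 := by
      intro k m
      rw [loadMove, sem_whenPos, if_pos (by simp [h3, h5]; omega), sem_whenPos,
        if_pos (by simp [h1, h3, h4]; omega), sem_whenPos, if_pos (by simp [h1, h4, h5]; omega)]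
      by_cases hk : k = i
      · by_cases hmj : m = j <;> by_cases hml : m = l <;> simp_all
      · simp_all
    have hx' : ∀ m, (loadMove.sem E τ) vExc m 0 = τ vExc m 0 +
        (if m = l then D else 0) - if m = j then D else 0 := by
      intro m
      rw [loadMove, sem_whenPos, if_pos (by simp [h3, h5]; omega), sem_whenPos,
        if_pos (by simp [h1, h3, h4]; omega), sem_whenPos, if_pos (by simp [h1, h4, h5]; omega)]
      by_cases hmj : m = j <;> by_cases hml : m = l <;> simp_all
    refine ⟨hI.move hi hj hl hne ha hD hf (fun k _ m _ => hf' k m) fun m _ => hx' m,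
      .inr ⟨fun h => ?_, ?_⟩⟩
    · exact absurd (h ha hf) (not_lt.2 hx)
    · exact sum_sq_move hj hl hne hD hx fun m _ => hx' m
  · have h6 : loadMove.sem E τ = τ := by
      simp only [loadMove, sem_whenPos]
      split_ifs with c1 c2 c3
      · simp [h1, h3, h4, h5] at c1 c2 c3
        exact absurd ⟨e1.1 (by omega), by omega, by omega⟩ hc
      all_goals rfl
    rw [h6]
    refine ⟨hI, .inl ⟨fun ha hf => ?_, rfl⟩⟩
    by_contra hx
    exact hc ⟨ha, hf, not_lt.1 hx⟩

/-- A sweep without a move has tested all triples on one and the same load, which is therefore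
stable; any other sweep pays `2 * D²`. -/
theorem converges_loadSweep {p q : ℕ → ℕ} {al : ℕ → ℕ → Prop} {D : ℤ} (hD : 0 < D) :
    Converges E loadView (fun v => IsLoad E.N p q al v.1 v.2)
      (fun v => ∑ j ∈ Finset.range E.N, v.2 j ^ 2) (2 * D ^ 2)
      (fun τ => τ vAmt 0 0 = D ∧ ∀ i j, τ vBad i j ≤ 0 ↔ al i j)
      (repeatPow kR loadSweep 6) (fun v => IsStable E.N al v.1 v.2 D) (E.N ^ 6) := by
  have hδ : 0 ≤ 2 * D ^ 2 := by positivity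
  rw [← mul_one (E.N ^ 6)]
  have hview : ∀ a, a ≠ vFlow → a ≠ vExc → ∀ (τ : Store) (k : ℕ),
      loadView (τ.set a 0 0 k) = loadView τ := by
    intro a h1 h2 τ k
    simp only [loadView, Store.set_of_ne _ h1.symm, Store.set_of_ne _ h2.symm]
  have hP1 : ∀ τ τ' : Store, τ' vAmt = τ vAmt → τ' vBad = τ vBad →
      (τ vAmt 0 0 = D ∧ ∀ i j, τ vBad i j ≤ 0 ↔ al i j) →
      τ' vAmt 0 0 = D ∧ ∀ i j, τ' vBad i j ≤ 0 ↔ al i j := by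
    intro τ τ' h1 h2 h3
    rwa [h1, h2]
  refine (IsSweep.converges hδ ?_).repeatPow (hview _ (by decide) (by decide)) ?_ 6
  · refine IsSweep.loop hδ (hview _ (by decide) (by decide)) ?_ fun i hi => ?_
    · exact fun τ τ' h => hP1 τ τ' (h _ (by decide)) (h _ (by decide))
    refine IsSweep.loop hδ (hview _ (by decide) (by decide)) ?_ fun j hj => ?_
    · exact fun τ τ' h => And.imp (hP1 τ τ' (h _ (by decide)) (h _ (by decide)))
        (h kI (by decide) ▸ id)
    refine IsSweep.loop hδ (hview _ (by decide) (by decide)) ?_ fun l hl => ?_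
    · exact fun τ τ' h => And.imp (And.imp (hP1 τ τ' (h _ (by decide)) (h _ (by decide)))
        (h kI (by decide) ▸ id)) (h kJ (by decide) ▸ id)
    exact isSweep_loadMove hD hi hj hl
  · exact fun τ τ' h => hP1 τ τ' (h _ (by decide)) (h _ (by decide))

/-- Stability is conditional: a sum of squares cannot become negative, so a small initial potential
rules out `N⁶` decreases. The load invariant survives in any case, which the infeasible problems
need. -/
theorem sem_loadPhase {p q : ℕ → ℕ} {al : ℕ → ℕ → Prop} {D : ℤ} (hD : 0 < D) {τ : Store}
    (hA : τ vAmt 0 0 = 2 * D) (hB : ∀ i j, τ vBad i j ≤ 0 ↔ al i j)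
    (hI : IsLoad E.N p q al (τ vFlow) fun j => τ vExc j 0) :
    (loadPhase.sem E τ) vAmt 0 0 = D ∧
      IsLoad E.N p q al ((loadPhase.sem E τ) vFlow) (fun j => (loadPhase.sem E τ) vExc j 0) ∧
      (∑ j ∈ Finset.range E.N, τ vExc j 0 ^ 2 < E.N ^ 6 * (2 * D ^ 2) →
        IsStable E.N al ((loadPhase.sem E τ) vFlow) (fun j => (loadPhase.sem E τ) vExc j 0) D) := by
  have hA' : (assign vAmt ((reg vAmt).div (lit 2))).sem E τ vAmt 0 0 = D := by
    simp [hA]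
  obtain ⟨h1, -, -, h2⟩ := converges_loadSweep (p := p) (q := q) hD
    ((assign vAmt ((reg vAmt).div (lit 2))).sem E τ)
    ⟨hA', by simpa using hB⟩ (by simpa [loadView] using hI)
  refine ⟨?_, h1, fun hlt => h2.resolve_right ?_⟩
  · rw [loadPhase, sem_seq, sem_frame (notMem_writes_repeatPow (by decide)), hA']
  · simp only [loadView, sem_assign, Store.set_of_ne _ (show vExc ≠ vAmt by decide)]
    rw [not_le]
    push_cast
    refine hlt.trans_le ?_
    simp only [le_add_iff_nonneg_left]
    positivity

theorem sem_doubling {τ : Store} : (repeatPow kR (assign vAmt (reg vAmt + reg vAmt)) 2).sem E τ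
    vAmt 0 0 = 2 ^ E.N ^ 2 * τ vAmt 0 0 := by
  refine sem_repeatPow_inv (fun k ρ => ρ vAmt 0 0 = 2 ^ k * τ vAmt 0 0) ?_ ?_ (by simp) 2
  · intro k ρ z h
    simpa using h
  · intro k ρ _ h
    simp [h]
    ring

theorem _root_.Masking.HallCond.mul_left {N M : ℕ} {p q : ℕ → ℕ} {al : ℕ → ℕ → Prop} (h : HallCond N p q al) :
    HallCond N (fun i => M * p i) (fun j => M * q j) al := by
  intro R hR
  obtain ⟨T, hT, h1, h2⟩ := h R hR
  refine ⟨T, hT, h1, ?_⟩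
  rw [← Finset.mul_sum, ← Finset.mul_sum]
  exact Nat.mul_le_mul_left _ h2

/-- In a feasible problem stability for one amount bounds the potential at the start of the next
phase, down to excesses of at most `3 * N` for amount one. In an infeasible one the final load has
an excess above `3 * N`, whatever the phases did. -/
theorem sem_loadPhases {M : ℕ} {p q : ℕ → ℕ} {al : ℕ → ℕ → Prop} {τ : Store} (hN : 100 ≤ E.N)
    (hpq : ∑ i ∈ Finset.range E.N, p i = ∑ j ∈ Finset.range E.N, q j)
    (hA : τ vAmt 0 0 = 2 ^ E.N ^ 2) (hB : ∀ i j, τ vBad i j ≤ 0 ↔ al i j)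
    (hI : IsLoad E.N (fun i => M * p i) (fun j => M * q j) al (τ vFlow) fun j => τ vExc j 0)
    (hx : 2 * ∑ j ∈ Finset.range E.N, τ vExc j 0 ^ 2 < (2 ^ E.N ^ 2) ^ 2)
    (hM : E.N * (3 * E.N) < M) :
    (∀ j < E.N, (repeatPow kR loadPhase 2).sem E τ vExc j 0 ≤ 3 * E.N) ↔
      HallCond E.N p q al := by
  -- Here `m` is the number of phases still to come, so the amount is `2 ^ m`; the potential bound
  -- is stated for the halved amount `D` of the next phase.
  have key := sem_repeatPow_inv (E := E) (a := kR) (p := loadPhase) (σ := τ) (fun k ρ =>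
    ∀ m, k + m = E.N ^ 2 →
      IsLoad E.N (fun i => M * p i) (fun j => M * q j) al (ρ vFlow) (fun j => ρ vExc j 0) ∧
      ρ vAmt 0 0 = 2 ^ m ∧ (HallCond E.N p q al →
      (m = 0 → ∀ j < E.N, ρ vExc j 0 ≤ 3 * E.N) ∧
      ∀ D : ℤ, 2 ^ m = 2 * D → ∑ j ∈ Finset.range E.N, ρ vExc j 0 ^ 2 < E.N ^ 6 * (2 * D ^ 2)))
    ?_ ?_ ?_ 2
  · obtain ⟨h1, -, h2⟩ := key 0 rfl
    refine ⟨fun h => ?_, fun h => (h2 h).1 rfl⟩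
    by_contra hH
    obtain ⟨j, hj, hlt⟩ := h1.exists_lt_of_not_hall hH hM
    exact absurd (h j hj) (not_le.2 (by exact_mod_cast hlt))
  · intro k ρ z h
    simpa using h
  · intro k ρ hρ h m hm
    obtain ⟨h1, h3, h4⟩ := h (m + 1) (by omega)
    rw [pow_succ'] at h3
    have hD : (0 : ℤ) < 2 ^ m := by positivity
    obtain ⟨g1, g2, g3⟩ := sem_loadPhase hD h3 (by rwa [hρ vBad (by decide)]) h1
    refine ⟨g2, g1, fun hH => ?_⟩
    have hs := g2.le_of_isStable (g3 ((h4 hH).2 _ (pow_succ' _ _))) (hH.mul_left) hD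
    refine ⟨fun h0 => ?_, fun D hD' => ?_⟩
    · subst h0
      simpa using hs
    · rw [hD'] at hs hD
      refine sum_sq_lt g2 ?_ (by omega) hN hs
      rw [← Finset.mul_sum, ← Finset.mul_sum, hpq]
  · intro m hm
    obtain rfl : m = E.N ^ 2 := by omega
    refine ⟨hI, hA, fun _ => ⟨fun h0 => ?_, fun D hD => ?_⟩⟩
    · have : 0 < E.N ^ 2 := by positivity
      omega
    -- The first amount is so large that the initial potential is below `2 * D²` even without the
    -- factor `N⁶`.
    · rw [hD] at hx
      have h6 : (1 : ℤ) ≤ E.N ^ 6 := one_le_pow₀ (by exact_mod_cast (by omega : 1 ≤ E.N))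
      nlinarith [sq_nonneg D]

theorem sem_loadInit {a b : ℕ} {w w' p q : ℕ → ℕ} {σ : Store} (hN : 0 < E.N)
    (ha : σ kA 0 0 = a) (hb : σ kB 0 0 = b)
    (hw : ∀ i < E.N, σ vRecs a (i + 2) = w i) (hw' : ∀ i < E.N, σ vRecs' b (i + 3) = w' i)
    (hlt : ∀ i < E.N, w i < 2 ^ E.N) (hlt' : ∀ i < E.N, w' i < 2 ^ E.N) (h0 : w' (E.N - 1) = 0)
    (hp : ∀ i, p i = 2 ^ E.N * (w i * ∑ j ∈ Finset.range E.N, w' j))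
    (hq : ∀ j, q j = 2 ^ E.N * (w' j * ∑ i ∈ Finset.range E.N, w i)) :
    (∀ i < E.N, ∀ j < E.N, loadInit.sem E σ vFlow i j = if j = E.N - 1 then (p i : ℤ) else 0) ∧
    ∀ j < E.N, loadInit.sem E σ vExc j 0 =
      if j = E.N - 1 then ∑ i ∈ Finset.range E.N, (p i : ℤ) else -q j := by
  have t2 : ∀ k : ℕ, ((k : ℤ) + 2).toNat = k + 2 := fun k => by omega
  have t3 : ∀ k : ℕ, ((k : ℤ) + 3).toNat = k + 3 := fun k => by omega
  have t1 : ((E.N : ℤ) - 1).toNat = E.N - 1 := by omega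
  rw [loadInit]
  simp only [sem_seq]
  set σ₁ := (sumProg vSum kI (cell vRecs (reg kA) (reg kI + lit 2))).sem E σ with hσ₁
  set σ₂ := (sumProg vSum' kJ (cell vRecs' (reg kB) (reg kJ + lit 3))).sem E σ₁ with hσ₂
  set σ₃ := (shiftProg vSum kR).sem E σ₂ with hσ₃
  set σ₄ := (shiftProg vSum' kR).sem E σ₃ with hσ₄
  have f : ∀ c ∉ [vSum, kI, vSum', kJ, kR], σ₄ c = σ c := by
    intro c hc
    simp only [List.mem_cons, List.not_mem_nil, not_or] at hc
    rw [hσ₄, sem_frame, hσ₃, sem_frame, hσ₂, sem_frame, hσ₁, sem_frame] <;>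
      simp [sumProg, shiftProg, assign, writes, hc]
  have e₁ : σ₄ vSum 0 0 = 2 ^ E.N * ∑ i ∈ Finset.range E.N, (w i : ℤ) := by
    rw [hσ₄, sem_frame (by decide), hσ₃, sem_shiftProg (by decide), hσ₂, sem_frame (by decide), hσ₁,
      sem_sumProg (by decide)]
    intro k hk τ hτ hτk
    simp [hτ, hτk, ha, t2, hw k hk]
  have e₂ : σ₄ vSum' 0 0 = 2 ^ E.N * ∑ j ∈ Finset.range E.N, (w' j : ℤ) := by
    rw [hσ₄, sem_shiftProg (by decide), hσ₃, sem_frame (by decide), hσ₂, sem_sumProg (by decide)]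
    intro k hk τ hτ hτk
    have f1 : σ₁ vRecs' = σ vRecs' := sem_frame (by decide) _
    have f2 : σ₁ kB = σ kB := sem_frame (by decide) _
    simp [hτ, hτk, f1, f2, hb, t3, hw' k hk]
  set b₅ := seq (assign vMulX (reg vSum)) <|
    seq (assign vMulY (cell vRecs' (reg kB) (reg kJ + lit 3))) <|
    seq mulProg (store vExc (reg kJ) (lit 0) (lit 0 - reg vProd)) with hb₅
  have e₃ := sem_loop_inv (E := E) (a := kJ) (p := b₅) (σ := σ₄)
    (fun k τ => ∀ j < k, τ vExc j 0 = -q j) (by simp) (by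
      intro k hk τ hτ h j hj
      have f1 : τ vSum = σ₄ vSum := hτ _ (by decide)
      have f2 : τ vRecs' = σ vRecs' := (hτ _ (by decide)).trans (f _ (by decide))
      have f3 : τ kB = σ kB := (hτ _ (by decide)).trans (f _ (by decide))
      simp only [hb₅, sem_seq]
      set ρ := (assign vMulY (cell vRecs' (reg kB) (reg kJ + lit 3))).sem E
        ((assign vMulX (reg vSum)).sem E (τ.set kJ 0 0 k)) with hρ
      have g1 : ρ vMulX 0 0 = σ₄ vSum 0 0 := by simp [hρ, f1]
      have g2 : ρ vMulY 0 0 = w' k := by simp [hρ, f2, f3, hb, t3, hw' k hk]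
      have g3 := sem_mulProg (E := E) (σ := ρ) (by rw [g2]; positivity)
        (by rw [g2]; exact_mod_cast hlt' k hk)
      have g4 : mulProg.sem E ρ kJ 0 0 = k := by
        rw [sem_frame (by decide)]
        simp [hρ]
      have g5 : mulProg.sem E ρ vExc = τ vExc := by
        rw [sem_frame (by decide)]
        simp [hρ]
      simp only [sem_store, Store.set_same, eval_reg, eval_sub, eval_lit, g4, g3, g1, g2, g5, e₁,
        Int.toNat_natCast]
      by_cases hjk : j = k
      · simp [hjk, hq]
        ring
      · simpa [hjk] using h j (by omega))
  set σ₅ := (loop kJ b₅).sem E σ₄ with hσ₅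
  have f' : ∀ c ∉ (loop kJ b₅).writes, σ₅ c = σ₄ c := fun c hc => sem_frame hc _
  set b₆ := seq (assign vMulX (reg vSum')) <|
    seq (assign vMulY (cell vRecs (reg kA) (reg kI + lit 2))) <|
    seq mulProg <|
    seq (loop kJ (store vFlow (reg kI) (reg kJ) (lit 0))) <|
    seq (store vFlow (reg kI) (bound - lit 1) (reg vProd)) <|
    store vExc (bound - lit 1) (lit 0) (cell vExc (bound - lit 1) (lit 0) + reg vProd) with hb₆
  have e₄ := sem_loop_inv (E := E) (a := kI) (p := b₆) (σ := σ₅)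
    (fun k τ => (∀ i < k, ∀ j < E.N, τ vFlow i j = if j = E.N - 1 then (p i : ℤ) else 0) ∧
      ∀ j < E.N, τ vExc j 0 =
        if j = E.N - 1 then ∑ i ∈ Finset.range k, (p i : ℤ) else -q j) ?_ ?_
  · exact e₄
  · refine ⟨by simp, fun j hj => ?_⟩
    rw [e₃ j hj]
    split_ifs with h
    · simp [h, hq, h0]
    · rfl
  · rintro k hk τ hτ ⟨h1, h2⟩
    have f1 : τ vSum' = σ₄ vSum' := (hτ _ (by decide)).trans (f' _ (by decide))
    have f2 : τ vRecs = σ vRecs :=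
      (hτ _ (by decide)).trans ((f' _ (by decide)).trans (f _ (by decide)))
    have f3 : τ kA = σ kA :=
      (hτ _ (by decide)).trans ((f' _ (by decide)).trans (f _ (by decide)))
    simp only [hb₆, sem_seq]
    set ρ := (assign vMulY (cell vRecs (reg kA) (reg kI + lit 2))).sem E
      ((assign vMulX (reg vSum')).sem E (τ.set kI 0 0 k)) with hρ
    have g1 : ρ vMulX 0 0 = σ₄ vSum' 0 0 := by simp [hρ, f1]
    have g2 : ρ vMulY 0 0 = w k := by simp [hρ, f2, f3, ha, t2, hw k hk]
    have g3 := sem_mulProg (E := E) (σ := ρ) (by rw [g2]; positivity)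
      (by rw [g2]; exact_mod_cast hlt k hk)
    have g3' : mulProg.sem E ρ vProd 0 0 = p k := by
      rw [g3, g1, g2, e₂, hp]
      push_cast
      ring
    have g4 : mulProg.sem E ρ kI 0 0 = k := by
      rw [sem_frame (by decide)]
      simp [hρ]
    have g5 : mulProg.sem E ρ vExc = τ vExc := by
      rw [sem_frame (by decide)]
      simp [hρ]
    have g6 : mulProg.sem E ρ vFlow = τ vFlow := by
      rw [sem_frame (by decide)]
      simp [hρ]
    set ρ₁ := mulProg.sem E ρ with hρ₁
    have g7 := sem_loop_inv (E := E) (a := kJ) (p := store vFlow (reg kI) (reg kJ) (lit 0))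
      (σ := ρ₁) (fun m υ => (∀ i, i ≠ k → υ vFlow i = τ vFlow i) ∧ ∀ j < m, υ vFlow k j = 0)
      (by simp [g6]) (by
        rintro m - υ hυ ⟨u1, u2⟩
        have u3 : υ kI 0 0 = k := by rw [hυ kI (by decide), g4]
        refine ⟨fun i hi => ?_, fun j hj => ?_⟩
        · ext j
          simp [u3, hi, u1 i hi]
        · by_cases hjm : j = m
          · simp [u3, hjm]
          · simpa [u3, hjm] using u2 j (by omega))
    set ρ₂ := (loop kJ (store vFlow (reg kI) (reg kJ) (lit 0))).sem E ρ₁ with hρ₂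
    have k1 : ρ₂ kI 0 0 = k := by rw [hρ₂, sem_frame (by decide), g4]
    have k2 : ρ₂ vProd 0 0 = p k := by rw [hρ₂, sem_frame (by decide), g3']
    have k3 : ρ₂ vExc = τ vExc := by rw [hρ₂, sem_frame (by decide), g5]
    refine ⟨fun i hi j hj => ?_, fun j hj => ?_⟩
    · by_cases hik : i = k
      · subst hik
        simp [k1, k2, t1, g7.2 j hj]
      · simp [k1, hik, g7.1 i hik]
        exact h1 i (by omega) j hj
    · simp only [sem_store, Store.set_same, eval_sub, eval_bound, eval_lit, t1, eval_reg, eval_cell,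
        eval_add, Store.set_of_ne _ (show vExc ≠ vFlow by decide), k3,
        Store.set_of_ne _ (show vProd ≠ vFlow by decide), k2, Finset.sum_range_succ]
      have := h2 (E.N - 1) (by omega)
      by_cases hjN : j = E.N - 1
      · simp [hjN, this]
      · simp [hjN, h2 j hj]

/-- The last column is a dummy without demand that every row may use, so a load exists even when the
problem is infeasible. -/
theorem isLoad_last {N : ℕ} {p q : ℕ → ℕ} {al : ℕ → ℕ → Prop} {f : ℕ → ℕ → ℤ} {x : ℕ → ℤ}
    (hN : 0 < N) (hf : ∀ i < N, ∀ j < N, f i j = if j = N - 1 then (p i : ℤ) else 0)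
    (hx : ∀ j < N, x j = if j = N - 1 then ∑ i ∈ Finset.range N, (p i : ℤ) else -q j)
    (h0 : q (N - 1) = 0) (hal : ∀ i < N, al i (N - 1)) : IsLoad N p q al f x := by
  refine ⟨fun i hi j hj => ?_, fun i hi j hj h => ?_, fun i hi => ?_, fun j hj => ?_⟩
  · rw [hf i hi j hj]
    positivity
  · rw [hf i hi j hj, if_neg]
    rintro rfl
    exact h (hal i hi)
  · rw [Finset.sum_congr rfl fun j hj => hf i hi j (Finset.mem_range.1 hj)]
    simp [hN]
  · rw [Finset.sum_congr rfl fun i hi => hf i (Finset.mem_range.1 hi) j hj, hx j hj]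
    split_ifs with h
    · simp [h, h0]
    · simp

/-- All excesses are at most `2 ^ (5 * N)` in absolute value, so twice the sum of squares is at most
`2 ^ (11 * N + 1)`, far below `2 ^ (2 * N²)`. -/
theorem sum_sq_last_lt {N : ℕ} (hN : 100 ≤ N) {w w' : ℕ → ℕ} (hlt : ∀ i < N, w i < 2 ^ N)
    (hlt' : ∀ i < N, w' i < 2 ^ N) {q : ℕ → ℕ} {x : ℕ → ℤ} {P : ℕ}
    (hP : P = 2 ^ N * ((∑ i ∈ Finset.range N, w i) * ∑ j ∈ Finset.range N, w' j))
    (hq : ∑ j ∈ Finset.range N, q j = P)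
    (hx : ∀ j < N, x j = if j = N - 1 then (P : ℤ) else -q j) :
    2 * ∑ j ∈ Finset.range N, x j ^ 2 < (2 ^ N ^ 2) ^ 2 := by
  have hs : ∀ {v : ℕ → ℕ}, (∀ i < N, v i < 2 ^ N) →
      ∑ i ∈ Finset.range N, v i ≤ 2 ^ N * 2 ^ N := by
    intro v hv
    refine (Finset.sum_le_card_nsmul _ _ (2 ^ N) fun i hi =>
      (hv i (Finset.mem_range.1 hi)).le).trans ?_
    rw [Finset.card_range, smul_eq_mul]
    exact Nat.mul_le_mul_right _ Nat.lt_two_pow_self.le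
  have hP' : P ≤ 2 ^ (5 * N) := by
    rw [hP]
    refine (Nat.mul_le_mul_left _ (Nat.mul_le_mul (hs hlt) (hs hlt'))).trans (le_of_eq ?_)
    ring
  have h1 : ∀ j ∈ Finset.range N, x j ^ 2 ≤ (2 ^ (5 * N)) ^ 2 := by
    intro j hj
    have h2 : q j ≤ P := hq ▸ Finset.single_le_sum (f := q) (fun _ _ => Nat.zero_le _) hj
    have h3 : (P : ℤ) ≤ 2 ^ (5 * N) := by exact_mod_cast hP'
    have h4 : (q j : ℤ) ≤ P := by exact_mod_cast h2
    rw [hx j (Finset.mem_range.1 hj)]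
    split_ifs
    · exact sq_le_sq' (by omega) h3
    · exact sq_le_sq' (by omega) (by omega)
  have h2 := Finset.sum_le_card_nsmul _ _ _ h1
  rw [Finset.card_range, nsmul_eq_mul] at h2
  have h3 : (N : ℤ) ≤ 2 ^ N := by exact_mod_cast Nat.lt_two_pow_self.le
  calc 2 * ∑ j ∈ Finset.range N, x j ^ 2 ≤ 2 * (2 ^ N * (2 ^ (5 * N)) ^ 2) := by
        refine mul_le_mul_of_nonneg_left (h2.trans ?_) (by norm_num)
        exact mul_le_mul_of_nonneg_right h3 (by positivity)
    _ = 2 ^ (11 * N + 1) := by ring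
    _ < 2 ^ (N ^ 2 * 2) := pow_lt_pow_right₀ (by norm_num) (by nlinarith)
    _ = (2 ^ N ^ 2) ^ 2 := pow_mul _ _ _

open Classical in
/-- The program decides whether the row `a` of the first table can be transported to the row `b` of
the second one by the pairs that are not bad. -/
theorem sem_feasProg {a b : ℕ} {w w' : ℕ → ℕ} {σ : Store} (hN : 100 ≤ E.N)
    (ha : σ kA 0 0 = a) (hb : σ kB 0 0 = b)
    (hw : ∀ i < E.N, σ vRecs a (i + 2) = w i) (hw' : ∀ i < E.N, σ vRecs' b (i + 3) = w' i)
    (hlt : ∀ i < E.N, w i < 2 ^ E.N) (hlt' : ∀ i < E.N, w' i < 2 ^ E.N) (h0 : w' (E.N - 1) = 0)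
    (hbad : ∀ i < E.N, σ vBad i (E.N - 1) = 0) (k l : ℕ) :
    feasProg.sem E σ vFeas k l = if k = a ∧ l = b then
      if HallCond E.N (fun i => w i * ∑ j ∈ Finset.range E.N, w' j)
        (fun j => w' j * ∑ i ∈ Finset.range E.N, w i) fun i j => σ vBad i j ≤ 0 then 1 else 0
    else σ vFeas k l := by
  set p₀ : ℕ → ℕ := fun i => w i * ∑ j ∈ Finset.range E.N, w' j with hp₀
  set q₀ : ℕ → ℕ := fun j => w' j * ∑ i ∈ Finset.range E.N, w i with hq₀
  have hpq : ∑ i ∈ Finset.range E.N, p₀ i = ∑ j ∈ Finset.range E.N, q₀ j := by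
    rw [hp₀, hq₀, ← Finset.sum_mul, ← Finset.sum_mul, mul_comm]
  obtain ⟨i1, i2⟩ := sem_loadInit (p := fun i => 2 ^ E.N * p₀ i) (q := fun j => 2 ^ E.N * q₀ j)
    (by omega) ha hb hw hw' hlt hlt' h0 (fun _ => rfl) fun _ => rfl
  rw [feasProg]
  simp only [sem_seq]
  set σ₁ := loadInit.sem E σ with hσ₁
  set σ₂ := (repeatPow kR (assign vAmt (reg vAmt + reg vAmt)) 2).sem E
    ((assign vAmt (lit 1)).sem E σ₁) with hσ₂
  have f : ∀ c ∉ [vAmt, kR], σ₂ c = σ₁ c := by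
    intro c hc
    simp only [List.mem_cons, List.not_mem_nil, not_or] at hc
    rw [hσ₂, sem_frame (notMem_writes_repeatPow (by simp [assign, writes, hc])), sem_frame]
    simp [assign, writes, hc]
  have hP : ∑ i ∈ Finset.range E.N, 2 ^ E.N * p₀ i =
      2 ^ E.N * ((∑ i ∈ Finset.range E.N, w i) * ∑ j ∈ Finset.range E.N, w' j) := by
    rw [← Finset.mul_sum, hp₀, ← Finset.sum_mul]
  have key := sem_loadPhases (E := E) (M := 2 ^ E.N) (p := p₀) (q := q₀)
    (al := fun i j => σ vBad i j ≤ 0) (τ := σ₂) hN hpq ?_ ?_ ?_ ?_ ?_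
  · set σ₃ := (repeatPow kR loadPhase 2).sem E σ₂ with hσ₃
    have f' : ∀ c ∉ kR :: loadPhase.writes, σ₃ c = σ₂ c := fun c hc =>
      sem_frame (notMem_writes_repeatPow hc) _
    have g1 : σ₃ kA 0 0 = a := by
      rw [f' _ (by decide), f _ (by decide), hσ₁, sem_frame (by decide), ha]
    have g2 : σ₃ kB 0 0 = b := by
      rw [f' _ (by decide), f _ (by decide), hσ₁, sem_frame (by decide), hb]
    have g3 : σ₃ vFeas = σ vFeas := by
      rw [f' _ (by decide), f _ (by decide), hσ₁, sem_frame (by decide)]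
    have := sem_loop_inv (E := E) (a := kJ) (p := whenPos (cell vExc (reg kJ) (lit 0) - bound - bound -
      bound) (store vFeas (reg kA) (reg kB) (lit 0)))
      (σ := (store vFeas (reg kA) (reg kB) (lit 1)).sem E σ₃)
      (fun m τ => τ vFeas k l = if k = a ∧ l = b then
        if ∀ j < m, σ₃ vExc j 0 ≤ 3 * E.N then 1 else 0 else σ vFeas k l) ?_ ?_
    · rw [this]
      simp only [key]
    · simp [g1, g2, g3]
    · intro m hm τ hτ h
      have u1 : τ vExc = σ₃ vExc := by
        rw [hτ _ (by decide)]
        simp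
      have u2 : τ kA 0 0 = a := by
        rw [hτ _ (by decide)]
        simp [g1]
      have u3 : τ kB 0 0 = b := by
        rw [hτ _ (by decide)]
        simp [g2]
      rw [sem_whenPos]
      by_cases hc : σ₃ vExc m 0 ≤ 3 * E.N
      · rw [if_neg (by simp [u1]; omega), Store.set_of_ne _ (by decide), h]
        simp only [Nat.lt_succ_iff_lt_or_eq, or_imp, forall_and, forall_eq, hc, and_true]
      · rw [if_pos (by simp [u1]; omega)]
        have : ¬ ∀ j < m + 1, σ₃ vExc j 0 ≤ 3 * E.N := fun h' => hc (h' m (Nat.lt_succ_self m))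
        simp only [this, if_false]
        by_cases hkl : k = a ∧ l = b
        · simp [u2, u3, hkl]
        · rw [if_neg hkl] at h ⊢
          simp [u2, u3, hkl, h]
  · rw [hσ₂, sem_doubling]
    simp
  · rw [f _ (by decide), hσ₁, sem_frame (by decide)]
    exact fun _ _ => Iff.rfl
  · rw [f _ (by decide), f _ (by decide)]
    refine isLoad_last (by omega) i1 i2 (by simp [hq₀, h0]) fun i hi => (hbad i hi).le
  · rw [f _ (by decide)]
    refine sum_sq_last_lt hN hlt hlt' rfl (q := fun j => 2 ^ E.N * q₀ j) ?_ fun j hj => ?_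
    · rw [← hP, ← Finset.mul_sum, ← Finset.mul_sum, hpq]
    · rw [i2 j hj, ← hP]
      simp
  · have : ∀ n, 100 ≤ n → n * (3 * n) < 2 ^ n := by
      intro n hn
      induction n, hn using Nat.le_induction with
      | base => norm_num
      | succ n hn ih =>
        rw [pow_succ]
        nlinarith
    exact this _ hN

end RAM

/-! ### The tables of two systems, and the fixed points of the game -/

/-- The transitions of two systems, by numbers below a bound `N`; `M a b` says that the transition `b`
of the second system may be matched with `a`. The numbers `a < T` and `b < T'` are moves of the
Refuter. -/
structure Tab where
  n : ℕ
  n' : ℕ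
  T : ℕ
  T' : ℕ
  src : ℕ → ℕ
  src' : ℕ → ℕ
  w : ℕ → ℕ → ℕ
  w' : ℕ → ℕ → ℕ
  M : ℕ → ℕ → Prop

namespace Tab

variable (D : Tab) (N : ℕ)

/-- The transitions `a` and `b` have a coupling outside of `X`. -/
def Feas (X : ℕ → ℕ → Prop) (a b : ℕ) : Prop :=
  HallCond N (fun i => D.w a i * ∑ j ∈ Finset.range N, D.w' b j)
    (fun j => D.w' b j * ∑ i ∈ Finset.range N, D.w a i) fun i j => ¬ X i j

/-- A set of pairs of states that contains those at which the Refuter has a move all of whose answers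
have no coupling outside of the set. -/
structure BadClosed (X : ℕ → ℕ → Prop) : Prop where
  nominal : ∀ a < D.T, ∀ s' < D.n', (∀ b < N, D.M a b → D.src' b = s' → ¬ D.Feas N X a b) →
    X (D.src a) s'
  implementation : ∀ b < D.T', ∀ s < D.n, (∀ a < N, D.M a b → D.src a = s → ¬ D.Feas N X a b) →
    X s (D.src' b)

def Bad (s s' : ℕ) : Prop := ∀ X, D.BadClosed N X → X s s'

/-- A set of pairs of states that contains those that are not bad, and is closed under predecessors. -/
structure ReachClosed (X : ℕ → ℕ → Prop) : Prop where
  base : ∀ s < N, ∀ s' < N, ¬ D.Bad N s s' → X s s'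
  step : ∀ a < N, ∀ b < N, D.M a b → ∀ t < N, ∀ t' < N, 0 < D.w a t → 0 < D.w' b t' → X t t' →
    X (D.src a) (D.src' b)

def Reach (s s' : ℕ) : Prop := ∀ X, D.ReachClosed N X → X s s'

/-- The strict bounds on the numbers of states leave the index `N - 1` free for the dummy column. -/
structure Valid : Prop where
  n_lt : D.n < N
  n_lt' : D.n' < N
  T_le : D.T ≤ N
  T_le' : D.T' ≤ N
  src_lt : ∀ a < N, D.src a < D.n
  src_lt' : ∀ b < N, D.src' b < D.n'
  w_lt : ∀ a < N, ∀ i < N, D.w a i < 2 ^ N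
  w_lt' : ∀ b < N, ∀ i < N, D.w' b i < 2 ^ N
  w_last' : ∀ b < N, D.w' b (N - 1) = 0

variable {D N}

theorem Feas.mono {X Y : ℕ → ℕ → Prop} (h : ∀ i j, Y i j → X i j) {a b : ℕ} (hf : D.Feas N X a b) :
    D.Feas N Y a b := by
  intro R hR
  obtain ⟨T, hT, h1, h2⟩ := hf R hR
  refine ⟨T, hT, fun j hj => ?_, h2⟩
  obtain ⟨i, hi, hij⟩ := h1 j hj
  exact ⟨i, hi, fun hY => hij (h _ _ hY)⟩

/-- Bad pairs consist of genuine states; hence the dummy column is always allowed. -/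
theorem Valid.badClosed_lt (hD : D.Valid N) : D.BadClosed N fun s s' => s < D.n ∧ s' < D.n' :=
  ⟨fun a ha _ hs _ => ⟨hD.src_lt a (ha.trans_le hD.T_le), hs⟩,
    fun b hb _ hs _ => ⟨hs, hD.src_lt' b (hb.trans_le hD.T_le')⟩⟩

/-- Feasibility is antitone in the set to be avoided, so the intersection of all closed relations is
closed, as for Knaster and Tarski. -/
theorem badClosed_bad : D.BadClosed N (D.Bad N) :=
  ⟨fun a ha s' hs h X hX => hX.nominal a ha s' hs fun b hb hM hb' hf =>
      h b hb hM hb' (hf.mono fun _ _ h => h X hX),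
    fun b hb s hs h X hX => hX.implementation b hb s hs fun a ha hM ha' hf =>
      h a ha hM ha' (hf.mono fun _ _ h => h X hX)⟩

end Tab

namespace RAM

open AExpr AProg

variable {E : Env}

/-! ### Marking elements of a relation -/

section Mark

/-- The entries are zero or one, and only good pairs are marked with one. -/
def MarkInv (good : ℕ → ℕ → Prop) (V : ℕ → ℕ → ℤ) : Prop :=
  ∀ i j, V i j = 0 ∨ V i j = 1 ∧ good i j

def numUnmarked (N : ℕ) (V : ℕ → ℕ → ℤ) : ℤ :=
  ∑ i ∈ Finset.range N, ∑ j ∈ Finset.range N, (1 - V i j)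

variable {good : ℕ → ℕ → Prop} {Pre : Store → Prop} {c : ℕ}

theorem isSweep_mark {ei ej : AExpr} {i j : ℕ} (hi : i < E.N) (hj : j < E.N)
    (hP : ∀ τ, Pre τ → (ei.eval E τ).toNat = i ∧ (ej.eval E τ).toNat = j ∧ good i j) :
    IsSweep E (fun τ => τ c) (MarkInv good) (numUnmarked E.N) 1 Pre (store c ei ej (lit 1))
      fun V => V i j = 1 := by
  intro τ h hI
  obtain ⟨h1, h2, h3⟩ := hP τ h
  have hset : ∀ k l, (store c ei ej (lit 1)).sem E τ c k l = if k = i ∧ l = j then 1 else τ c k l := by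
    intro k l
    simp [h1, h2]
  refine ⟨fun k l => ?_, ?_⟩
  · change (store c ei ej (lit 1)).sem E τ c k l = 0 ∨ (store c ei ej (lit 1)).sem E τ c k l = 1 ∧ _
    rw [hset]
    split_ifs with hkl
    · exact .inr ⟨rfl, hkl.1 ▸ hkl.2 ▸ h3⟩
    · exact hI k l
  · by_cases hV : τ c i j = 1
    · refine .inl ⟨hV, ?_⟩
      ext k l
      change (store c ei ej (lit 1)).sem E τ c k l = τ c k l
      rw [hset]
      split_ifs with hkl
      · rw [hkl.1, hkl.2, hV]
      · rfl
    · have hV0 : τ c i j = 0 := (hI i j).resolve_right fun h => hV h.1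
      refine .inr ⟨hV, ?_⟩
      have : ∀ k ∈ Finset.range E.N, ∀ l ∈ Finset.range E.N,
          1 - (store c ei ej (lit 1)).sem E τ c k l =
          (1 - τ c k l) - if k = i ∧ l = j then 1 else 0 := by
        intro k _ l _
        rw [hset]
        split_ifs with hkl
        · rw [hkl.1, hkl.2, hV0]
          rfl
        · rw [sub_zero]
      have h4 : numUnmarked E.N ((store c ei ej (lit 1)).sem E τ c) = numUnmarked E.N (τ c) -
          ∑ k ∈ Finset.range E.N, ∑ l ∈ Finset.range E.N, if k = i ∧ l = j then 1 else 0 := by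
        rw [numUnmarked, numUnmarked, ← Finset.sum_sub_distrib]
        refine Finset.sum_congr rfl fun k hk => ?_
        rw [← Finset.sum_sub_distrib]
        exact Finset.sum_congr rfl fun l hl => this k hk l hl
      have h5 : ∑ k ∈ Finset.range E.N, ∑ l ∈ Finset.range E.N,
          (if k = i ∧ l = j then (1 : ℤ) else 0) = 1 := by
        rw [Finset.sum_eq_single i, Finset.sum_eq_single j]
        · simp
        · intro l _ hl
          simp [hl]
        · intro h
          exact absurd (Finset.mem_range.2 hj) h
        · intro k _ hk
          simp [hk]
        · intro h
          exact absurd (Finset.mem_range.2 hi) h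
      change numUnmarked E.N ((store c ei ej (lit 1)).sem E τ c) + 1 ≤ numUnmarked E.N (τ c)
      rw [h4, h5, sub_add_cancel]

/-- At most `N²` entries can be marked, so `N³` sweeps cannot all mark a new one. -/
theorem sem_repeat_sweep {p : AProg} {P : (ℕ → ℕ → ℤ) → Prop} (hN : 2 ≤ E.N) (hc : kR ≠ c)
    (hPre : Preserves (AProg.loop kR p) Pre)
    (h : IsSweep E (fun τ => τ c) (MarkInv good) (numUnmarked E.N) 1 Pre p P) {τ : Store}
    (hτ : Pre τ) (hI : MarkInv good (τ c)) :
    MarkInv good ((repeatPow kR p 3).sem E τ c) ∧ P ((repeatPow kR p 3).sem E τ c) := by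
  obtain ⟨h1, -, -, h2⟩ := (h.converges zero_le_one).repeatPow (fun τ k => Store.set_of_ne _ hc.symm)
    hPre 3 τ hτ hI
  beta_reduce at h1 h2
  refine ⟨h1, h2.resolve_right fun h3 => ?_⟩
  have h4 : 0 ≤ numUnmarked E.N ((repeatPow kR p 3).sem E τ c) :=
    Finset.sum_nonneg fun i _ => Finset.sum_nonneg fun j _ => by
      rcases h1 i j with h | ⟨h, -⟩ <;> omega
  have h5 : numUnmarked E.N (τ c) ≤ E.N * E.N := by
    have : numUnmarked E.N (τ c) ≤
        ∑ i ∈ Finset.range E.N, ∑ j ∈ Finset.range E.N, (1 : ℤ) :=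
      Finset.sum_le_sum fun i _ => Finset.sum_le_sum fun j _ => by
        rcases hI i j with h | ⟨h, -⟩ <;> omega
    simpa using this
  have h6 : (2 : ℤ) ≤ E.N := by exact_mod_cast hN
  push_cast at h3
  nlinarith [mul_pos (show (0 : ℤ) < E.N by omega) (show (0 : ℤ) < E.N by omega)]

end Mark

/-! ### The programs for the fixed points -/

/-- The store contains the tables. -/
structure HasTables (D : Tab) (N : ℕ) (σ : Store) : Prop where
  numS : σ vNumS 0 0 = D.n
  numS' : σ vNumS' 0 0 = D.n'
  numT : σ vNumT 0 0 = D.T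
  numT' : σ vNumT' 0 0 = D.T'
  src : ∀ a < N, σ vRecs a 0 = D.src a
  src' : ∀ b < N, σ vRecs' b 0 = D.src' b
  w : ∀ a < N, ∀ i < N, σ vRecs a (i + 2) = D.w a i
  w' : ∀ b < N, ∀ i < N, σ vRecs' b (i + 3) = D.w' b i
  mtch : ∀ a < N, ∀ b < N, 0 < σ vMatch a b ↔ D.M a b

theorem HasTables.congr {D : Tab} {N : ℕ} {σ τ : Store} (h : HasTables D N σ)
    (hτ : ∀ c ∈ [vNumS, vNumS', vNumT, vNumT', vRecs, vRecs', vMatch], τ c = σ c) :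
    HasTables D N τ := by
  simp only [List.forall_mem_cons, List.not_mem_nil, false_imp_iff, implies_true, and_true] at hτ
  obtain ⟨h1, h2, h3, h4, h5, h6, h7⟩ := hτ
  constructor
  · rw [h1, h.numS]
  · rw [h2, h.numS']
  · rw [h3, h.numT]
  · rw [h4, h.numT']
  · rw [h5]; exact h.src
  · rw [h6]; exact h.src'
  · rw [h5]; exact h.w
  · rw [h6]; exact h.w'
  · rw [h7]; exact h.mtch

/-- Setting `vOk` to one if no value of the loop variable satisfies the three conditions. -/
def okProg (k : ℕ) (e e₁ e₂ e₃ : AExpr) : AProg :=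
  seq (assign vOk (lit 1)) <| loop k <| whenPos e <| whenEq e₁ e₂ <| whenPos e₃ <|
    assign vOk (lit 0)

theorem sem_okProg {k : ℕ} {e e₁ e₂ e₃ : AExpr} (hk : k ≠ vOk) {σ : Store} (c : ℕ → Prop)
    (hc : ∀ m < E.N, ∀ τ : Store, (∀ b, b ≠ vOk → b ≠ k → τ b = σ b) → τ k 0 0 = m →
      (0 < e.eval E τ ∧ e₁.eval E τ = e₂.eval E τ ∧ 0 < e₃.eval E τ ↔ c m)) :
    0 < (okProg k e e₁ e₂ e₃).sem E σ vOk 0 0 ↔ ∀ m < E.N, ¬ c m := by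
  refine sem_loop_inv (fun m τ => 0 < τ vOk 0 0 ↔ ∀ m' < m, ¬ c m') (by simp) ?_
  intro m hm τ hτ h
  have := hc m hm (τ.set k 0 0 m) (fun b hb hb' => ?_) (by simp)
  · have hgoal : (∀ m' < m + 1, ¬ c m') ↔ (∀ m' < m, ¬ c m') ∧ ¬ c m := by
      simp only [Nat.lt_succ_iff_lt_or_eq, or_imp, forall_and, forall_eq]
    rw [hgoal, ← h]
    simp only [sem_whenPos, sem_whenEq]
    by_cases hcm : c m
    · obtain ⟨h1, h2, h3⟩ := this.2 hcm
      simp [h1, h2, h3, hcm]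
    · have h0 : (τ.set k 0 0 m) vOk 0 0 = τ vOk 0 0 := by rw [Store.set_of_ne _ hk.symm]
      split_ifs with h1 h2 h3
      · exact absurd (this.1 ⟨h1, h2, h3⟩) hcm
      all_goals simp [h0, hcm]
  · rw [Store.set_of_ne _ hb', hτ b (by simp [writes, whenPos, whenEq, assign, hb, hb']), sem_assign,
      Store.set_of_ne _ hb]

def markNominal : AProg :=
  loop kA <| loop kJ <|
    seq (okProg kB (cell vMatch (reg kA) (reg kB)) (cell vRecs' (reg kB) (lit 0)) (reg kJ)
      (cell vFeas (reg kA) (reg kB))) <|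
    whenPos (reg vNumT - reg kA) <| whenPos (reg vNumS' - reg kJ) <| whenPos (reg vOk) <|
      store vBad (cell vRecs (reg kA) (lit 0)) (reg kJ) (lit 1)

def markImplementation : AProg :=
  loop kB <| loop kI <|
    seq (okProg kA (cell vMatch (reg kA) (reg kB)) (cell vRecs (reg kA) (lit 0)) (reg kI)
      (cell vFeas (reg kA) (reg kB))) <|
    whenPos (reg vNumT' - reg kB) <| whenPos (reg vNumS - reg kI) <| whenPos (reg vOk) <|
      store vBad (reg kI) (cell vRecs' (reg kB) (lit 0)) (lit 1)

section Bad

variable {D : Tab} {F : ℕ → ℕ → Prop} {good : ℕ → ℕ → Prop}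

/-- The store contains the tables and the relation `F`. -/
def HasFeas (D : Tab) (F : ℕ → ℕ → Prop) (N : ℕ) (τ : Store) : Prop :=
  HasTables D N τ ∧ ∀ a < N, ∀ b < N, 0 < τ vFeas a b ↔ F a b

theorem HasFeas.congr {N : ℕ} {σ τ : Store} (h : HasFeas D F N σ)
    (hτ : ∀ c ∈ [vNumS, vNumS', vNumT, vNumT', vRecs, vRecs', vMatch, vFeas], τ c = σ c) :
    HasFeas D F N τ :=
  ⟨h.1.congr fun c hc => hτ c (by
    simp only [List.mem_cons, List.not_mem_nil, or_false] at hc ⊢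
    tauto), by rw [hτ vFeas (by decide)]; exact h.2⟩

theorem isSweep_markNominal (hD : D.Valid E.N)
    (hg : ∀ a < D.T, ∀ s' < D.n', (∀ b < E.N, D.M a b → D.src' b = s' → ¬ F a b) →
      good (D.src a) s') :
    IsSweep E (fun τ => τ vBad) (MarkInv good) (numUnmarked E.N) 1 (HasFeas D F E.N) markNominal
      fun V => ∀ a < E.N, ∀ s' < E.N, a < D.T → s' < D.n' →
        (∀ b < E.N, ¬ (D.M a b ∧ D.src' b = s' ∧ F a b)) → V (D.src a) s' = 1 := by
  refine IsSweep.loop zero_le_one (fun τ k => Store.set_of_ne _ (by decide)) ?_ fun a ha => ?_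
  · exact fun τ τ' h hτ => hτ.congr fun c hc => h c (by revert c; decide)
  refine IsSweep.loop zero_le_one (fun τ k => Store.set_of_ne _ (by decide)) ?_ fun s' hs' => ?_
  · exact fun τ τ' h => And.imp (fun hτ => hτ.congr fun c hc => h c (by revert c; decide))
      (h kA (by decide) ▸ id)
  refine IsSweep.comp (Pre' := fun τ => (HasFeas D F E.N τ ∧ τ kA 0 0 = a ∧ τ kJ 0 0 = s') ∧
    (0 < τ vOk 0 0 ↔ ∀ b < E.N, ¬ (D.M a b ∧ D.src' b = s' ∧ F a b))) ?_ ?_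
  · rintro τ ⟨⟨h1, h2⟩, h3⟩
    refine ⟨sem_frame (by decide) τ, ⟨h1.congr fun c hc => sem_frame (by revert c; decide) τ, ?_, ?_⟩,
      sem_okProg (by decide) _ fun b hb υ hυ hυb => ?_⟩
    · rw [sem_frame (by decide), h2]
    · rw [sem_frame (by decide), h3]
    · have u1 : υ kA 0 0 = a := by rw [hυ _ (by decide) (by decide), h2]
      have u2 : υ kJ 0 0 = s' := by rw [hυ _ (by decide) (by decide), h3]
      have u3 : υ vMatch = τ vMatch := hυ _ (by decide) (by decide)
      have u4 : υ vRecs' = τ vRecs' := hυ _ (by decide) (by decide)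
      have u5 : υ vFeas = τ vFeas := hυ _ (by decide) (by decide)
      simp [u1, u2, u3, u4, u5, hυb, h1.1.mtch a ha b hb, h1.1.src' b hb, h1.2 a ha b hb]
  · refine IsSweep.whenPos (c := fun _ => a < D.T) (fun τ h => ?_) <|
      IsSweep.whenPos (c := fun _ => s' < D.n') (fun τ h => ?_) <|
      IsSweep.whenPos (c := fun _ => ∀ b < E.N, ¬ (D.M a b ∧ D.src' b = s' ∧ F a b))
        (fun τ h => ?_) <| isSweep_mark ((hD.src_lt a ha).trans hD.n_lt) hs' fun τ h => ?_
    · simp [h.1.1.1.numT, h.1.2.1]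
    · simp [h.1.1.1.1.numS', h.1.1.2.2]
    · exact h.1.1.2
    · obtain ⟨⟨⟨⟨⟨h1, h2, h3⟩, -⟩, -, h4⟩, -, h5⟩, -, h6⟩ := h
      refine ⟨by simp [h2, h1.1.src a ha], by simp [h3], hg a h4 s' h5 fun b hb hM hs hF => ?_⟩
      exact h6 b hb ⟨hM, hs, hF⟩

theorem isSweep_markImplementation (hD : D.Valid E.N)
    (hg : ∀ b < D.T', ∀ s < D.n, (∀ a < E.N, D.M a b → D.src a = s → ¬ F a b) →
      good s (D.src' b)) :
    IsSweep E (fun τ => τ vBad) (MarkInv good) (numUnmarked E.N) 1 (HasFeas D F E.N)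
      markImplementation
      fun V => ∀ b < E.N, ∀ s < E.N, b < D.T' → s < D.n →
        (∀ a < E.N, ¬ (D.M a b ∧ D.src a = s ∧ F a b)) → V s (D.src' b) = 1 := by
  refine IsSweep.loop zero_le_one (fun τ k => Store.set_of_ne _ (by decide)) ?_ fun b hb => ?_
  · exact fun τ τ' h hτ => hτ.congr fun c hc => h c (by revert c; decide)
  refine IsSweep.loop zero_le_one (fun τ k => Store.set_of_ne _ (by decide)) ?_ fun s hs => ?_
  · exact fun τ τ' h => And.imp (fun hτ => hτ.congr fun c hc => h c (by revert c; decide))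
      (h kB (by decide) ▸ id)
  refine IsSweep.comp (Pre' := fun τ => (HasFeas D F E.N τ ∧ τ kB 0 0 = b ∧ τ kI 0 0 = s) ∧
    (0 < τ vOk 0 0 ↔ ∀ a < E.N, ¬ (D.M a b ∧ D.src a = s ∧ F a b))) ?_ ?_
  · rintro τ ⟨⟨h1, h2⟩, h3⟩
    refine ⟨sem_frame (by decide) τ, ⟨h1.congr fun c hc => sem_frame (by revert c; decide) τ, ?_, ?_⟩,
      sem_okProg (by decide) _ fun a ha υ hυ hυa => ?_⟩
    · rw [sem_frame (by decide), h2]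
    · rw [sem_frame (by decide), h3]
    · have u1 : υ kB 0 0 = b := by rw [hυ _ (by decide) (by decide), h2]
      have u2 : υ kI 0 0 = s := by rw [hυ _ (by decide) (by decide), h3]
      have u3 : υ vMatch = τ vMatch := hυ _ (by decide) (by decide)
      have u4 : υ vRecs = τ vRecs := hυ _ (by decide) (by decide)
      have u5 : υ vFeas = τ vFeas := hυ _ (by decide) (by decide)
      simp [u1, u2, u3, u4, u5, hυa, h1.1.mtch a ha b hb, h1.1.src a ha, h1.2 a ha b hb]
  · refine IsSweep.whenPos (c := fun _ => b < D.T') (fun τ h => ?_) <|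
      IsSweep.whenPos (c := fun _ => s < D.n) (fun τ h => ?_) <|
      IsSweep.whenPos (c := fun _ => ∀ a < E.N, ¬ (D.M a b ∧ D.src a = s ∧ F a b))
        (fun τ h => ?_) <| isSweep_mark hs ((hD.src_lt' b hb).trans hD.n_lt') fun τ h => ?_
    · simp [h.1.1.1.numT', h.1.2.1]
    · simp [h.1.1.1.1.numS, h.1.1.2.2]
    · exact h.1.1.2
    · obtain ⟨⟨⟨⟨⟨h1, h2, h3⟩, -⟩, -, h4⟩, -, h5⟩, -, h6⟩ := h
      refine ⟨by simp [h3], by simp [h2, h1.1.src' b hb], hg b h4 s h5 fun a ha hM hs hF => ?_⟩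
      exact h6 a ha ⟨hM, hs, hF⟩

open Classical in
-- Feasibility of all pairs of transitions is tabulated before any new mark is set, so it refers to
-- one fixed set of marks.
theorem hasFeas_loop (hN : 100 ≤ E.N) (hD : D.Valid E.N) {σ : Store} (hσ : HasTables D E.N σ)
    (hI : MarkInv (D.Bad E.N) (σ vBad)) :
    HasFeas D (D.Feas E.N fun i j => σ vBad i j = 1) E.N
      ((loop kA (loop kB feasProg)).sem E σ) := by
  refine ⟨hσ.congr fun c hc => sem_frame (by revert c; decide) σ, ?_⟩
  have hbad : ∀ i, σ vBad i (E.N - 1) = 0 := by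
    refine fun i => (hI i (E.N - 1)).resolve_right fun h => ?_
    have h1 : E.N - 1 < D.n' := (h.2 _ hD.badClosed_lt).2
    have h2 := hD.n_lt'
    omega
  have hal : (fun i j => ¬ σ vBad i j = 1) = fun i j => σ vBad i j ≤ 0 := by
    funext i j
    rcases hI i j with h | ⟨h, -⟩ <;> simp [h]
  refine sem_loop_inv (fun m τ => ∀ a < m, ∀ b < E.N, 0 < τ vFeas a b ↔
    D.Feas E.N (fun i j => σ vBad i j = 1) a b) (by simp) ?_
  intro a ha τ hτ h
  have := sem_loop_inv (E := E) (a := kB) (p := feasProg) (σ := τ.set kA 0 0 a)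
    (fun m υ => (∀ c < a, ∀ b, υ vFeas c b = τ vFeas c b) ∧ ∀ b < m, 0 < υ vFeas a b ↔
      D.Feas E.N (fun i j => σ vBad i j = 1) a b) (by simp) ?_
  · intro c hc b hb
    rcases Nat.lt_succ_iff_lt_or_eq.1 hc with hc | rfl
    · rw [this.1 c hc]
      exact h c hc b hb
    · exact this.2 b hb
  · rintro b hb υ hυ ⟨h1, h2⟩
    have u1 : υ vBad = σ vBad := by
      rw [hυ _ (by decide), Store.set_of_ne _ (by decide), hτ _ (by decide)]
    have u2 : υ vRecs = σ vRecs := by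
      rw [hυ _ (by decide), Store.set_of_ne _ (by decide), hτ _ (by decide)]
    have u3 : υ vRecs' = σ vRecs' := by
      rw [hυ _ (by decide), Store.set_of_ne _ (by decide), hτ _ (by decide)]
    have u4 : υ kA 0 0 = a := by
      rw [hυ _ (by decide)]
      simp
    have key := sem_feasProg (a := a) (b := b) (w := D.w a) (w' := D.w' b) (σ := υ.set kB 0 0 b) hN
      (by simp [u4]) (by simp) (by simpa [u2] using hσ.w a ha) (by simpa [u3] using hσ.w' b hb)
      (hD.w_lt a ha) (hD.w_lt' b hb) (hD.w_last' b hb) (by simpa [u1] using fun i _ => hbad i)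
    simp only [Store.set_of_ne _ (show vFeas ≠ kB by decide),
      Store.set_of_ne _ (show vBad ≠ kB by decide), u1] at key
    rw [← hal] at key
    refine ⟨fun c hc d => ?_, fun d hd => ?_⟩
    · rw [key, if_neg fun h => hc.ne h.1, h1 c hc]
    · rw [key]
      by_cases hdb : d = b
      · subst hdb
        rw [if_pos ⟨rfl, rfl⟩, Tab.Feas]
        split_ifs with hf
        · simpa using hf
        · simpa using hf
      · rw [if_neg fun h => hdb h.2]
        exact h2 d (by omega)

/-- One round of the computation of the bad pairs. -/
def badRound : AProg := seq (loop kA (loop kB feasProg)) (seq markNominal markImplementation)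

/-- A round that marks nothing has verified that the marks are closed. -/
theorem isSweep_badRound (hN : 100 ≤ E.N) (hD : D.Valid E.N) :
    IsSweep E (fun τ => τ vBad) (MarkInv (D.Bad E.N)) (numUnmarked E.N) 1 (HasTables D E.N) badRound
      fun V => D.BadClosed E.N fun i j => V i j = 1 := by
  intro τ h hI
  have h1 := hasFeas_loop hN hD h hI
  set F := D.Feas E.N fun i j => τ vBad i j = 1
  -- The marks are bad pairs, so avoiding the bad pairs is harder than avoiding the marks: whatever
  -- fails for the marks fails for the bad pairs, and new marks are bad.
  have hF : ∀ a b, D.Feas E.N (D.Bad E.N) a b → F a b := fun a b => Tab.Feas.mono fun i j hij =>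
    ((hI i j).resolve_left (by beta_reduce; rw [hij]; decide)).2
  have h2 := (isSweep_markNominal (E := E) (F := F) (good := D.Bad E.N) hD fun a ha s' hs' h =>
    Tab.badClosed_bad.nominal a ha s' hs' fun b hb hM hs hf => h b hb hM hs (hF a b hf)).seq
    zero_le_one (fun τ τ' h hτ => hτ.congr fun c hc => h c (by revert c; decide))
    (isSweep_markImplementation (E := E) (F := F) (good := D.Bad E.N) hD fun b hb s hs h =>
    Tab.badClosed_bad.implementation b hb s hs fun a ha hM hs hf => h a ha hM hs (hF a b hf))
  have h3 : (loop kA (loop kB feasProg)).sem E τ vBad = τ vBad := sem_frame (by decide) τ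
  obtain ⟨h4, h5⟩ := h2 _ h1 (by beta_reduce; rwa [h3])
  refine ⟨h4, ?_⟩
  rw [badRound, sem_seq]
  beta_reduce at h5 ⊢
  rw [h3] at h5
  have key : ((∀ a < E.N, ∀ s' < E.N, a < D.T → s' < D.n' →
      (∀ b < E.N, ¬ (D.M a b ∧ D.src' b = s' ∧ F a b)) → τ vBad (D.src a) s' = 1) ∧
      ∀ b < E.N, ∀ s < E.N, b < D.T' → s < D.n →
        (∀ a < E.N, ¬ (D.M a b ∧ D.src a = s ∧ F a b)) → τ vBad s (D.src' b) = 1) ↔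
      D.BadClosed E.N fun i j => τ vBad i j = 1 := by
    constructor
    · rintro ⟨g1, g2⟩
      refine ⟨fun a ha s' hs' h => ?_, fun b hb s hs h => ?_⟩
      · exact g1 a (ha.trans_le hD.T_le) s' (hs'.trans hD.n_lt') ha hs'
          fun b hb hF => h b hb hF.1 hF.2.1 hF.2.2
      · exact g2 b (hb.trans_le hD.T_le') s (hs.trans hD.n_lt) hb hs
          fun a ha hF => h a ha hF.1 hF.2.1 hF.2.2
    · rintro ⟨g1, g2⟩
      exact ⟨fun a _ s' _ ha hs' h => g1 a ha s' hs' fun b hb h1 h2 h3 => h b hb ⟨h1, h2, h3⟩,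
        fun b _ s _ hb hs h => g2 b hb s hs fun a ha h1 h2 h3 => h a ha ⟨h1, h2, h3⟩⟩
  rwa [key] at h5

end Bad

/-! ### Reachability -/

/-- Adding the pairs that are not bad. -/
def reachBase : AProg :=
  loop kI <| loop kJ <| whenPos (lit 1 - cell vBad (reg kI) (reg kJ)) <|
    store vReach (reg kI) (reg kJ) (lit 1)

/-- Adding the predecessors of the pairs that are already reached. -/
def reachStep : AProg :=
  loop kA <| loop kB <| loop kI <| loop kJ <|
    whenPos (cell vMatch (reg kA) (reg kB)) <| whenPos (cell vRecs (reg kA) (reg kI + lit 2)) <|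
    whenPos (cell vRecs' (reg kB) (reg kJ + lit 3)) <| whenPos (cell vReach (reg kI) (reg kJ)) <|
      store vReach (cell vRecs (reg kA) (lit 0)) (cell vRecs' (reg kB) (lit 0)) (lit 1)

/-- The store contains the tables and the relation `B`. -/
def HasBad (D : Tab) (B : ℕ → ℕ → Prop) (N : ℕ) (τ : Store) : Prop :=
  HasTables D N τ ∧ ∀ i < N, ∀ j < N, 0 < 1 - τ vBad i j ↔ ¬ B i j

theorem HasBad.congr {D : Tab} {B : ℕ → ℕ → Prop} {N : ℕ} {σ τ : Store} (h : HasBad D B N σ)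
    (hτ : ∀ c ∈ [vNumS, vNumS', vNumT, vNumT', vRecs, vRecs', vMatch, vBad], τ c = σ c) :
    HasBad D B N τ :=
  ⟨h.1.congr fun c hc => hτ c (by
    simp only [List.mem_cons, List.not_mem_nil, or_false] at hc ⊢
    tauto), by rw [hτ vBad (by decide)]; exact h.2⟩

theorem isSweep_reachBase {D : Tab} :
    IsSweep E (fun τ => τ vReach) (MarkInv (D.Reach E.N)) (numUnmarked E.N) 1
      (HasBad D (D.Bad E.N) E.N) reachBase
      fun V => ∀ s < E.N, ∀ s' < E.N, ¬ D.Bad E.N s s' → V s s' = 1 := by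
  refine IsSweep.loop zero_le_one (fun τ k => Store.set_of_ne _ (by decide)) ?_ fun s hs => ?_
  · exact fun τ τ' h hτ => hτ.congr fun c hc => h c (by revert c; decide)
  refine IsSweep.loop zero_le_one (fun τ k => Store.set_of_ne _ (by decide)) ?_ fun s' hs' => ?_
  · exact fun τ τ' h => And.imp (fun hτ => hτ.congr fun c hc => h c (by revert c; decide))
      (h kI (by decide) ▸ id)
  refine IsSweep.whenPos (c := fun _ => ¬ D.Bad E.N s s') (fun τ h => ?_) <|
    isSweep_mark hs hs' fun τ h => ?_
  · obtain ⟨⟨h1, h2⟩, h3⟩ := h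
    simpa [h2, h3] using h1.2 s hs s' hs'
  · obtain ⟨⟨⟨h1, h2⟩, h3⟩, -, hb⟩ := h
    exact ⟨by simp [h2], by simp [h3], fun X hX => hX.base s hs s' hs' hb⟩

theorem isSweep_reachStep {D : Tab} (hD : D.Valid E.N) :
    IsSweep E (fun τ => τ vReach) (MarkInv (D.Reach E.N)) (numUnmarked E.N) 1 (HasTables D E.N)
      reachStep fun V => ∀ a < E.N, ∀ b < E.N, ∀ t < E.N, ∀ t' < E.N, D.M a b → 0 < D.w a t →
        0 < D.w' b t' → 0 < V t t' → V (D.src a) (D.src' b) = 1 := by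
  refine IsSweep.loop zero_le_one (fun τ k => Store.set_of_ne _ (by decide)) ?_ fun a ha => ?_
  · exact fun τ τ' h hτ => hτ.congr fun c hc => h c (by revert c; decide)
  refine IsSweep.loop zero_le_one (fun τ k => Store.set_of_ne _ (by decide)) ?_ fun b hb => ?_
  · exact fun τ τ' h => And.imp (fun hτ => hτ.congr fun c hc => h c (by revert c; decide))
      (h kA (by decide) ▸ id)
  refine IsSweep.loop zero_le_one (fun τ k => Store.set_of_ne _ (by decide)) ?_ fun t ht => ?_
  · exact fun τ τ' h => And.imp (And.imp (fun hτ => hτ.congr fun c hc => h c (by revert c; decide))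
      (h kA (by decide) ▸ id)) (h kB (by decide) ▸ id)
  refine IsSweep.loop zero_le_one (fun τ k => Store.set_of_ne _ (by decide)) ?_ fun t' ht' => ?_
  · exact fun τ τ' h => And.imp (And.imp (And.imp
      (fun hτ => hτ.congr fun c hc => h c (by revert c; decide))
      (h kA (by decide) ▸ id)) (h kB (by decide) ▸ id)) (h kI (by decide) ▸ id)
  refine IsSweep.whenPos (c := fun _ => D.M a b) (fun τ h => ?_) <|
    IsSweep.whenPos (c := fun _ => 0 < D.w a t) (fun τ h => ?_) <|
    IsSweep.whenPos (c := fun _ => 0 < D.w' b t') (fun τ h => ?_) <|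
    IsSweep.whenPos (c := fun V => 0 < V t t') (fun τ h => ?_) <|
    isSweep_mark ((hD.src_lt a ha).trans hD.n_lt) ((hD.src_lt' b hb).trans hD.n_lt') fun τ h => ?_
  · obtain ⟨⟨⟨⟨h1, h2⟩, h3⟩, h4⟩, h5⟩ := h
    simp [h2, h3, h1.mtch a ha b hb]
  · obtain ⟨⟨⟨⟨⟨h1, h2⟩, h3⟩, h4⟩, h5⟩, -⟩ := h
    have t2 : ((t : ℤ) + 2).toNat = t + 2 := by omega
    simp [h2, h4, t2, h1.w a ha t ht]
  · obtain ⟨⟨⟨⟨⟨⟨h1, h2⟩, h3⟩, h4⟩, h5⟩, -⟩, -⟩ := h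
    have t3 : ((t' : ℤ) + 3).toNat = t' + 3 := by omega
    simp [h3, h5, t3, h1.w' b hb t' ht']
  · obtain ⟨⟨⟨⟨⟨⟨⟨h1, h2⟩, h3⟩, h4⟩, h5⟩, -⟩, -⟩, -⟩ := h
    simp [h4, h5]
  · obtain ⟨⟨⟨⟨⟨⟨⟨⟨h1, h2⟩, h3⟩, h4⟩, h5⟩, -, hM⟩, -, hw⟩, -, hw'⟩, hI, hV⟩ := h
    refine ⟨by simp [h2, h1.src a ha], by simp [h3, h1.src' b hb], fun X hX => ?_⟩
    refine hX.step a ha b hb hM t ht t' ht' hw hw' (((hI t t').resolve_left fun h0 => ?_).2 X hX)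
    omega

/-! ### The decision program -/

/-- The decision for the systems in the tables. -/
def solveProg : AProg :=
  seq (repeatPow kR badRound 3) <|
  seq (repeatPow kR (seq reachBase reachStep) 3) <|
  assign vRes (lit 1 - cell vReach (reg vInit) (reg vInit'))

/-- Each time the marks lie in the least closed relation by the invariant and contain it because
they are closed, so they agree with it. -/
theorem sem_solveProg {D : Tab} (hN : 100 ≤ E.N) (hD : D.Valid E.N) {σ : Store}
    (hσ : HasTables D E.N σ) (h0 : σ vBad = 0) (h0' : σ vReach = 0) {i i' : ℕ}
    (hi : σ vInit 0 0 = i) (hi' : σ vInit' 0 0 = i') :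
    solveProg.sem E σ vRes 0 0 = 1 ↔ ¬ D.Reach E.N i i' := by
  obtain ⟨h1, h2⟩ := sem_repeat_sweep (by omega) (by decide)
    (fun τ τ' h hτ => hτ.congr fun c hc => h c (by revert c; decide))
    (isSweep_badRound hN hD) hσ (by rw [h0]; exact fun _ _ => .inl rfl)
  rw [solveProg]
  simp only [sem_seq]
  set σ₁ := (repeatPow kR badRound 3).sem E σ with hσ₁
  have f₁ : ∀ c ∉ kR :: badRound.writes, σ₁ c = σ c := fun c hc =>
    sem_frame (notMem_writes_repeatPow hc) σ
  have h3 : HasBad D (D.Bad E.N) E.N σ₁ := by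
    refine ⟨hσ.congr fun c hc => f₁ c (by revert c; decide), fun s _ s' _ => ⟨fun h hb => ?_,
      fun h => ?_⟩⟩
    · have := hb _ h2
      omega
    · rw [(h1 s s').resolve_right fun h' => h h'.2]
      decide
  obtain ⟨h4, h5, h6⟩ := sem_repeat_sweep (by omega) (by decide)
    (fun τ τ' h hτ => hτ.congr fun c hc => h c (by revert c; decide))
    (isSweep_reachBase.seq zero_le_one
      (fun τ τ' h hτ => hτ.congr fun c hc => h c (by revert c; decide))
      ((isSweep_reachStep hD).of_imp fun τ hτ => hτ.1)) h3
    (by rw [f₁ _ (by decide), h0']; exact fun _ _ => .inl rfl)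
  set σ₂ := (repeatPow kR (seq reachBase reachStep) 3).sem E σ₁ with hσ₂
  have f₂ : ∀ c ∉ kR :: (seq reachBase reachStep).writes, σ₂ c = σ₁ c := fun c hc =>
    sem_frame (notMem_writes_repeatPow hc) σ₁
  have e1 : σ₂ vInit 0 0 = i := by rw [f₂ _ (by decide), f₁ _ (by decide), hi]
  have e2 : σ₂ vInit' 0 0 = i' := by rw [f₂ _ (by decide), f₁ _ (by decide), hi']
  simp only [sem_assign, Store.set_same, and_self, if_true, eval_sub, eval_lit, eval_cell, eval_reg,
    e1, e2, Int.toNat_natCast]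
  constructor
  · intro h hr
    have := hr (fun s s' => σ₂ vReach s s' = 1) ⟨h5, fun a ha b hb hM t ht t' ht' hw hw' hV =>
      h6 a ha b hb t ht t' ht' hM hw hw' (by omega)⟩
    omega
  · intro h
    rw [(h4 i i').resolve_right fun h' => h h'.2]
    decide

end RAM

namespace RAM

open AExpr AProg

variable {E : Env}

/-! ### Reading the input -/

/-- Reading a system from the position `vPos` on: its number of states, its initial state, the number
of its transitions, and the records of the transitions. -/
def parseProg (vN vI vT vR : ℕ) (e : ℕ) : AProg :=
  seq (assign vN (input (reg vPos))) <|
  seq (assign vI (input (reg vPos + lit 1))) <|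
  seq (assign vT (input (reg vPos + lit 2))) <|
  seq (assign vPos (reg vPos + lit 3)) <|
  loop kA <| whenPos (reg vT - reg kA) <|
    seq (loop kJ <| whenPos (reg vN + lit e - reg kJ) <|
      store vR (reg kA) (reg kJ) (input (reg vPos + reg kJ))) <|
    assign vPos (reg vPos + reg vN + lit e)

/-- A record has length `n + e`, where `e` counts the source and the code of the action: 2 for the
nominal model, 3 for the implementation. -/
theorem sem_parseProg {vN vI vT vR e : ℕ} (hv : [vN, vI, vT, vR, vPos, kA, kJ].Nodup) {σ : Store}
    {P n i T : ℕ} (hP : σ vPos 0 0 = P) (hR : σ vR = 0) (hn : E.inp P = n) (hi : E.inp (P + 1) = i)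
    (hT : E.inp (P + 2) = T) (hTN : T ≤ E.N) (hnN : n + e ≤ E.N) :
    (parseProg vN vI vT vR e).sem E σ vN 0 0 = n ∧ (parseProg vN vI vT vR e).sem E σ vI 0 0 = i ∧
    (parseProg vN vI vT vR e).sem E σ vT 0 0 = T ∧
    (parseProg vN vI vT vR e).sem E σ vPos 0 0 = (P + 3 + T * (n + e) : ℕ) ∧
    ∀ a k, (parseProg vN vI vT vR e).sem E σ vR a k =
      if a < T ∧ k < n + e then E.inp (P + 3 + a * (n + e) + k) else 0 := by
  have t : ∀ x y : ℕ, ((x : ℤ) + y).toNat = x + y := fun x y => by omega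
  have t1 : ((P : ℤ) + 1).toNat = P + 1 := by omega
  have t2 : ((P : ℤ) + 2).toNat = P + 2 := by omega
  have hv' := hv
  simp only [List.nodup_cons, List.mem_cons, List.not_mem_nil, or_false, not_or, not_false_eq_true,
    List.nodup_nil, and_true] at hv
  obtain ⟨⟨n1, n2, n3, n4, n5, n6⟩, ⟨i1, i2, i3, i4, i5⟩, ⟨u1, u2, u3, u4⟩, ⟨r1, r2, r3⟩, -⟩ := hv
  have r1' := Ne.symm r1
  have r2' := Ne.symm r2
  rw [parseProg]
  simp only [sem_seq]
  set σ₁ := (assign vPos (reg vPos + lit 3)).sem E ((assign vT (input (reg vPos + lit 2))).sem E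
    ((assign vI (input (reg vPos + lit 1))).sem E ((assign vN (input (reg vPos))).sem E σ))) with hσ₁
  have g1 : σ₁ vN 0 0 = n := by
    simp [hσ₁, n1, n2, n4, hP, hn]
  have g2 : σ₁ vI 0 0 = i := by
    simp [hσ₁, i1, i3, Ne.symm n4, hP, t1, hi]
  have g3 : σ₁ vT 0 0 = T := by
    simp [hσ₁, u2, Ne.symm n4, Ne.symm i3, hP, t2, hT]
  have g4 : σ₁ vPos 0 0 = (P + 3 : ℕ) := by
    simp [hσ₁, Ne.symm n4, Ne.symm i3, Ne.symm u2, hP]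
  have g5 : σ₁ vR = 0 := by
    simp [hσ₁, Ne.symm n3, Ne.symm i2, Ne.symm u1, r1, hR]
  have key := sem_loop_inv (E := E) (a := kA) (σ := σ₁) (p := whenPos (reg vT - reg kA) <|
    seq (loop kJ <| whenPos (reg vN + lit e - reg kJ) <|
      store vR (reg kA) (reg kJ) (input (reg vPos + reg kJ))) <|
    assign vPos (reg vPos + reg vN + lit e))
    -- The loop always makes `N` rounds; those beyond the last transition do nothing, hence the
    -- minimum.
    (fun m τ => τ vPos 0 0 = (P + 3 + min m T * (n + e) : ℕ) ∧
      ∀ a k, τ vR a k =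
      if a < min m T ∧ k < n + e then E.inp (P + 3 + a * (n + e) + k) else 0) ?_ ?_
  · rw [min_eq_right hTN] at key
    refine ⟨?_, ?_, ?_, key⟩
    · rw [sem_frame (by simp [writes, whenPos, assign, *]), g1]
    · rw [sem_frame (by simp [writes, whenPos, assign, *]), g2]
    · rw [sem_frame (by simp [writes, whenPos, assign, *]), g3]
  · simp [g4, g5]
  · rintro m hm τ hτ ⟨h1, h2⟩
    have f1 : τ vN 0 0 = n := by rw [hτ _ (by simp [writes, whenPos, assign, *]), g1]
    have f2 : τ vT 0 0 = T := by rw [hτ _ (by simp [writes, whenPos, assign, *]), g3]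
    rw [sem_whenPos]
    by_cases hmT : m < T
    · rw [min_eq_left hmT.le] at h1 h2
      rw [min_eq_left hmT, if_pos (by simp [u3, f2, hmT])]
      have h3 := sem_loop_inv (E := E) (a := kJ) (σ := τ.set kA 0 0 m)
        (p := whenPos (reg vN + lit e - reg kJ) <|
          store vR (reg kA) (reg kJ) (input (reg vPos + reg kJ)))
        (fun c υ => ∀ a k, υ vR a k = if a < m ∧ k < n + e ∨ a = m ∧ k < min c (n + e) then
          E.inp (P + 3 + a * (n + e) + k) else 0) ?_ ?_
      · rw [min_eq_right hnN] at h3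
        refine ⟨?_, fun a k => ?_⟩
        · rw [sem_seq, sem_assign, Store.set_same, if_pos ⟨rfl, rfl⟩]
          simp only [eval_add, eval_reg, eval_lit]
          rw [sem_frame (by simp [writes, whenPos, *]), sem_frame
            (by simp [writes, whenPos, *])]
          simp [n5, f1, h1]
          ring
        · rw [sem_seq, sem_assign, Store.set_of_ne _ r1, h3]
          have : (a < m ∧ k < n + e ∨ a = m ∧ k < n + e) ↔ a < m + 1 ∧ k < n + e := by omega
          simp only [this]
      · simp [r2, h2]
      · intro c hc υ hυ h4 a k
        have k1 : υ vN 0 0 = n := by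
          rw [hυ _ (by simp [writes, whenPos, *]), Store.set_of_ne _ n5, f1]
        have k2 : υ vPos 0 0 = (P + 3 + m * (n + e) : ℕ) := by
          rw [hυ _ (by simp [writes, whenPos, *]), Store.set_of_ne _ (by decide), h1]
        have k3 : υ kA 0 0 = m := by
          rw [hυ _ (by simp [writes, whenPos, *])]
          simp
        rw [sem_whenPos]
        by_cases hce : c < n + e
        · rw [if_pos (by simp [n6, k1]; omega)]
          simp only [sem_store, Store.set_same, eval_reg, eval_input, eval_add,
            Store.set_of_ne _ (show kA ≠ kJ by decide), Store.set_of_ne _ (show vPos ≠ kJ by decide),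
            k2, k3, Int.toNat_natCast, and_self, if_true, Store.set_of_ne _ r3, t, h4]
          by_cases hak : a = m ∧ k = c
          · rw [if_pos hak, hak.1, hak.2, if_pos (by omega)]
          · rw [if_neg hak]
            have : (a < m ∧ k < n + e ∨ a = m ∧ k < min c (n + e)) ↔
              (a < m ∧ k < n + e ∨ a = m ∧ k < min (c + 1) (n + e)) := by omega
            simp only [this]
        · rw [if_neg (by simp [n6, k1]; omega), Store.set_of_ne _ r3, h4, min_eq_right (by omega),
            min_eq_right (by omega)]
    · rw [if_neg (by simp [u3, f2]; omega)]
      rw [min_eq_right (by omega)] at h1 h2 ⊢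
      simpa [r2] using ⟨h1, h2⟩

/-- Adding records for the Dirac distributions of the first system. -/
def diracProg : AProg :=
  loop kI <| whenPos (reg vNumS - reg kI) <|
    seq (store vRecs (reg vNumT + reg kI) (lit 0) (reg kI))
      (store vRecs (reg vNumT + reg kI) (reg kI + lit 2) (lit 1))

/-- The only answer to a fault is the Dirac distribution of the current state. Rows `T, …, T + n -
1` hold these, so that faults are matched like ordinary actions. -/
theorem sem_diracProg {σ : Store} {n T : ℕ} (hn : σ vNumS 0 0 = n) (hT : σ vNumT 0 0 = T)
    (hnN : n ≤ E.N) (hR : ∀ a k, T ≤ a → σ vRecs a k = 0) (a k : ℕ) :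
    diracProg.sem E σ vRecs a k = if a < T then σ vRecs a k else
      if a < T + n then if k = 0 then ((a - T : ℕ) : ℤ) else if k = a - T + 2 then 1 else 0
      else 0 := by
  have t : ∀ x y : ℕ, ((x : ℤ) + y).toNat = x + y := fun x y => by omega
  have t2 : ∀ x : ℕ, ((x : ℤ) + 2).toNat = x + 2 := fun x => by omega
  have key := sem_loop_inv (E := E) (a := kI) (σ := σ) (p := whenPos (reg vNumS - reg kI) <|
    seq (store vRecs (reg vNumT + reg kI) (lit 0) (reg kI))
      (store vRecs (reg vNumT + reg kI) (reg kI + lit 2) (lit 1)))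
    (fun m τ => ∀ a k, τ vRecs a k = if a < T then σ vRecs a k else
      if a < T + min m n then if k = 0 then ((a - T : ℕ) : ℤ) else if k = a - T + 2 then 1 else 0
      else 0) ?_ ?_
  · rw [min_eq_right hnN] at key
    exact key a k
  · intro a k
    by_cases h : a < T
    · simp [h]
    · simp [h, hR a k (by omega)]
  · intro m hm τ hτ h a k
    have f1 : τ vNumS 0 0 = n := by rw [hτ _ (by decide), hn]
    have f2 : τ vNumT 0 0 = T := by rw [hτ _ (by decide), hT]
    rw [sem_whenPos]
    by_cases hmn : m < n
    · rw [if_pos (by simp [f1, hmn])]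
      have := h a k
      have hmin : min (m + 1) n = m + 1 := min_eq_left hmn
      by_cases ha : a = T + m
      · subst ha
        by_cases hk0 : k = 0
        · simp [f2, t, t2, hk0, hmin]
        · by_cases hk : k = m + 2
          · simp [f2, t, t2, hk, hmin]
          · simp [f2, t, t2, hk, hk0, hmin, this]
      · have hiff : a < T + min (m + 1) n ↔ a < T + min m n := by omega
        simp [f2, t, t2, ha, this, hiff]
    · rw [if_neg (by simp [f1]; omega), Store.set_of_ne _ (by decide), h, min_eq_right (by omega),
        min_eq_right (by omega)]

/-- Deciding which transitions may be matched. -/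
def matchProg : AProg :=
  loop kA <| loop kB <| whenPos (reg vNumT' - reg kB) <|
    ite (reg vNumT - reg kA)
      (whenEq (cell vRecs' (reg kB) (lit 1)) (lit 0) <|
        whenEq (cell vRecs (reg kA) (lit 1)) (cell vRecs' (reg kB) (lit 2)) <|
        store vMatch (reg kA) (reg kB) (lit 1))
      (whenPos (reg vNumT + reg vNumS - reg kA) <|
        whenEq (cell vRecs' (reg kB) (lit 1)) (lit 1) <|
        store vMatch (reg kA) (reg kB) (lit 1))

theorem sem_matchProg {σ : Store} {n T T' : ℕ} (hn : σ vNumS 0 0 = n) (hT : σ vNumT 0 0 = T)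
    (hT' : σ vNumT' 0 0 = T') (hM : σ vMatch = 0) : ∀ a < E.N, ∀ b < E.N,
    0 < matchProg.sem E σ vMatch a b ↔ b < T' ∧
      (a < T ∧ σ vRecs' b 1 = 0 ∧ σ vRecs a 1 = σ vRecs' b 2 ∨
        T ≤ a ∧ a < T + n ∧ σ vRecs' b 1 = 1) := by
  set c : ℕ → ℕ → Prop := fun a b => b < T' ∧
      (a < T ∧ σ vRecs' b 1 = 0 ∧ σ vRecs a 1 = σ vRecs' b 2 ∨
        T ≤ a ∧ a < T + n ∧ σ vRecs' b 1 = 1) with hc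
  have key := sem_loop_inv (E := E) (a := kA) (σ := σ) (p := loop kB <|
    whenPos (reg vNumT' - reg kB) <| ite (reg vNumT - reg kA)
      (whenEq (cell vRecs' (reg kB) (lit 1)) (lit 0) <|
        whenEq (cell vRecs (reg kA) (lit 1)) (cell vRecs' (reg kB) (lit 2)) <|
        store vMatch (reg kA) (reg kB) (lit 1))
      (whenPos (reg vNumT + reg vNumS - reg kA) <|
        whenEq (cell vRecs' (reg kB) (lit 1)) (lit 1) <|
        store vMatch (reg kA) (reg kB) (lit 1)))
    (fun m τ => ∀ a b, 0 < τ vMatch a b ↔ a < m ∧ b < E.N ∧ c a b) (by simp [hM]) ?_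
  · intro a ha b hb
    exact (key a b).trans ⟨fun h => h.2.2, fun h => ⟨ha, hb, h⟩⟩
  · intro a ha τ hτ h
    have := sem_loop_inv (E := E) (a := kB) (σ := τ.set kA 0 0 a) (p :=
      whenPos (reg vNumT' - reg kB) <| ite (reg vNumT - reg kA)
        (whenEq (cell vRecs' (reg kB) (lit 1)) (lit 0) <|
          whenEq (cell vRecs (reg kA) (lit 1)) (cell vRecs' (reg kB) (lit 2)) <|
          store vMatch (reg kA) (reg kB) (lit 1))
        (whenPos (reg vNumT + reg vNumS - reg kA) <|
          whenEq (cell vRecs' (reg kB) (lit 1)) (lit 1) <|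
          store vMatch (reg kA) (reg kB) (lit 1)))
      (fun m υ => ∀ d b, 0 < υ vMatch d b ↔ d < a ∧ b < E.N ∧ c d b ∨ d = a ∧ b < m ∧ c d b)
      (by simp [h]) ?_
    · intro d b
      rw [this]
      constructor
      · rintro (⟨h1, h2⟩ | ⟨h1, h2⟩)
        · exact ⟨by omega, h2⟩
        · exact ⟨by omega, h2⟩
      · rintro ⟨h1, h2⟩
        rcases Nat.lt_succ_iff_lt_or_eq.1 h1 with h1 | h1
        · exact .inl ⟨h1, h2⟩
        · exact .inr ⟨h1, h2⟩
    · intro b hb υ hυ h1 d b'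
      have e1 : υ kA 0 0 = a := by
        rw [hυ _ (by decide)]
        simp
      have e2 : υ vNumS 0 0 = n := by
        rw [hυ _ (by decide), Store.set_of_ne _ (by decide), hτ _ (by decide), hn]
      have e3 : υ vNumT 0 0 = T := by
        rw [hυ _ (by decide), Store.set_of_ne _ (by decide), hτ _ (by decide), hT]
      have e4 : υ vNumT' 0 0 = T' := by
        rw [hυ _ (by decide), Store.set_of_ne _ (by decide), hτ _ (by decide), hT']
      have e5 : υ vRecs = σ vRecs := by
        rw [hυ _ (by decide), Store.set_of_ne _ (by decide), hτ _ (by decide)]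
      have e6 : υ vRecs' = σ vRecs' := by
        rw [hυ _ (by decide), Store.set_of_ne _ (by decide), hτ _ (by decide)]
      have hsem : (whenPos (reg vNumT' - reg kB) <| ite (reg vNumT - reg kA)
          (whenEq (cell vRecs' (reg kB) (lit 1)) (lit 0) <|
            whenEq (cell vRecs (reg kA) (lit 1)) (cell vRecs' (reg kB) (lit 2)) <|
            store vMatch (reg kA) (reg kB) (lit 1))
          (whenPos (reg vNumT + reg vNumS - reg kA) <|
            whenEq (cell vRecs' (reg kB) (lit 1)) (lit 1) <|
            store vMatch (reg kA) (reg kB) (lit 1))).sem E (υ.set kB 0 0 b) vMatch d b' =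
          if c a b ∧ d = a ∧ b' = b then 1 else υ vMatch d b' := by
        simp only [sem_whenPos, sem_whenEq, AProg.sem]
        simp only [eval_sub, eval_reg, eval_add, eval_cell, eval_lit, Store.set_same, and_self,
          if_true, Store.set_of_ne _ (show kA ≠ kB by decide), Store.set_of_ne _
          (show vNumS ≠ kB by decide), Store.set_of_ne _ (show vNumT ≠ kB by decide),
          Store.set_of_ne _ (show vNumT' ≠ kB by decide), Store.set_of_ne _
          (show vRecs ≠ kB by decide), Store.set_of_ne _ (show vRecs' ≠ kB by decide), e1, e2, e3, e4,
          e5, e6, Int.toNat_natCast]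
        simp only [Int.reduceToNat, hc]
        split_ifs <;> first | omega | (simp; try omega)
      rw [hsem]
      by_cases hd : c a b ∧ d = a ∧ b' = b
      · obtain ⟨hcab, rfl, rfl⟩ := hd
        simp [hcab]
      · rw [if_neg hd, h1]
        refine or_congr_right (and_congr_right fun hda => ?_)
        subst hda
        constructor
        · exact fun h2 => ⟨by omega, h2.2⟩
        · rintro ⟨h2, h3⟩
          refine ⟨?_, h3⟩
          rcases Nat.lt_succ_iff_lt_or_eq.1 h2 with h2 | rfl
          · exact h2
          · exact absurd ⟨h3, rfl, rfl⟩ hd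

end RAM

/-! ### The fixed points on pairs of states -/

section StatePairs

variable {S S' Act Flt : Type*} (A : PTS S Act) (A' : PTS S' (Act ⊕ Flt))

/-- All couplings of the two distributions meet `X`. -/
def AllMeet (X : Set (S × S')) (μ : PMF S) (μ' : PMF S') : Prop :=
  ∀ w, IsCoupling w μ μ' → ∃ p ∈ w.support, p ∈ X

/-- The distributions with which the nominal model may answer a transition of the implementation. -/
def Answers (s : S) : Act ⊕ Flt → PMF S → Prop
  | .inl σ, μ => (s, σ, μ) ∈ A.trans
  | .inr _, μ => μ = PMF.pure s

/-- One whole round, the Refuter's move, the answer and the coupling, as a single closure condition.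
-/
structure PairsBadClosed (X : Set (S × S')) : Prop where
  nominal : ∀ s σ μ, (s, σ, μ) ∈ A.trans → ∀ s',
    (∀ μ', (s', Sum.inl σ, μ') ∈ A'.trans → AllMeet X μ μ') → (s, s') ∈ X
  implementation : ∀ s' σ' μ', (s', σ', μ') ∈ A'.trans → ∀ s,
    (∀ μ, Answers A s σ' μ → AllMeet X μ μ') → (s, s') ∈ X

/-- Moves of the implementation suffice for the step: a nominal move and its answer lead to the same
pairs of distributions as the answering transition, played first and matched by the nominal one. -/
structure PairsReachClosed (B X : Set (S × S')) : Prop where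
  base : ∀ p ∉ B, p ∈ X
  step : ∀ s' σ' μ', (s', σ', μ') ∈ A'.trans → ∀ s μ, Answers A s σ' μ →
    ∀ t ∈ μ.support, ∀ t' ∈ μ'.support, (t, t') ∈ X → (s, s') ∈ X

variable {A A'}

namespace SymVertex

/-- The vertices from which the Refuter reaches the pairs in `X` whatever the answer and the coupling. -/
def ForcesPair (X : Set (S × S')) : SymVertex A A' → Prop
  | .err => True
  | .ref s s' => (s, s') ∈ X
  | .verNom _ σ s' μ _ => ∀ μ', (s', Sum.inl σ, μ') ∈ A'.trans → AllMeet X μ μ'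
  | .verImp s σ' _ μ' _ => ∀ μ, Answers A s σ' μ → AllMeet X μ μ'
  | .prob _ _ μ μ' => AllMeet X μ μ'

theorem forallPre_forcesPair_subset [Finite S] [Finite S'] {X : Set (S × S')}
    (hX : PairsBadClosed A A' X) :
    forallPre {v : SymVertex A A' | ForcesPair X v} ⊆ {v | ForcesPair X v} := by
  intro v hv
  cases v with
  | err => trivial
  | ref s s' =>
    obtain ⟨v', hv', e⟩ := (mem_forallPre_of_refuter rfl).1 hv
    rcases e with e | ⟨h, -⟩
    · cases e with
      | nominal _ h => exact hX.nominal _ _ _ h _ hv'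
      | implementation _ h => exact hX.implementation _ _ _ h _ hv'
    · rcases h with h | h <;> nomatch h
  | verNom s σ s' μ h =>
    intro μ' h'
    exact (mem_forallPre_of_verifier rfl).1 hv (.prob s s' μ μ') (.move (.matchNominal h h'))
  | verImp s σ' s' μ' h =>
    intro μ hμ
    cases σ' with
    | inl σ =>
      exact (mem_forallPre_of_verifier rfl).1 hv (.prob s s' μ μ') (.move (.matchImplementation hμ h))
    | inr F =>
      obtain rfl : μ = PMF.pure s := hμ
      exact (mem_forallPre_of_verifier rfl).1 hv (.prob s s' _ μ') (.move (.fault h))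
  | prob s s' μ μ' => exact prob_mem_forallPre_iff.1 hv

theorem pairsBadClosed [Finite S] [Finite S'] (hA : A.trans.Finite) (hA' : A'.trans.Finite) :
    PairsBadClosed A A'
      {p | (.ref p.1 p.2 : SymVertex A A') ∈ preStar forallPre {.err}} := by
  have hcl := forallPre_preStar_subset hA hA'
  have herr : (.err : SymVertex A A') ∈ preStar forallPre {.err} := Set.mem_iUnion.2 ⟨0, rfl⟩
  refine ⟨fun s σ μ h s' hall => ?_, fun s' σ' μ' h s hall => ?_⟩
  · refine hcl ((mem_forallPre_of_refuter rfl).2 ⟨.verNom s σ s' μ h, ?_, .move (.nominal s' h)⟩)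
    refine hcl ((mem_forallPre_of_verifier rfl).2 fun v' e => ?_)
    rcases e with e | _
    · cases e with
      | matchNominal _ h' => exact hcl (prob_mem_forallPre_iff.2 (hall _ h'))
    · exact herr
  · refine hcl ((mem_forallPre_of_refuter rfl).2 ⟨.verImp s σ' s' μ' h, ?_,
      .move (.implementation s h)⟩)
    refine hcl ((mem_forallPre_of_verifier rfl).2 fun v' e => ?_)
    rcases e with e | _
    · cases e with
      | matchImplementation hμ _ => exact hcl (prob_mem_forallPre_iff.2 (hall _ hμ))
      | fault _ => exact hcl (prob_mem_forallPre_iff.2 (hall _ rfl))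
    · exact herr

/-- Closed sets of pairs extend to `forallPre`-closed sets of vertices through `ForcesPair`, and the
attractor restricts to a closed set of pairs, so the two least fixed points agree. -/
theorem ref_mem_preStar_forallPre_iff [Finite S] [Finite S'] (hA : A.trans.Finite)
    (hA' : A'.trans.Finite) {s : S} {s' : S'} :
    (.ref s s' : SymVertex A A') ∈ preStar forallPre {.err} ↔
      ∀ X, PairsBadClosed A A' X → (s, s') ∈ X := by
  refine ⟨fun h X hX => ?_, fun h => h _ (pairsBadClosed hA hA')⟩
  exact preStar_subset forallPre_mono (by rintro _ rfl; trivial)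
    (forallPre_forcesPair_subset hX) h

/-- The vertices from which a pair in `X` can be reached with one answer at most. -/
def MayReachPair (X : Set (S × S')) : SymVertex A A' → Prop
  | .err => False
  | .ref s s' => (s, s') ∈ X
  | .verNom _ σ s' μ _ => ∃ μ', (s', Sum.inl σ, μ') ∈ A'.trans ∧
      ∃ t ∈ μ.support, ∃ t' ∈ μ'.support, (t, t') ∈ X
  | .verImp s σ' _ μ' _ => ∃ μ, Answers A s σ' μ ∧ ∃ t ∈ μ.support, ∃ t' ∈ μ'.support, (t, t') ∈ X
  | .prob _ _ μ μ' => ∃ t ∈ μ.support, ∃ t' ∈ μ'.support, (t, t') ∈ X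

theorem existsPre_mayReachPair_subset {B X : Set (S × S')} (hX : PairsReachClosed A A' B X) :
    existsPre {v : SymVertex A A' | MayReachPair X v} ⊆ {v | MayReachPair X v} := by
  intro v hv
  obtain ⟨v', hv', e⟩ := mem_existsPre_iff.1 hv
  rcases e with e | _
  · cases e with
    | nominal s' h =>
      obtain ⟨μ', h', t, ht, t', ht', htX⟩ := hv'
      exact hX.step _ _ _ h' _ _ h t ht t' ht' htX
    | implementation s h =>
      obtain ⟨μ, hμ, t, ht, t', ht', htX⟩ := hv'
      exact hX.step _ _ _ h _ _ hμ t ht t' ht' htX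
    | matchNominal h h' => exact ⟨_, h', hv'⟩
    | matchImplementation h h' => exact ⟨_, h, hv'⟩
    | fault h' => exact ⟨_, rfl, hv'⟩
    | resolve h h' => exact ⟨_, h, _, h', hv'⟩
  · exact hv'.elim

theorem compl_subset_mayReachPair [Finite S] [Finite S'] (hA : A.trans.Finite)
    (hA' : A'.trans.Finite) {X : Set (S × S')}
    (hX : ∀ s s', (.ref s s' : SymVertex A A') ∉ preStar forallPre {.err} → (s, s') ∈ X) :
    Set.univ \ preStar forallPre ({.err} : Set (SymVertex A A')) ⊆ {v | MayReachPair X v} := by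
  have hcl := forallPre_preStar_subset hA hA'
  have herr : (.err : SymVertex A A') ∈ preStar forallPre {.err} := Set.mem_iUnion.2 ⟨0, rfl⟩
  have hprob : ∀ s s' μ μ', (.prob s s' μ μ' : SymVertex A A') ∉ preStar forallPre {.err} →
      ∃ t ∈ μ.support, ∃ t' ∈ μ'.support, (t, t') ∈ X := by
    intro s s' μ μ' h
    have h1 := mt (fun h => hcl (prob_mem_forallPre_iff.2 h)) h
    push Not at h1
    obtain ⟨w, hw, hall⟩ := h1
    obtain ⟨p, hp⟩ := w.support_nonempty
    obtain ⟨h2, h3⟩ := hw.mem_support hp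
    exact ⟨_, h2, _, h3, hX _ _ (hall p hp)⟩
  rintro v ⟨-, hv⟩
  cases v with
  | err => exact hv herr
  | ref s s' => exact hX s s' hv
  | verNom s σ s' μ h =>
    have h1 := mt (fun h' => hcl ((mem_forallPre_of_verifier rfl).2 h')) hv
    push Not at h1
    obtain ⟨v', e, hv'⟩ := h1
    rcases e with e | _
    · cases e with
      | matchNominal _ h' => exact ⟨_, h', hprob _ _ _ _ hv'⟩
    · exact (hv' herr).elim
  | verImp s σ' s' μ' h =>
    have h1 := mt (fun h' => hcl ((mem_forallPre_of_verifier rfl).2 h')) hv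
    push Not at h1
    obtain ⟨v', e, hv'⟩ := h1
    rcases e with e | _
    · cases e with
      | matchImplementation hμ _ => exact ⟨_, hμ, hprob _ _ _ _ hv'⟩
      | fault _ => exact ⟨_, rfl, hprob _ _ _ _ hv'⟩
    · exact (hv' herr).elim
  | prob s s' μ μ' => exact hprob s s' μ μ' hv

theorem ref_mem_preStar_existsPre_iff [Finite S] [Finite S'] (hA : A.trans.Finite)
    (hA' : A'.trans.Finite) {s : S} {s' : S'} :
    (.ref s s' : SymVertex A A') ∈ preStar existsPre (Set.univ \ preStar forallPre {.err}) ↔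
      ∀ X, PairsReachClosed A A' {p | ∀ X, PairsBadClosed A A' X → p ∈ X} X → (s, s') ∈ X := by
  constructor
  · intro h X hX
    refine preStar_subset existsPre_mono (compl_subset_mayReachPair hA hA' fun s s' h => ?_)
      (existsPre_mayReachPair_subset hX) h
    rw [ref_mem_preStar_forallPre_iff hA hA'] at h
    exact hX.base _ h
  · have key : PairsReachClosed A A' {p | ∀ X, PairsBadClosed A A' X → p ∈ X}
        {p | (.ref p.1 p.2 : SymVertex A A') ∈
          preStar existsPre (Set.univ \ preStar forallPre {.err})} := ?_
    · exact fun h => h _ key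
    refine ⟨fun p hp => ?_, ?_⟩
    · refine Set.mem_iUnion.2 ⟨0, trivial, fun hm => hp ?_⟩
      exact (ref_mem_preStar_forallPre_iff hA hA').1 hm
    · intro s' σ' μ' h s μ hμ t ht t' ht' hX
      refine existsPre_preStar_subset _ (mem_existsPre (v' := .verImp s σ' s' μ' h)
        (.move (.implementation s h)) ?_)
      refine existsPre_preStar_subset _ (mem_existsPre (v' := .prob s s' μ μ') (.move ?_)
        (existsPre_preStar_subset _ (mem_existsPre (.move (.resolve ht ht')) hX)))
      cases σ' with
      | inl σ => exact .matchImplementation hμ h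
      | inr F =>
        obtain rfl : μ = PMF.pure s := hμ
        exact .fault h

end SymVertex

theorem almostSureFailing_iff_pairs [Finite S] [Finite S'] (hA : A.trans.Finite)
    (hA' : A'.trans.Finite) : AlmostSureFailing A A' ↔
      ¬ ∀ X, PairsReachClosed A A' {p | ∀ X, PairsBadClosed A A' X → p ∈ X} X →
        (A.init, A'.init) ∈ X := by
  rw [almostSureFailing_iff hA hA', ← SymVertex.ref_mem_preStar_existsPre_iff hA hA', Set.mem_sdiff]
  simp

end StatePairs

/-! ### The encodings -/

theorem getD_flatMap {α : Type*} {f : α → List ℤ} {c : ℕ} (hf : ∀ x, (f x).length = c) :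
    ∀ (L : List α) (a : ℕ) (h : a < L.length) (k : ℕ), k < c →
      (L.flatMap f).getD (a * c + k) 0 = (f L[a]).getD k 0 := by
  intro L
  induction L with
  | nil => exact fun a h => absurd h (Nat.not_lt_zero a)
  | cons x L ih =>
    intro a h k hk
    rw [List.flatMap_cons]
    cases a with
    | zero =>
      rw [Nat.zero_mul, Nat.zero_add, List.getD_append _ _ _ _ (by rw [hf]; exact hk)]
      rfl
    | succ a =>
      rw [List.getD_append_right _ _ _ _ (by rw [hf, Nat.succ_mul]; omega), hf,
        show (a + 1) * c + k - c = a * c + k by rw [Nat.succ_mul]; omega, ih a _ k hk]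
      rfl

namespace RatTrans

variable {n : ℕ} {Act : Type}

/-- The weights, continued by zero. -/
def wt (t : RatTrans n Act) (i : ℕ) : ℕ := if h : i < n then t.weight ⟨i, h⟩ else 0

theorem length_encode {act : Act → List ℤ} {c : ℕ} (hc : ∀ a, (act a).length = c)
    (t : RatTrans n Act) : (t.encode act).length = n + (c + 1) := by
  simp [encode, hc]
  omega

theorem getD_encode_zero {act : Act → List ℤ} (t : RatTrans n Act) :
    (t.encode act).getD 0 0 = t.src := by
  simp [encode]

theorem getD_encode_act {act : Act → List ℤ} (t : RatTrans n Act) {k : ℕ}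
    (hk : k < (act t.act).length) : (t.encode act).getD (k + 1) 0 = (act t.act).getD k 0 := by
  rw [encode, List.cons_append, List.getD_cons_succ, List.getD_append _ _ _ _ hk]

theorem getD_encode_weight {act : Act → List ℤ} {c : ℕ} (hc : ∀ a, (act a).length = c)
    (t : RatTrans n Act) (i : ℕ) : (t.encode act).getD (i + (c + 1)) 0 = t.wt i := by
  rw [encode, List.cons_append, ← Nat.add_assoc, List.getD_cons_succ, List.getD_append_right _ _ _ _
    (by rw [hc]; omega), hc, Nat.add_sub_cancel, wt]
  split_ifs with h
  · rw [List.getD_eq_getElem _ _ (by simpa using h), List.getElem_ofFn]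
  · rw [List.getD_eq_default _ _ (by simpa using h)]
    rfl

theorem sum_wt (t : RatTrans n Act) {N : ℕ} (hN : n ≤ N) :
    ∑ i ∈ Finset.range N, t.wt i = ∑ i, t.weight i := by
  rw [← Finset.sum_subset (Finset.range_mono hN), ← Fin.sum_univ_eq_sum_range t.wt n]
  · exact Finset.sum_congr rfl fun i _ => by simp [wt]
  · intro i _ hi
    simp only [Finset.mem_range] at hi
    simp [wt, hi]

theorem hasWeights (t : RatTrans n Act) {N : ℕ} (hN : n ≤ N) : HasWeights N t.dist t.wt := by
  refine ⟨fun i => ?_, ?_, fun i hi => dif_neg (not_lt.2 hi)⟩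
  · rw [t.sum_wt hN, dist, PMF.normalize_apply, tsum_fintype, ← Nat.cast_sum, ENNReal.toReal_mul,
      ENNReal.toReal_inv, ENNReal.toReal_natCast, ENNReal.toReal_natCast, mul_assoc, inv_mul_cancel₀,
      mul_one, wt, dif_pos i.2]
    exact_mod_cast t.sum_ne_zero
  · rw [t.sum_wt hN]
    exact t.sum_ne_zero

end RatTrans

theorem hasWeights_pure {n N : ℕ} (hN : n ≤ N) (s : Fin n) :
    HasWeights N (PMF.pure s) fun i => if i = s then 1 else 0 := by
  have h : ∑ i ∈ Finset.range N, (if i = (s : ℕ) then 1 else 0) = 1 := by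
    simp [s.2.trans_le hN]
  refine ⟨fun i => ?_, by rw [h]; exact one_ne_zero, fun i hi => if_neg (by omega)⟩
  rw [h, PMF.pure_apply]
  by_cases his : i = s
  · simp [his]
  · simp [his, Fin.val_inj]

namespace RatPTS

variable {Act : Type} {act : Act → List ℤ} {c : ℕ}

theorem length_encode (hc : ∀ a, (act a).length = c) (A : RatPTS Act) :
    (A.encode act).length = 3 + A.trans.length * (A.n + (c + 1)) := by
  simp only [encode, List.length_append, List.length_flatMap, RatTrans.length_encode hc]
  simp

theorem getD_encode (hc : ∀ a, (act a).length = c) (A : RatPTS Act) {a k : ℕ}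
    (ha : a < A.trans.length) (hk : k < A.n + (c + 1)) :
    (A.encode act).getD (3 + a * (A.n + (c + 1)) + k) 0 = (A.trans[a].encode act).getD k 0 := by
  rw [encode, List.getD_append_right _ _ _ _ (by simp; omega), ← getD_flatMap
    (RatTrans.length_encode hc) A.trans a ha k hk]
  congr 1
  simp
  omega

theorem n_pos (A : RatPTS Act) : 0 < A.n := A.init.pos

theorem trans_length_pos (A : RatPTS Act) : 0 < A.trans.length := by
  obtain ⟨t, ht, -⟩ := A.exists_trans A.init
  exact List.length_pos_of_mem ht

end RatPTS

def encodeAct (a : ℕ) : List ℤ := [(a : ℤ)]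

def encodeAct' : ℕ ⊕ ℕ → List ℤ :=
  Sum.elim (fun a : ℕ => [0, (a : ℤ)]) fun F : ℕ => [1, (F : ℤ)]

theorem length_encodeAct (a : ℕ) : (encodeAct a).length = 1 := rfl

theorem length_encodeAct' (a : ℕ ⊕ ℕ) : (encodeAct' a).length = 2 := by
  cases a <;> rfl

/-! ### The tables of a pair of finite rational systems -/

section Table

variable (A : RatPTS ℕ) (A' : RatPTS (ℕ ⊕ ℕ))

/-- The distributions of the transitions, followed by the Dirac distributions. -/
def RatPTS.distExt (A : RatPTS ℕ) (a : ℕ) : PMF (Fin A.n) :=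
  if h : a < A.trans.length then A.trans[a].dist
  else if h : a - A.trans.length < A.n then PMF.pure ⟨a - A.trans.length, h⟩ else PMF.pure A.init

/-- Rows past the transitions of `A` are the Dirac answers to faults. The default source `0` is a
state, as validity demands for every row below `N`; unused rows are excluded by `M`. -/
def tab : Tab where
  n := A.n
  n' := A'.n
  T := A.trans.length
  T' := A'.trans.length
  src a := if h : a < A.trans.length then A.trans[a].src else
    if a < A.trans.length + A.n then a - A.trans.length else 0
  src' b := if h : b < A'.trans.length then A'.trans[b].src else 0
  w a i := if h : a < A.trans.length then A.trans[a].wt i else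
    if a < A.trans.length + A.n then if i = a - A.trans.length then 1 else 0 else 0
  w' b i := if h : b < A'.trans.length then A'.trans[b].wt i else 0
  M a b := ∃ hb : b < A'.trans.length,
    (∃ ha : a < A.trans.length, A'.trans[b].act = .inl A.trans[a].act) ∨
    (A.trans.length ≤ a ∧ a < A.trans.length + A.n ∧ ∃ F, A'.trans[b].act = .inr F)

variable {A A'} {N : ℕ}

theorem hasWeights_tab (hn : A.n ≤ N) {a : ℕ} (ha : a < A.trans.length + A.n) :
    HasWeights N (A.distExt a) ((tab A A').w a) := by
  by_cases h : a < A.trans.length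
  · have h1 : A.distExt a = A.trans[a].dist := dif_pos h
    have h2 : (tab A A').w a = A.trans[a].wt := funext fun i => dif_pos h
    rw [h1, h2]
    exact RatTrans.hasWeights _ hn
  · have h1 : A.distExt a = PMF.pure ⟨a - A.trans.length, by omega⟩ :=
      (dif_neg h).trans (dif_pos (by omega))
    have h2 : (tab A A').w a = fun i => if i = a - A.trans.length then 1 else 0 :=
      funext fun i => (dif_neg h).trans (if_pos ha)
    rw [h1, h2]
    exact hasWeights_pure hn _

theorem hasWeights_tab' (hn' : A'.n ≤ N) {b : ℕ} (hb : b < A'.trans.length) :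
    HasWeights N A'.trans[b].dist ((tab A A').w' b) := by
  have h : (tab A A').w' b = A'.trans[b].wt := funext fun i => dif_pos hb
  rw [h]
  exact RatTrans.hasWeights _ hn'

theorem HasWeights.mem_support_iff {n : ℕ} {μ : PMF (Fin n)} {w : ℕ → ℕ} (h : HasWeights N μ w)
    (i : Fin n) : i ∈ μ.support ↔ 0 < w i := by
  have h1 : ((∑ i ∈ Finset.range N, w i : ℕ) : ℝ) ≠ 0 := Nat.cast_ne_zero.2 h.2.1
  rw [PMF.mem_support_iff, Nat.pos_iff_ne_zero, ← Nat.cast_ne_zero (R := ℝ), ← h.1 i,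
    mul_ne_zero_iff_right h1, ENNReal.toReal_ne_zero]
  simp [μ.apply_ne_top i]

theorem HasWeights.lt_of_pos {n : ℕ} {μ : PMF (Fin n)} {w : ℕ → ℕ} (h : HasWeights N μ w) {i : ℕ}
    (hi : 0 < w i) : i < n := by
  by_contra hle
  exact hi.ne' (h.2.2 i (not_lt.1 hle))

theorem tab_feas_iff (hn : A.n ≤ N) (hn' : A'.n ≤ N) {X : ℕ → ℕ → Prop} {a b : ℕ}
    (ha : a < A.trans.length + A.n) (hb : b < A'.trans.length) :
    (tab A A').Feas N X a b ↔
      ¬ AllMeet {p : Fin A.n × Fin A'.n | X p.1 p.2} (A.distExt a) A'.trans[b].dist := by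
  rw [Tab.Feas, ← exists_isTransport_iff_hall hn hn' (hasWeights_tab hn ha)
    (hasWeights_tab' hn' hb)
    (C := {p : Fin A.n × Fin A'.n | X p.1 p.2}) fun i j => Iff.rfl, ← exists_coupling_iff, AllMeet]
  push Not
  rfl

theorem answers_iff (hN : A.trans.length + A.n ≤ N) {b : ℕ} (hb : b < A'.trans.length) {s : Fin A.n}
    {μ : PMF (Fin A.n)} : Answers A.toPTS s A'.trans[b].act μ ↔
      ∃ a < N, (tab A A').M a b ∧ (tab A A').src a = s ∧ A.distExt a = μ ∧
        a < A.trans.length + A.n := by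
  constructor
  · intro h
    cases hact : A'.trans[b].act with
    | inl σ =>
      rw [hact] at h
      obtain ⟨t, ht, heq⟩ := h
      obtain ⟨a, ha, rfl⟩ := List.mem_iff_getElem.1 ht
      simp only [Prod.mk.injEq] at heq
      refine ⟨a, by omega, ⟨hb, .inl ⟨ha, by rw [hact, heq.2.1]⟩⟩, ?_, ?_, by omega⟩
      · exact (dif_pos ha).trans (by rw [heq.1])
      · exact (dif_pos ha).trans heq.2.2.symm
    | inr F =>
      rw [hact] at h
      obtain rfl : μ = PMF.pure s := h
      refine ⟨A.trans.length + s, by omega, ⟨hb, .inr ⟨by omega, by omega, F, hact⟩⟩, ?_, ?_,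
        by omega⟩
      · exact (dif_neg (by omega)).trans ((if_pos (by omega)).trans (by omega))
      · refine (dif_neg (by omega)).trans ((dif_pos (by omega)).trans ?_)
        congr
        omega
  · rintro ⟨a, -, ⟨_, ⟨ha, hact⟩ | ⟨ha, ha', F, hact⟩⟩, hs, rfl, -⟩
    · rw [hact]
      refine ⟨A.trans[a], List.getElem_mem ha, ?_⟩
      have h1 : ((tab A A').src a) = (A.trans[a].src : ℕ) := dif_pos ha
      have h2 : A.distExt a = A.trans[a].dist := dif_pos ha
      rw [h2, ← Fin.val_inj.1 (h1.symm.trans hs)]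
    · rw [hact]
      have h1 : ((tab A A').src a) = a - A.trans.length :=
        (dif_neg (by omega)).trans (if_pos (by omega))
      refine (dif_neg (by omega)).trans ((dif_pos (by omega)).trans ?_)
      congr
      exact h1.symm.trans hs

/-- A set of pairs of states as a relation between numbers. -/
def natRel (X : Set (Fin A.n × Fin A'.n)) (i j : ℕ) : Prop := ∀ h h', ((⟨i, h⟩, ⟨j, h'⟩) : _ × _) ∈ X

theorem natRel_val {X : Set (Fin A.n × Fin A'.n)} {s : Fin A.n} {s' : Fin A'.n} :
    natRel X s s' ↔ (s, s') ∈ X :=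
  ⟨fun h => h s.2 s'.2, fun h _ _ => h⟩

theorem setOf_natRel (X : Set (Fin A.n × Fin A'.n)) :
    {p : Fin A.n × Fin A'.n | natRel X p.1 p.2} = X :=
  Set.ext fun _ => natRel_val

theorem badClosed_natRel (hN : A.trans.length + A.n ≤ N) (hN' : A'.trans.length ≤ N)
    (hn' : A'.n ≤ N) {X : Set (Fin A.n × Fin A'.n)}
    (hX : PairsBadClosed A.toPTS A'.toPTS X) : (tab A A').BadClosed N (natRel X) := by
  refine ⟨fun a ha s' hs' h => ?_, fun b hb s hs h => ?_⟩
  · have ha' : a < A.trans.length := ha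
    have h1 : (tab A A').src a = A.trans[a].src := dif_pos ha'
    rw [h1]
    refine (natRel_val (s' := ⟨s', hs'⟩)).2 (hX.nominal _ A.trans[a].act A.trans[a].dist
      ⟨_, List.getElem_mem ha', rfl⟩ _ ?_)
    rintro μ' ⟨t, ht, heq⟩
    obtain ⟨b, hb, rfl⟩ := List.mem_iff_getElem.1 ht
    simp only [Prod.mk.injEq] at heq
    have h2 := h b (by omega) ⟨hb, .inl ⟨ha', heq.2.1.symm⟩⟩ ((dif_pos hb).trans (by rw [← heq.1]))
    rw [tab_feas_iff (by omega) hn' (by omega) hb, not_not, setOf_natRel] at h2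
    rw [heq.2.2]
    have h3 : A.distExt a = A.trans[a].dist := dif_pos ha'
    rwa [h3] at h2
  · have hb' : b < A'.trans.length := hb
    have h1 : (tab A A').src' b = A'.trans[b].src := dif_pos hb'
    rw [h1]
    refine (natRel_val (s := ⟨s, hs⟩)).2 (hX.implementation _ A'.trans[b].act A'.trans[b].dist
      ⟨_, List.getElem_mem hb', rfl⟩ _ ?_)
    intro μ hμ
    obtain ⟨a, haN, hM, hsrc, rfl, ha⟩ := (answers_iff hN hb').1 hμ
    have h2 := h a haN hM hsrc
    rwa [tab_feas_iff (by omega) hn' ha hb', not_not, setOf_natRel] at h2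

theorem pairsBadClosed_setOf (hN : A.trans.length + A.n ≤ N)
    (hn' : A'.n ≤ N) {X : ℕ → ℕ → Prop} (hX : (tab A A').BadClosed N X) :
    PairsBadClosed A.toPTS A'.toPTS {p | X p.1 p.2} := by
  refine ⟨?_, ?_⟩
  · rintro s σ μ ⟨t, ht, heq⟩ s' h
    obtain ⟨a, ha, rfl⟩ := List.mem_iff_getElem.1 ht
    simp only [Prod.mk.injEq] at heq
    obtain ⟨rfl, rfl, rfl⟩ := heq
    have h1 : (tab A A').src a = A.trans[a].src := dif_pos ha
    have := hX.nominal a ha s' s'.2 ?_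
    · rwa [h1] at this
    · rintro b - ⟨hb, hM⟩ hs'
      rw [tab_feas_iff (by omega) hn' (by omega) hb, not_not]
      have h2 : A.distExt a = A.trans[a].dist := dif_pos ha
      rw [h2]
      refine h _ ⟨_, List.getElem_mem hb, ?_⟩
      have h3 : (tab A A').src' b = A'.trans[b].src := dif_pos hb
      rw [Fin.val_inj.1 (hs'.symm.trans h3)]
      rcases hM with ⟨_, hM⟩ | ⟨h4, -⟩
      · rw [hM]
      · omega
  · rintro s' σ' μ' ⟨t, ht, heq⟩ s h
    obtain ⟨b, hb, rfl⟩ := List.mem_iff_getElem.1 ht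
    simp only [Prod.mk.injEq] at heq
    obtain ⟨rfl, rfl, rfl⟩ := heq
    have h1 : (tab A A').src' b = A'.trans[b].src := dif_pos hb
    have := hX.implementation b hb s s.2 ?_
    · rwa [h1] at this
    · intro a haN hM hs
      have ha : a < A.trans.length + A.n := by
        obtain ⟨_, ⟨h2, -⟩ | ⟨-, h2, -⟩⟩ := hM <;> omega
      rw [tab_feas_iff (by omega) hn' ha hb, not_not]
      exact h _ ((answers_iff hN hb).2 ⟨a, haN, hM, hs, rfl, ha⟩)

theorem tab_bad_iff (hN : A.trans.length + A.n ≤ N) (hN' : A'.trans.length ≤ N)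
    (hn' : A'.n ≤ N) (s : Fin A.n) (s' : Fin A'.n) : (tab A A').Bad N s s' ↔
      (s, s') ∈ {p | ∀ X, PairsBadClosed A.toPTS A'.toPTS X → p ∈ X} :=
  ⟨fun h _ hX => natRel_val.1 (h _ (badClosed_natRel hN hN' hn' hX)),
    fun h Y hX => h {p | Y p.1 p.2} (pairsBadClosed_setOf hN hn' hX)⟩

/-- Numbers that are not states do no harm: `natRel` holds for them vacuously, and positive weights
in a step select genuine states. -/
theorem tab_reach_iff (hN : A.trans.length + A.n ≤ N) (hN' : A'.trans.length ≤ N)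
    (hn' : A'.n ≤ N) (s : Fin A.n) (s' : Fin A'.n) : (tab A A').Reach N s s' ↔
      ∀ X, PairsReachClosed A.toPTS A'.toPTS
        {p | ∀ X, PairsBadClosed A.toPTS A'.toPTS X → p ∈ X} X → (s, s') ∈ X := by
  constructor
  · refine fun h X hX => natRel_val.1 (h _ ⟨fun s _ s' _ hb hs hs' => hX.base _ fun hB => hb ?_, ?_⟩)
    · exact (tab_bad_iff hN hN' hn' ⟨s, hs⟩ ⟨s', hs'⟩).2 hB
    · intro a haN b hbN hM t _ t' _ hw hw' hX' hs hs'
      have hb : b < A'.trans.length := hM.1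
      have ha : a < A.trans.length + A.n := by
        obtain ⟨_, ⟨h2, -⟩ | ⟨-, h2, -⟩⟩ := hM <;> omega
      have h1 := hasWeights_tab (A' := A') (N := N) (by omega) ha
      have h2 := hasWeights_tab' (A := A) hn' hb
      have ht := h1.lt_of_pos hw
      have ht' := h2.lt_of_pos hw'
      have h3 := hX.step _ _ _ ⟨_, List.getElem_mem hb, rfl⟩ ⟨_, hs⟩ (A.distExt a)
        ((answers_iff hN hb).2 ⟨a, haN, hM, rfl, rfl, ha⟩) ⟨t, ht⟩ ((h1.mem_support_iff _).2 hw)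
        ⟨t', ht'⟩ ((h2.mem_support_iff _).2 hw') (hX' ht ht')
      have h4 : (tab A A').src' b = A'.trans[b].src := dif_pos hb
      have h5 : (⟨_, hs'⟩ : Fin A'.n) = A'.trans[b].src := Fin.ext h4
      rwa [h5]
  · refine fun h X hX => h {p | X p.1 p.2} ⟨fun p hp => hX.base _ (by omega) _ (by omega) ?_, ?_⟩
    · rwa [tab_bad_iff hN hN' hn' p.1 p.2]
    · rintro s' σ' μ' ⟨t, ht, heq⟩ s μ hμ u hu u' hu' hX'
      obtain ⟨b, hb, rfl⟩ := List.mem_iff_getElem.1 ht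
      simp only [Prod.mk.injEq] at heq
      obtain ⟨rfl, rfl, rfl⟩ := heq
      obtain ⟨a, haN, hM, hs, rfl, ha⟩ := (answers_iff hN hb).1 hμ
      have h1 := hasWeights_tab (A' := A') (N := N) (by omega) ha
      have h2 := hasWeights_tab' (A := A) hn' hb
      have h3 := hX.step a haN b (by omega) hM u (by omega) u' (by omega)
        ((h1.mem_support_iff _).1 hu) ((h2.mem_support_iff _).1 hu') hX'
      have h4 : (tab A A').src' b = A'.trans[b].src := dif_pos hb
      rw [hs, h4] at h3
      exact h3

theorem almostSureFailing_iff_tab (hN : A.trans.length + A.n ≤ N) (hN' : A'.trans.length ≤ N)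
    (hn' : A'.n ≤ N) : AlmostSureFailing A.toPTS A'.toPTS ↔
      ¬ (tab A A').Reach N A.init A'.init := by
  have hfin : ∀ {Act : Type} (A : RatPTS Act), A.toPTS.trans.Finite := fun A =>
    (A.trans.finite_toSet.image fun t => (t.src, t.act, t.dist)).subset fun _ ⟨t, ht, h⟩ =>
      ⟨t, ht, h.symm⟩
  rw [almostSureFailing_iff_pairs (hfin A) (hfin A'), tab_reach_iff hN hN' hn']
  rfl

end Table

/-! ### The decision procedure -/

section Decision

open RAM AExpr AProg

/-- The program that decides whether the masking game is almost-sure failing. -/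
def decisionProg : AProg :=
  seq (assign vPos (lit 1)) <|
  seq (parseProg vNumS vInit vNumT vRecs 2) <|
  seq (parseProg vNumS' vInit' vNumT' vRecs' 3) <|
  seq diracProg <| seq matchProg solveProg

variable (A : RatPTS ℕ) (A' : RatPTS (ℕ ⊕ ℕ))

theorem inp_encode {k : ℕ} (hk : k < (A.encode encodeAct).length) :
    (inputEnv (encodePair (A, A'))).inp (1 + k) = (A.encode encodeAct).getD k 0 := by
  rw [Nat.add_comm]
  exact (load_succ _ _).trans (List.getD_append _ _ _ _ hk)

theorem inp_encode' (k : ℕ) :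
    (inputEnv (encodePair (A, A'))).inp (1 + (A.encode encodeAct).length + k) =
      (A'.encode encodeAct').getD k 0 := by
  rw [show 1 + (A.encode encodeAct).length + k = k + (A.encode encodeAct).length + 1 by omega]
  refine (load_succ _ _).trans ((List.getD_append_right (A.encode encodeAct) _ 0
    (k + (A.encode encodeAct).length) (Nat.le_add_left _ _)).trans ?_)
  congr 1
  omega

/-- The loop bound exceeds the length of the input, which is at least the product of the numbers of
states and of transitions; the bits of the entries are covered by the part of the bound that comes
from their sum. -/
theorem tab_valid : (tab A A').Valid (inputEnv (encodePair (A, A'))).N ∧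
    A.n + A.trans.length + 3 ≤ (inputEnv (encodePair (A, A'))).N ∧
    A'.n + A'.trans.length + 3 ≤ (inputEnv (encodePair (A, A'))).N := by
  have h1 := RatPTS.length_encode length_encodeAct A
  have h2 := RatPTS.length_encode length_encodeAct' A'
  have h3 : (A.encode encodeAct).length + (A'.encode encodeAct').length + 100 ≤
      (inputEnv (encodePair (A, A'))).N := by
    rw [← List.length_append]
    exact Nat.le_add_right _ _
  have h4 := A.n_pos
  have h5 := A'.n_pos
  have h6 := A.trans_length_pos
  have h7 := A'.trans_length_pos
  have h8 : A.n + A.trans.length + 3 ≤ (inputEnv (encodePair (A, A'))).N := by nlinarith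
  have h9 : A'.n + A'.trans.length + 3 ≤ (inputEnv (encodePair (A, A'))).N := by nlinarith
  have hlt : ∀ z : ℕ, (z : ℤ) ∈ encodePair (A, A') → z < 2 ^ (inputEnv (encodePair (A, A'))).N := by
    intro z hz
    exact_mod_cast lt_two_pow_loopBound hz
  have hwt : ∀ t ∈ A.trans, ∀ i, t.wt i < 2 ^ (inputEnv (encodePair (A, A'))).N := by
    intro t ht i
    unfold RatTrans.wt
    split_ifs with hi
    · refine hlt _ (List.mem_append_left _ (List.mem_append_right _ (List.mem_flatMap.2 ⟨t, ht, ?_⟩)))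
      exact List.mem_append_right _ (List.mem_ofFn.2 ⟨_, rfl⟩)
    · positivity
  have hwt' : ∀ t ∈ A'.trans, ∀ i, t.wt i < 2 ^ (inputEnv (encodePair (A, A'))).N := by
    intro t ht i
    unfold RatTrans.wt
    split_ifs with hi
    · refine hlt _ (List.mem_append_right _ (List.mem_append_right _ (List.mem_flatMap.2 ⟨t, ht, ?_⟩)))
      exact List.mem_append_right _ (List.mem_ofFn.2 ⟨_, rfl⟩)
    · positivity
  refine ⟨⟨?_, ?_, ?_, ?_, ?_, ?_, ?_, ?_, ?_⟩, h8, h9⟩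
  · change A.n < _
    omega
  · change A'.n < _
    omega
  · change A.trans.length ≤ _
    omega
  · change A'.trans.length ≤ _
    omega
  · intro a _
    change dite _ _ _ < A.n
    split_ifs <;> omega
  · intro b _
    change dite _ _ _ < A'.n
    split_ifs <;> omega
  · intro a _ i _
    change dite _ _ _ < _
    split_ifs
    · exact hwt _ (List.getElem_mem _) _
    · exact Nat.one_lt_two_pow (by omega)
    · positivity
    · positivity
  · intro b _ i _
    change dite _ _ _ < _
    split_ifs
    · exact hwt' _ (List.getElem_mem _) _
    · positivity
  · intro b _
    change dite _ _ _ = 0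
    split_ifs
    · exact dif_neg (by omega)
    · rfl

theorem sem_decisionProg :
    decisionProg.sem (inputEnv (encodePair (A, A'))) (fun _ _ _ => 0) vRes 0 0 = 1 ↔
      AlmostSureFailing A.toPTS A'.toPTS := by
  obtain ⟨hD, hN1, hN2⟩ := tab_valid A A'
  have hN : 100 ≤ (inputEnv (encodePair (A, A'))).N :=
    (Nat.le_add_left 100 _).trans (Nat.le_add_right _ _)
  have h1 : (A.encode encodeAct).length = 3 + A.trans.length * (A.n + 2) :=
    RatPTS.length_encode length_encodeAct A
  rw [almostSureFailing_iff_tab (N := (inputEnv (encodePair (A, A'))).N) (by omega) (by omega)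
    (by omega)]
  have hinp := fun k => inp_encode A A' (k := k)
  have hinp' := inp_encode' A A'
  generalize inputEnv (encodePair (A, A')) = E at *
  rw [decisionProg]
  simp only [sem_seq]
  set σ₁ := (assign vPos (lit 1)).sem E fun _ _ _ => 0 with hσ₁
  have f₁ : ∀ c, c ≠ vPos → σ₁ c = 0 := fun c hc => by
    rw [hσ₁, sem_frame (by simpa [assign, writes] using hc)]
    rfl
  obtain ⟨p1, p2, p3, p4, p5⟩ := sem_parseProg (E := E) (e := 2)
    (show [vNumS, vInit, vNumT, vRecs, vPos, kA, kJ].Nodup by decide) (σ := σ₁) (P := 1)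
    (n := A.n) (i := A.init) (T := A.trans.length) (by simp [hσ₁]) (f₁ _ (by decide))
    (hinp 0 (by omega)) (hinp 1 (by omega)) (hinp 2 (by omega)) (by omega) (by omega)
  set σ₂ := (parseProg vNumS vInit vNumT vRecs 2).sem E σ₁ with hσ₂
  have hP : 1 + 3 + A.trans.length * (A.n + 2) = 1 + (A.encode encodeAct).length := by
    rw [h1, Nat.add_assoc]
  rw [hP] at p4
  obtain ⟨q1, q2, q3, -, q5⟩ := sem_parseProg (E := E) (e := 3)
    (show [vNumS', vInit', vNumT', vRecs', vPos, kA, kJ].Nodup by decide) (σ := σ₂)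
    (n := A'.n) (i := A'.init) (T := A'.trans.length) p4
    (by rw [hσ₂, sem_frame (by decide), f₁ _ (by decide)])
    (hinp' 0) (hinp' 1) (hinp' 2) (by omega) (by omega)
  set σ₃ := (parseProg vNumS' vInit' vNumT' vRecs' 3).sem E σ₂ with hσ₃
  have f₃ : ∀ c ∉ (parseProg vNumS' vInit' vNumT' vRecs' 3).writes, σ₃ c = σ₂ c :=
    fun c hc => sem_frame hc σ₂
  have hrec : ∀ a k, σ₃ vRecs a k = if h : a < A.trans.length then
      (A.trans[a].encode encodeAct).getD k 0 else 0 := by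
    intro a k
    rw [f₃ _ (by decide), p5]
    by_cases ha : a < A.trans.length
    · rw [dif_pos ha]
      by_cases hk : k < A.n + 2
      · have g : (A.encode encodeAct).getD (3 + a * (A.n + 2) + k) 0 =
            (A.trans[a].encode encodeAct).getD k 0 := RatPTS.getD_encode length_encodeAct A ha hk
        have : (a + 1) * (A.n + 2) ≤ A.trans.length * (A.n + 2) := Nat.mul_le_mul_right _ ha
        rw [Nat.succ_mul] at this
        rw [if_pos ⟨ha, hk⟩, ← g, ← hinp _ (by omega)]
        congr 1
        omega
      · rw [if_neg fun h => hk h.2, List.getD_eq_default]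
        rw [RatTrans.length_encode length_encodeAct]
        omega
    · rw [dif_neg ha, if_neg fun h => ha h.1]
  have hrec' : ∀ b k, σ₃ vRecs' b k = if h : b < A'.trans.length then
      (A'.trans[b].encode encodeAct').getD k 0 else 0 := by
    intro b k
    rw [q5]
    by_cases hb : b < A'.trans.length
    · rw [dif_pos hb]
      by_cases hk : k < A'.n + 3
      · have g : (A'.encode encodeAct').getD (3 + b * (A'.n + 3) + k) 0 =
            (A'.trans[b].encode encodeAct').getD k 0 :=
          RatPTS.getD_encode length_encodeAct' A' hb hk
        rw [if_pos ⟨hb, hk⟩, ← g, ← hinp']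
        congr 1
        omega
      · rw [if_neg fun h => hk h.2, List.getD_eq_default]
        rw [RatTrans.length_encode length_encodeAct']
        omega
    · rw [dif_neg hb, if_neg fun h => hb h.1]
  have hdir := sem_diracProg (E := E) (σ := σ₃) (n := A.n) (T := A.trans.length)
    (by rw [f₃ _ (by decide), p1]) (by rw [f₃ _ (by decide), p3]) (by omega)
    fun a k ha => by rw [hrec, dif_neg (by omega)]
  set σ₄ := diracProg.sem E σ₃ with hσ₄
  have f₄ : ∀ c ∉ diracProg.writes, σ₄ c = σ₃ c := fun c hc => sem_frame hc σ₃
  have hmat := sem_matchProg (E := E) (σ := σ₄) (n := A.n) (T := A.trans.length)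
    (T' := A'.trans.length) (by rw [f₄ _ (by decide), f₃ _ (by decide), p1])
    (by rw [f₄ _ (by decide), f₃ _ (by decide), p3]) (by rw [f₄ _ (by decide), q3])
    (by rw [f₄ _ (by decide), f₃ _ (by decide), hσ₂, sem_frame (by decide), f₁ _ (by decide)])
  set σ₅ := matchProg.sem E σ₄ with hσ₅
  have f₅ : ∀ c ∉ matchProg.writes, σ₅ c = σ₄ c := fun c hc => sem_frame hc σ₄
  have hT : HasTables (tab A A') E.N σ₅ := by
    refine ⟨?_, ?_, ?_, ?_, fun a _ => ?_, fun b _ => ?_, fun a _ i _ => ?_, fun b _ i _ => ?_, ?_⟩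
    · rw [f₅ _ (by decide), f₄ _ (by decide), f₃ _ (by decide), p1]
      rfl
    · rw [f₅ _ (by decide), f₄ _ (by decide), q1]
      rfl
    · rw [f₅ _ (by decide), f₄ _ (by decide), f₃ _ (by decide), p3]
      rfl
    · rw [f₅ _ (by decide), f₄ _ (by decide), q3]
      rfl
    · rw [f₅ _ (by decide), hdir, hrec]
      simp only [tab]
      split_ifs
      · exact RatTrans.getD_encode_zero _
      · rfl
      · rfl
    · rw [f₅ _ (by decide), f₄ _ (by decide), hrec']
      simp only [tab]
      split_ifs
      · exact RatTrans.getD_encode_zero _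
      · rfl
    · rw [f₅ _ (by decide), hdir, hrec]
      simp only [tab]
      rw [if_neg (Nat.succ_ne_zero (i + 1))]
      split_ifs <;> first | omega | rfl | exact RatTrans.getD_encode_weight length_encodeAct _ _
    · rw [f₅ _ (by decide), f₄ _ (by decide), hrec']
      simp only [tab]
      split_ifs
      · exact RatTrans.getD_encode_weight length_encodeAct' _ _
      · rfl
    · intro a ha b hb
      rw [hmat a ha b hb, f₄ _ (by decide)]
      rw [← exists_prop]
      refine exists_congr fun hbT => ?_
      have k1 : σ₃ vRecs' b 1 = (encodeAct' A'.trans[b].act).getD 0 0 := by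
        rw [hrec', dif_pos hbT, RatTrans.getD_encode_act _ (by rw [length_encodeAct']; omega)]
      have k2 : σ₃ vRecs' b 2 = (encodeAct' A'.trans[b].act).getD 1 0 := by
        rw [hrec', dif_pos hbT, RatTrans.getD_encode_act _ (by rw [length_encodeAct']; omega)]
      have k3 : ∀ h : a < A.trans.length, σ₄ vRecs a 1 = A.trans[a].act := by
        intro h
        rw [hdir, if_pos h, hrec, dif_pos h, RatTrans.getD_encode_act _ Nat.one_pos]
        rfl
      rw [k1, k2]
      refine or_congr ?_ (and_congr_right fun _ => and_congr_right fun _ => ?_)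
      · rw [← exists_prop]
        refine exists_congr fun h => ?_
        rw [k3 h]
        cases A'.trans[b].act with
        | inl σ => simp [encodeAct', eq_comm]
        | inr F => simp [encodeAct']
      · cases A'.trans[b].act with
        | inl σ => simp [encodeAct']
        | inr F => simp [encodeAct']
  have key := sem_solveProg hN hD hT
    (by rw [f₅ _ (by decide), f₄ _ (by decide), f₃ _ (by decide), hσ₂, sem_frame (by decide),
      f₁ _ (by decide)])
    (by rw [f₅ _ (by decide), f₄ _ (by decide), f₃ _ (by decide), hσ₂, sem_frame (by decide),
      f₁ _ (by decide)])
    (i := A.init) (i' := A'.init) (by rw [f₅ _ (by decide), f₄ _ (by decide), f₃ _ (by decide), p2])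
    (by rw [f₅ _ (by decide), f₄ _ (by decide), q2])
  exact key

theorem decidableInPolyTime_almostSureFailing : RAM.DecidableInPolyTime encodePair
    fun x => AlmostSureFailing x.1.toPTS x.2.toPTS := by
  refine decidableInPolyTime decisionProg ?_ fun x => sem_decisionProg x.1 x.2
  have h : ∀ {Act : Type} {act : Act → List ℤ}, (∀ a, ∀ z ∈ act a, 0 ≤ z) →
      ∀ A : RatPTS Act, ∀ z ∈ A.encode act, 0 ≤ z := by
    intro Act act hact A z hz
    rcases List.mem_append.1 hz with hz | hz
    · simp only [List.mem_cons, List.not_mem_nil, or_false] at hz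
      rcases hz with rfl | rfl | rfl <;> positivity
    · obtain ⟨t, -, hz⟩ := List.mem_flatMap.1 hz
      rcases List.mem_append.1 hz with hz | hz
      · rcases List.mem_cons.1 hz with rfl | hz
        · positivity
        · exact hact _ _ hz
      · obtain ⟨i, rfl⟩ := List.mem_ofFn.1 hz
        positivity
  intro x z hz
  rcases List.mem_append.1 hz with hz | hz
  · refine h (fun a z hz => ?_) _ z hz
    rw [List.mem_singleton.1 hz]
    positivity
  · refine h (fun a z hz => ?_) _ z hz
    cases a with
    | inl a =>
      rcases List.mem_cons.1 hz with rfl | hz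
      · exact le_rfl
      · rw [List.mem_singleton.1 hz]
        positivity
    | inr F =>
      rcases List.mem_cons.1 hz with rfl | hz
      · exact zero_le_one
      · rw [List.mem_singleton.1 hz]
        positivity

end Decision

end

end Masking

theorem mainTheorem4 :
    (∀ (S : Type*) (S' : Type*) (Act : Type*) (Flt : Type*) [Finite S] [Finite S']
        (A : PTS S Act) (A' : PTS S' (Act ⊕ Flt)),
        A.trans.Finite → A'.trans.Finite →
        (AlmostSureFailing A A' ↔
          (SymVertex.ref A.init A'.init : SymVertex A A') ∈
            Set.univ \ preStar SymVertex.existsPre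
              (Set.univ \ preStar SymVertex.forallPre {SymVertex.err}))) ∧
    RAM.DecidableInPolyTime encodePair
      (fun x => AlmostSureFailing x.1.toPTS x.2.toPTS) := by
  refine ⟨fun S S' Act Flt _ _ A A' hA hA' => almostSureFailing_iff hA hA',
    decidableInPolyTime_almostSureFailing⟩
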